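/- **Setting.** Fix a dimension $d\ge 1$ and a number $f\in\mathbb N$; both are constants. An *object* is a connected (in particular nonempty) bounded subset of $\mathbb R^d$. Hypercubes are closed and axis-parallel, and the *size* of an object is the side length of a minimal hypercube that encloses it. A finite collection $S$ of objects is *$f$-fat* if for every hypercube $R$ of side length $r>0$ there are at most $f$ points such that every object of $S$ that intersects $R$ and has size at least $r$ contains one of these points. A finite set of objects is *independent* if its members are pairwise disjoint. A *MIX* from $A$ to $B$ with loss at most $g$, where $A$ and $B$ are independent sets, is a sequence $M_0,M_1,\dots,M_{|A|+|B|}$ of independent subsets of $A\cup B$ with $M_0=A$ and $M_{|A|+|B|}=B$, such that $M_i$ and $M_{i+1}$ differ in exactly one object for every $i<|A|+|B|$, and $|M_i|\ge \min(|A|,|B|)-g$ for every $i$. *Machine model.* A real RAM with a fixed finite program, arrays of natural numbers and arrays of real numbers. Each operation costs one step: reading and writing an array cell; addition, truncated subtraction and halving with rounding down of natural numbers; $+,-,\times,/$ on reals; conversion of natural numbers to reals; comparisons (there is no rounding of reals). The input consists of $|A|$, $|B|$ and handles of the objects, in arbitrary order. In one step the machine can read, for a given object, a coordinate of some fixed point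 of the object, or a coordinate of the center or the side length of some fixed minimal enclosing hypercube, and can test whether the object is contained in, or is disjoint from, a given hypercube. The choices of the points and of the enclosing hypercubes are arbitrary. A *MIX algorithm* is a data structure that is initialized with $A$ and $B$ and has a single operation *Advance*, whose $(i+1)$-st call reports the single object in which $M_i$ and $M_{i+1}$ differ, for a MIX $M_0,\dots,M_{|A|+|B|}$ from $A$ to $B$. It has running time $\gamma$ if the initialization and the $|A|+|B|$ calls of Advance always take at most $n\,\gamma(n)$ steps in total, where $n=|A|+|B|\ge 1$. **Lemma.** For all constants $d\ge1$ and $f$ there are functions $\Gamma,\gamma:\mathbb N\to\mathbb R$ with $$\Gamma(n)=O\!\left(n^{1-\frac1d}\log n\right),\qquad \Gamma(n)=o(n),\qquad \gamma(n)=O(\log n),$$ and a MIX algorithm, such that for all independent sets $S_1$ and $S_2$ of objects in $\mathbb R^d$ each of which is an $f$-fat collection, with $n=|S_1|+|S_2|$, there is a MIX from $S_1$ to $S_2$ with loss at most $\Gamma(n)$, that is, all its sets have size at least $\min(|S_1|,|S_2|)-\Gamma(n)$; and, on every presentation of $S_1,S_2$ as an input, the algorithm computes such a MIX and has running time $\gamma$.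 In particular, the initialization with $S_1$ and $S_2$ and all steps of the MIX together take $O(n\log n)$ time. -/

import Mathlib

open Filter Asymptotics

namespace FatMix

/-! ## Geometry -/

/-- A point of `d`-dimensional space. Only the affine and coordinate structure is used. -/
abbrev Pt (d : ℕ) : Type := Fin d → ℝ

/-- The closed axis-parallel hypercube with center `c` and side length `s`. -/
def cube {d : ℕ} (c : Pt d) (s : ℝ) : Set (Pt d) :=
  {x | ∀ j, c j - s / 2 ≤ x j ∧ x j ≤ c j + s / 2}

/-- The size of an object: the least side length of a hypercube that contains it
(the infimum is attained for bounded objects). -/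
noncomputable def objSize {d : ℕ} (X : Set (Pt d)) : ℝ :=
  sInf {s : ℝ | 0 ≤ s ∧ ∃ c : Pt d, X ⊆ cube c s}

/-- An object: a connected (in particular nonempty), bounded subset of space. -/
def IsObject {d : ℕ} (X : Set (Pt d)) : Prop :=
  IsConnected X ∧ Bornology.IsBounded X

/-- A finite collection of objects is `f`-fat if for every box `R` of size `r` there are (at most)
`f` points such that every object of the collection that intersects `R` and has size at least `r`
contains one of these points. -/
def IsFat {d : ℕ} (f : ℕ) (S : Finset (Set (Pt d))) : Prop :=
  (∀ X ∈ S, IsObject X) ∧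
    ∀ (c : Pt d) (r : ℝ), 0 < r →
      ∃ P : Finset (Pt d), P.card ≤ f ∧
        ∀ X ∈ S, (X ∩ cube c r).Nonempty → r ≤ objSize X → ∃ p ∈ P, p ∈ X

/-- An independent set: the objects are pairwise disjoint. -/
def IsIndep {d : ℕ} (S : Finset (Set (Pt d))) : Prop :=
  (S : Set (Set (Pt d))).PairwiseDisjoint id

/-! ## MIX functions -/

open scoped Classical in
/-- `M 0, M 1, …, M (|A| + |B|)` is a MIX from `A` to `B` with loss at most `g`: it goes from `A` to
`B` through independent sets of objects of `A ∪ B`, consecutive sets differ by exactly one object,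
and every set has at least `min(|A|, |B|) - g` objects. -/
structure IsMix {d : ℕ} (A B : Finset (Set (Pt d))) (g : ℝ)
    (M : ℕ → Finset (Set (Pt d))) : Prop where
  start : M 0 = A
  finish : M (A.card + B.card) = B
  subset : ∀ i ≤ A.card + B.card, M i ⊆ A ∪ B
  indep : ∀ i ≤ A.card + B.card, IsIndep (M i)
  size : ∀ i ≤ A.card + B.card, ((min A.card B.card : ℕ) : ℝ) - g ≤ ((M i).card : ℝ)
  step : ∀ i < A.card + B.card, (symmDiff (M i) (M (i + 1))).card = 1

/-! ## The machine model: a real RAM with constant-time access to the objects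

The objects are given by handles `0, 1, 2, …`. For each object the machine can read off, in constant
time, the coordinates of some point of the object, and the center and side length of some minimal
enclosing hypercube; and it can test in constant time whether an object lies inside,
or is disjoint from, a given hypercube. -/

/-- An input: `m₁` is the number of objects of the first set (handles `0, …, m₁ - 1`), `m₂` the number
of objects of the second set (handles `m₁, …, m₁ + m₂ - 1`). -/
structure Input (d : ℕ) where
  m₁ : ℕ
  m₂ : ℕ
  obj : ℕ → Set (Pt d)
  rep : ℕ → Pt d
  center : ℕ → Pt d
  side : ℕ → ℝ

open scoped Classical in
/-- `I` is an input that presents the pair `A`, `B`. The order in which the objects are listed, the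
representative points and the choice of the minimal enclosing hypercubes are arbitrary, and
nothing is required of the values at numbers that are not handles. -/
structure Input.Presents {d : ℕ} (I : Input d) (A B : Finset (Set (Pt d))) : Prop where
  card₁ : I.m₁ = A.card
  card₂ : I.m₂ = B.card
  image₁ : (Finset.range I.m₁).image I.obj = A
  image₂ : (Finset.Ico I.m₁ (I.m₁ + I.m₂)).image I.obj = B
  rep_mem : ∀ i < I.m₁ + I.m₂, I.rep i ∈ I.obj i
  enclosing : ∀ i < I.m₁ + I.m₂, I.obj i ⊆ cube (I.center i) (I.side i)
  minimal : ∀ i < I.m₁ + I.m₂, I.side i = objSize (I.obj i)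

/-- The memory: arrays of natural numbers and arrays of real numbers. The first argument is the name
of the array (fixed in the program text), the second one is the address. -/
structure Store where
  nat : ℕ → ℕ → ℕ
  real : ℕ → ℕ → ℝ

/-- Write `v` to cell `i` of the `a`-th array of natural numbers. -/
def Store.setNat (σ : Store) (a i v : ℕ) : Store :=
  { σ with nat := Function.update σ.nat a (Function.update (σ.nat a) i v) }

/-- Write `x` to cell `i` of the `a`-th array of real numbers. -/
noncomputable def Store.setReal (σ : Store) (a i : ℕ) (x : ℝ) : Store :=
  { σ with real := Function.update σ.real a (Function.update (σ.real a) i x) }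

/-- Expressions for natural numbers (counters, addresses, handles). -/
inductive NExp where
  | const : ℕ → NExp
  | read : ℕ → NExp → NExp
  | plus : NExp → NExp → NExp
  | minus : NExp → NExp → NExp
  | half : NExp → NExp

/-- Expressions for real numbers. There is no rounding operation. `rep h j`, `center h j` are the
`j`-th coordinates of the representative point, and of the center of the enclosing hypercube, of the
object with handle `h`, and `side h` is the size of this object. -/
inductive RExp (d : ℕ) where
  | ofNat : NExp → RExp d
  | read : ℕ → NExp → RExp d
  | plus : RExp d → RExp d → RExp d
  | minus : RExp d → RExp d → RExp d
  | times : RExp d → RExp d → RExp d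
  | divide : RExp d → RExp d → RExp d
  | rep : NExp → Fin d → RExp d
  | center : NExp → Fin d → RExp d
  | side : NExp → RExp d

/-- Tests. `inside h c s`: the object with handle `h` is contained in the hypercube with center `c`
and side length `s`; `outside h c s`: it is disjoint from this hypercube. -/
inductive Test (d : ℕ) where
  | natLe : NExp → NExp → Test d
  | realLe : RExp d → RExp d → Test d
  | inside : NExp → (Fin d → RExp d) → RExp d → Test d
  | outside : NExp → (Fin d → RExp d) → RExp d → Test d
  | not : Test d → Test d
  | and : Test d → Test d → Test d

/-- Programs. -/
inductive Prog (d : ℕ) where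
  | skip : Prog d
  | setNat : ℕ → NExp → NExp → Prog d
  | setReal : ℕ → NExp → RExp d → Prog d
  | seq : Prog d → Prog d → Prog d
  | ite : Test d → Prog d → Prog d → Prog d
  | while : Test d → Prog d → Prog d

/-- The value of an expression for a natural number; subtraction is truncated, halving rounds down. -/
def NExp.val (σ : Store) : NExp → ℕ
  | .const k => k
  | .read a e => σ.nat a (e.val σ)
  | .plus e₁ e₂ => e₁.val σ + e₂.val σ
  | .minus e₁ e₂ => e₁.val σ - e₂.val σ
  | .half e => e.val σ / 2

/-- The number of operations in an expression. -/
def NExp.cost : NExp → ℕ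
  | .const _ => 1
  | .read _ e => e.cost + 1
  | .plus e₁ e₂ => e₁.cost + e₂.cost + 1
  | .minus e₁ e₂ => e₁.cost + e₂.cost + 1
  | .half e => e.cost + 1

/-- The value of an expression for a real number. -/
noncomputable def RExp.val {d : ℕ} (I : Input d) (σ : Store) : RExp d → ℝ
  | .ofNat e => (e.val σ : ℝ)
  | .read a e => σ.real a (e.val σ)
  | .plus x y => x.val I σ + y.val I σ
  | .minus x y => x.val I σ - y.val I σ
  | .times x y => x.val I σ * y.val I σ
  | .divide x y => x.val I σ / y.val I σ
  | .rep h j => I.rep (h.val σ) j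
  | .center h j => I.center (h.val σ) j
  | .side h => I.side (h.val σ)

/-- The number of operations in an expression. -/
def RExp.cost {d : ℕ} : RExp d → ℕ
  | .ofNat e => e.cost + 1
  | .read _ e => e.cost + 1
  | .plus x y => x.cost + y.cost + 1
  | .minus x y => x.cost + y.cost + 1
  | .times x y => x.cost + y.cost + 1
  | .divide x y => x.cost + y.cost + 1
  | .rep h _ => h.cost + 1
  | .center h _ => h.cost + 1
  | .side h => h.cost + 1

/-- The truth value of a test. -/
def Test.Holds {d : ℕ} (I : Input d) (σ : Store) : Test d → Prop
  | .natLe e₁ e₂ => e₁.val σ ≤ e₂.val σ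
  | .realLe x y => x.val I σ ≤ y.val I σ
  | .inside h c s => I.obj (h.val σ) ⊆ cube (fun j => (c j).val I σ) (s.val I σ)
  | .outside h c s => Disjoint (I.obj (h.val σ)) (cube (fun j => (c j).val I σ) (s.val I σ))
  | .not b => ¬ b.Holds I σ
  | .and b₁ b₂ => b₁.Holds I σ ∧ b₂.Holds I σ

/-- The number of operations in a test. -/
def Test.cost {d : ℕ} : Test d → ℕ
  | .natLe e₁ e₂ => e₁.cost + e₂.cost + 1
  | .realLe x y => x.cost + y.cost + 1
  | .inside h c s => h.cost + (∑ j, (c j).cost) + s.cost + 1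
  | .outside h c s => h.cost + (∑ j, (c j).cost) + s.cost + 1
  | .not b => b.cost + 1
  | .and b₁ b₂ => b₁.cost + b₂.cost + 1

/-- `Exec I p σ t σ'`: on input `I`, the program `p` started in memory `σ` halts after exactly `t` steps
in memory `σ'`. -/
inductive Exec {d : ℕ} (I : Input d) : Prog d → Store → ℕ → Store → Prop where
  | skip (σ : Store) : Exec I .skip σ 1 σ
  | setNat (a : ℕ) (e v : NExp) (σ : Store) :
      Exec I (.setNat a e v) σ (e.cost + v.cost + 1) (σ.setNat a (e.val σ) (v.val σ))
  | setReal (a : ℕ) (e : NExp) (x : RExp d) (σ : Store) :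
      Exec I (.setReal a e x) σ (e.cost + x.cost + 1) (σ.setReal a (e.val σ) (x.val I σ))
  | seq {p q : Prog d} {σ₀ σ₁ σ₂ : Store} {t₁ t₂ : ℕ} :
      Exec I p σ₀ t₁ σ₁ → Exec I q σ₁ t₂ σ₂ → Exec I (.seq p q) σ₀ (t₁ + t₂) σ₂
  | iteTrue {b : Test d} {p q : Prog d} {σ₀ σ₁ : Store} {t : ℕ} :
      b.Holds I σ₀ → Exec I p σ₀ t σ₁ → Exec I (.ite b p q) σ₀ (b.cost + t + 1) σ₁
  | iteFalse {b : Test d} {p q : Prog d} {σ₀ σ₁ : Store} {t : ℕ} :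
      ¬ b.Holds I σ₀ → Exec I q σ₀ t σ₁ → Exec I (.ite b p q) σ₀ (b.cost + t + 1) σ₁
  | whileTrue {b : Test d} {p : Prog d} {σ₀ σ₁ σ₂ : Store} {t₁ t₂ : ℕ} :
      b.Holds I σ₀ → Exec I p σ₀ t₁ σ₁ → Exec I (.while b p) σ₁ t₂ σ₂ →
        Exec I (.while b p) σ₀ (b.cost + t₁ + t₂ + 1) σ₂
  | whileFalse {b : Test d} {p : Prog d} {σ₀ : Store} :
      ¬ b.Holds I σ₀ → Exec I (.while b p) σ₀ (b.cost + 1) σ₀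

/-- A data structure with an initialization and the single operation `advance`; both act on the same
memory. -/
structure MixAlgorithm (d : ℕ) where
  setup : Prog d
  advance : Prog d

/-- The memory at the start: cells `0` and `1` of array `0` hold the sizes of the two sets, everything
else is zero. -/
def Input.initialStore {d : ℕ} (I : Input d) : Store where
  nat a i := if a = 0 ∧ i = 0 then I.m₁ else if a = 0 ∧ i = 1 then I.m₂ else 0
  real _ _ := 0

/-- The handle that was reported by the last call of `advance`: cell `2` of array `0`. -/
def Store.reported (σ : Store) : ℕ := σ.nat 0 2

/-- On input `I`, the initialization and `m₁ + m₂` subsequent calls of `advance` all halt, they take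
exactly `T` steps in total, and the `i`-th call (counted from `0`) reports the handle `out i`. -/
def MixAlgorithm.Runs {d : ℕ} (𝒜 : MixAlgorithm d) (I : Input d) (out : ℕ → ℕ) (T : ℕ) : Prop :=
  ∃ (σ : ℕ → Store) (t : ℕ → ℕ),
    Exec I 𝒜.setup I.initialStore (t 0) (σ 0) ∧
    (∀ i < I.m₁ + I.m₂, Exec I 𝒜.advance (σ i) (t (i + 1)) (σ (i + 1)) ∧
      (σ (i + 1)).reported = out i) ∧
    T = ∑ i ∈ Finset.range (I.m₁ + I.m₂ + 1), t i

open scoped Classical in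
/-- On input `I`, the algorithm realizes the sequence `M` in `T` steps in total: the `i`-th call of
`advance` reports a handle (a number below `m₁ + m₂`) of the single object in which `M i` and `M (i + 1)`
differ. -/
def MixAlgorithm.Realizes {d : ℕ} (𝒜 : MixAlgorithm d) (I : Input d)
    (M : ℕ → Finset (Set (Pt d))) (T : ℕ) : Prop :=
  ∃ out : ℕ → ℕ, 𝒜.Runs I out T ∧
    ∀ i < I.m₁ + I.m₂, out i < I.m₁ + I.m₂ ∧ symmDiff (M i) (M (i + 1)) = {I.obj (out i)}

end FatMix

namespace FatMix

/-! ## Reasoning about programs -/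

/-! A MIX is an order on all `n` objects: an object of the first set is removed when its turn comes,
an object of the second set is added. The order must put a new object after every old object that it
intersects, and the running count must not drop far below the smaller of its two end values. Such an
order comes from recursive balanced separators.

Separator. Take representative points of the objects and cut off a `2 ^ (-4 * d)` fraction of them
on every side in every coordinate. This gives a box with longest side `w` and center `c`. A cube `Q`
around `c` with half side between `w / 2` and `3 * w / 2` contains the box, and a hyperplane
orthogonal to the longest direction splits it. The parts are the objects in `Q` on either side of
the hyperplane and those outside `Q`; objects of different parts are disjoint, and each part misses
a constant fraction of the objects (`card_part_le`). By connectedness, an object in no part meets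
the boundary of `Q` or the hyperplane. Both positions, the radius and the cut, are taken in the
middle of a window that holds at most `m` representatives and has width at least `w * m / (2 * n)`;
repeated halving finds it (`window_spec`). A met object smaller than half the window has its
representative in the window, so there are at most `m` of these. For the larger ones, each facet of
`Q` and the slice of `Q` by the hyperplane is covered by about `(n / m) ^ (d - 1)` cubes of half the
window width; fatness pierces the large objects at each such cube by `f` points, and a point lies in
only one object of an independent set (`IsFatFamily.card_le`). With `m` about `n ^ (1 - 1 / d)` both
counts are `O(m)` (`card_met_le`).

Order. Remove the met objects of the first set, process recursively the parts that do not lose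
objects, then those that lose objects, and finally add the met objects of the second set. Apart from
the losses inside the parts, the count first dips by at most the number of removed met objects, then
rises, and then falls towards its final value. So one level of the recursion costs only the size of
its separator (`isValid_flatMap`). The depth is `O(log n)`, which gives the loss `O(n ^ (1 - 1 / d)
* log n)`; this is `o(n)` because `log n = o(n ^ (1 / d))`.

Time. The handles are sorted once in every coordinate. A segment of these arrays is processed in
linear time by a stable rearrangement that keeps every coordinate order (`node_spec`,
`node_effect`), so all levels together take `O(n * log n)` steps (`mainLoop_spec`). The
initialization computes the whole order, and each call of `advance` reads off one more handle. The
remaining work is a program logic for the machine: `Exec.nat_eq` as a frame rule, `Prog.exec_eval`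
for code without loops, and `exec_while` with a potential for loops. -/

theorem Store.setNat_nat (σ : Store) (a i v a' i' : ℕ) :
    (σ.setNat a i v).nat a' i' = if a' = a ∧ i' = i then v else σ.nat a' i' := by
  by_cases h : a' = a
  · subst h; by_cases h' : i' = i
    · subst h'; simp [Store.setNat]
    · simp [Store.setNat, h']
  · simp [Store.setNat, h]

theorem Store.setReal_real (σ : Store) (a i : ℕ) (v : ℝ) (a' i' : ℕ) :
    (σ.setReal a i v).real a' i' = if a' = a ∧ i' = i then v else σ.real a' i' := by
  by_cases h : a' = a
  · subst h; by_cases h' : i' = i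
    · subst h'; simp [Store.setReal]
    · simp [Store.setReal, h']
  · simp [Store.setReal, h]

@[simp] theorem Store.setNat_real (σ : Store) (a i v : ℕ) : (σ.setNat a i v).real = σ.real := rfl

@[simp] theorem Store.setReal_nat (σ : Store) (a i : ℕ) (v : ℝ) :
    (σ.setReal a i v).nat = σ.nat := rfl

theorem Store.setNat_nat_of_ne (σ : Store) (i v : ℕ) {a a' : ℕ} (h : a' ≠ a) :
    (σ.setNat a i v).nat a' = σ.nat a' := by
  simp [Store.setNat, h]

theorem Store.setReal_real_of_ne (σ : Store) (i : ℕ) (v : ℝ) {a a' : ℕ} (h : a' ≠ a) :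
    (σ.setReal a i v).real a' = σ.real a' := by
  simp [Store.setReal, h]

/-- The program contains an assignment to the `a`-th array of natural numbers. -/
def Prog.WritesNat {d : ℕ} : Prog d → ℕ → Prop
  | .skip, _ => False
  | .setNat b _ _, a => a = b
  | .setReal _ _ _, _ => False
  | .seq p q, a => p.WritesNat a ∨ q.WritesNat a
  | .ite _ p q, a => p.WritesNat a ∨ q.WritesNat a
  | .while _ p, a => p.WritesNat a

/-- The program contains an assignment to the `a`-th array of real numbers. -/
def Prog.WritesReal {d : ℕ} : Prog d → ℕ → Prop
  | .skip, _ => False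
  | .setNat _ _ _, _ => False
  | .setReal b _ _, a => a = b
  | .seq p q, a => p.WritesReal a ∨ q.WritesReal a
  | .ite _ p q, a => p.WritesReal a ∨ q.WritesReal a
  | .while _ p, a => p.WritesReal a

/-- The frame rule. The name of the array in an assignment is a constant of the program text, so a
syntactic check shows which arrays survive a phase of the algorithm. -/
theorem Exec.nat_eq {d : ℕ} {I : Input d} {p : Prog d} {σ σ' : Store} {t : ℕ}
    (h : Exec I p σ t σ') {a : ℕ} (ha : ¬ p.WritesNat a) : σ'.nat a = σ.nat a := by
  induction h with
  | skip | setReal => rfl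
  | setNat b e v σ => exact Store.setNat_nat_of_ne _ _ _ ha
  | seq _ _ h₁ h₂ => simp only [Prog.WritesNat, not_or] at ha; rw [h₂ ha.2, h₁ ha.1]
  | iteTrue _ _ h => simp only [Prog.WritesNat, not_or] at ha; exact h ha.1
  | iteFalse _ _ h => simp only [Prog.WritesNat, not_or] at ha; exact h ha.2
  | whileTrue _ _ _ h₁ h₂ => rw [h₂ ha, h₁ ha]
  | whileFalse => rfl

theorem Exec.real_eq {d : ℕ} {I : Input d} {p : Prog d} {σ σ' : Store} {t : ℕ}
    (h : Exec I p σ t σ') {a : ℕ} (ha : ¬ p.WritesReal a) : σ'.real a = σ.real a := by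
  induction h with
  | skip | setNat => rfl
  | setReal b e v σ => exact Store.setReal_real_of_ne _ _ _ ha
  | seq _ _ h₁ h₂ => simp only [Prog.WritesReal, not_or] at ha; rw [h₂ ha.2, h₁ ha.1]
  | iteTrue _ _ h => simp only [Prog.WritesReal, not_or] at ha; exact h ha.1
  | iteFalse _ _ h => simp only [Prog.WritesReal, not_or] at ha; exact h ha.2
  | whileTrue _ _ _ h₁ h₂ => rw [h₂ ha, h₁ ha]
  | whileFalse => rfl

/-- A program without loops. -/
def Prog.Straight {d : ℕ} : Prog d → Prop
  | .seq p q => p.Straight ∧ q.Straight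
  | .ite _ p q => p.Straight ∧ q.Straight
  | .while _ _ => False
  | _ => True

open scoped Classical in
/-- The effect of a program without loops. -/
noncomputable def Prog.eval {d : ℕ} (I : Input d) : Prog d → Store → Store
  | .skip, σ => σ
  | .setNat a e v, σ => σ.setNat a (e.val σ) (v.val σ)
  | .setReal a e x, σ => σ.setReal a (e.val σ) (x.val I σ)
  | .seq p q, σ => q.eval I (p.eval I σ)
  | .ite b p q, σ => if b.Holds I σ then p.eval I σ else q.eval I σ
  | .while _ _, σ => σ

/-- A bound for the running time of a program without loops. -/
def Prog.bound {d : ℕ} : Prog d → ℕ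
  | .skip => 1
  | .setNat _ e v => e.cost + v.cost + 1
  | .setReal _ e x => e.cost + x.cost + 1
  | .seq p q => p.bound + q.bound
  | .ite b p q => b.cost + (p.bound + q.bound) + 1
  | .while _ _ => 0

/-- Without loops the effect is a function of the memory and can be computed by rewriting. The time
is only bounded from above, since `bound` charges both branches of a conditional. -/
theorem Prog.exec_eval {d : ℕ} (I : Input d) (p : Prog d) (hp : p.Straight) (σ : Store) :
    ∃ t ≤ p.bound, Exec I p σ t (p.eval I σ) := by
  induction p generalizing σ with
  | skip => exact ⟨1, le_rfl, .skip σ⟩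
  | setNat a e v => exact ⟨_, le_rfl, .setNat a e v σ⟩
  | setReal a e x => exact ⟨_, le_rfl, .setReal a e x σ⟩
  | seq p q hp' hq' =>
    obtain ⟨t₁, h₁, e₁⟩ := hp' hp.1 σ
    obtain ⟨t₂, h₂, e₂⟩ := hq' hp.2 (p.eval I σ)
    exact ⟨_, Nat.add_le_add h₁ h₂, .seq e₁ e₂⟩
  | ite b p q hp' hq' =>
    by_cases hb : b.Holds I σ
    · obtain ⟨t, h, e⟩ := hp' hp.1 σ
      refine ⟨_, ?_, by simpa only [Prog.eval, if_pos hb] using Exec.iteTrue hb e⟩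
      simp only [Prog.bound]; omega
    · obtain ⟨t, h, e⟩ := hq' hp.2 σ
      refine ⟨_, ?_, by simpa only [Prog.eval, if_neg hb] using Exec.iteFalse hb e⟩
      simp only [Prog.bound]; omega
  | _ => exact hp.elim

/-- Total correctness of a loop; the potential `Φ` bounds its running time. -/
theorem exec_while {d : ℕ} {I : Input d} {b : Test d} {p : Prog d} (Inv : Store → Prop)
    (Φ : Store → ℕ)
    (step : ∀ σ, Inv σ → b.Holds I σ → ∃ t σ', Exec I p σ t σ' ∧ Inv σ' ∧
      Φ σ' + t + b.cost + 1 ≤ Φ σ) (σ : Store) (hσ : Inv σ) :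
    ∃ t σ', Exec I (.while b p) σ t σ' ∧ t ≤ Φ σ + b.cost + 1 ∧ Inv σ' ∧ ¬ b.Holds I σ' := by
  -- Every round lowers the potential by its full cost, which is at least one; this gives
  -- termination and the time bound at once.
  induction hn : Φ σ using Nat.strong_induction_on generalizing σ with
  | _ n ih =>
    by_cases hb : b.Holds I σ
    · obtain ⟨t₁, σ₁, e₁, i₁, h₁⟩ := step σ hσ hb
      obtain ⟨t₂, σ₂, e₂, h₂, i₂, hb₂⟩ := ih (Φ σ₁) (by omega) σ₁ i₁ rfl
      exact ⟨_, σ₂, .whileTrue hb e₁ e₂, by omega, i₂, hb₂⟩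
    · exact ⟨_, σ, .whileFalse hb, by omega, hσ, hb⟩

/-- The first cell of an array of natural numbers, used as a variable. -/
abbrev NExp.var (a : ℕ) : NExp := .read a (.const 0)

/-- The first cell of an array of real numbers, used as a variable. -/
abbrev RExp.var {d : ℕ} (a : ℕ) : RExp d := .read a (.const 0)

/-- Assignment to a variable for a natural number. -/
abbrev Prog.assign {d : ℕ} (a : ℕ) (e : NExp) : Prog d := .setNat a (.const 0) e

/-- Assignment to a variable for a real number. -/
abbrev Prog.assignReal {d : ℕ} (a : ℕ) (e : RExp d) : Prog d := .setReal a (.const 0) e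

/-- `body` for all values of variable `7` up to the value of variable `11` (exclusive). -/
def Prog.forLoop {d : ℕ} (body : Prog d) : Prog d :=
  .while (.natLe (.plus (.var 7) (.const 1)) (.var 11))
    (.seq body (.assign 7 (.plus (.var 7) (.const 1))))

/-- The invariant for `k + 1` is demanded after the counter has been increased, as this is the
memory in which the next round starts. The summand `20` pays for the test and the increment, and the
extra round in `y - x + 1` for the final failing test. -/
theorem exec_forLoop {d : ℕ} {I : Input d} {body : Prog d} (Inv : ℕ → Store → Prop) (K x y : ℕ)
    (hw : ¬ body.WritesNat 7) (hw' : ¬ body.WritesNat 11)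
    (step : ∀ k σ, x ≤ k → k < y → σ.nat 7 0 = k → Inv k σ →
      ∃ t σ', Exec I body σ t σ' ∧ t ≤ K ∧ Inv (k + 1) (σ'.setNat 7 0 (k + 1)))
    (σ : Store) (hx : σ.nat 7 0 = x) (hy : σ.nat 11 0 = y) (hxy : x ≤ y) (hσ : Inv x σ) :
    ∃ t σ', Exec I body.forLoop σ t σ' ∧ t ≤ (K + 20) * (y - x + 1) ∧ Inv y σ' := by
  obtain ⟨t, σ', e, ht, hI, hb⟩ := exec_while (I := I)
    (b := .natLe (.plus (.var 7) (.const 1)) (.var 11))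
    (p := .seq body (.assign 7 (.plus (.var 7) (.const 1))))
    (fun σ => x ≤ σ.nat 7 0 ∧ σ.nat 7 0 ≤ y ∧ σ.nat 11 0 = y ∧ Inv (σ.nat 7 0) σ)
    (fun σ => (K + 20) * (y - σ.nat 7 0)) (by
      rintro σ ⟨h₁, h₂, h₃, h₄⟩ hb
      simp only [Test.Holds, NExp.val] at hb
      obtain ⟨t, σ', e, ht, hI⟩ := step (σ.nat 7 0) σ h₁ (by omega) rfl h₄
      refine ⟨_, _, .seq e (.setNat _ _ _ _), ?_, ?_⟩
      · have h7 := congrFun (e.nat_eq hw) 0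
        have h11 := congrFun (e.nat_eq hw') 0
        simp only [NExp.val, Store.setNat_nat, h7, h11] at *
        simp only [and_self, if_true]
        refine ⟨by omega, by omega, h₃, hI⟩
      · have h7 := congrFun (e.nat_eq hw) 0
        simp only [NExp.val, Store.setNat_nat, h7, Test.cost, NExp.cost]
        simp only [and_self, if_true]
        have : y - σ.nat 7 0 = (y - (σ.nat 7 0 + 1)) + 1 := by omega
        rw [this, mul_add]; omega) σ ⟨hx.ge, hx ▸ hxy, hy, hx ▸ hσ⟩
  simp only [Test.Holds, NExp.val] at hb
  have h7 : σ'.nat 7 0 = y := by omega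
  refine ⟨t, σ', e, ?_, h7 ▸ hI.2.2.2⟩
  simp only [Test.cost, NExp.cost, hx] at ht
  rw [mul_add]; omega

/-- The composition of the programs `P j` for the elements `j` of a list. -/
def Prog.seqList {α : Type*} {d : ℕ} (P : α → Prog d) : List α → Prog d
  | [] => .skip
  | j :: js => .seq (P j) (Prog.seqList P js)

theorem Prog.straight_seqList {α : Type*} {d : ℕ} {P : α → Prog d} (h : ∀ j, (P j).Straight) :
    ∀ js, (Prog.seqList P js).Straight
  | [] => trivial
  | j :: js => ⟨h j, Prog.straight_seqList h js⟩

theorem Prog.writesNat_seqList {α : Type*} {d : ℕ} {P : α → Prog d} {a : ℕ} {js : List α} :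
    (Prog.seqList P js).WritesNat a ↔ ∃ j ∈ js, (P j).WritesNat a := by
  induction js with
  | nil => simp [Prog.seqList, Prog.WritesNat]
  | cons j js ih => simp [Prog.seqList, Prog.WritesNat, ih]

theorem Prog.writesReal_seqList {α : Type*} {d : ℕ} {P : α → Prog d} {a : ℕ} {js : List α} :
    (Prog.seqList P js).WritesReal a ↔ ∃ j ∈ js, (P j).WritesReal a := by
  induction js with
  | nil => simp [Prog.seqList, Prog.WritesReal]
  | cons j js ih => simp [Prog.seqList, Prog.WritesReal, ih]

/-! ## Segments of arrays -/

/-- The list of the values of `f` at `a, …, b - 1`. -/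
def seg {α : Type*} (f : ℕ → α) (a b : ℕ) : List α := (List.range' a (b - a)).map f

@[simp] theorem length_seg {α : Type*} (f : ℕ → α) (a b : ℕ) : (seg f a b).length = b - a := by
  simp [seg]

theorem seg_self {α : Type*} (f : ℕ → α) (a : ℕ) : seg f a a = [] := by simp [seg]

theorem seg_append {α : Type*} (f : ℕ → α) {a b c : ℕ} (h : a ≤ b) (h' : b ≤ c) :
    seg f a b ++ seg f b c = seg f a c := by
  have h2 : c - a = (b - a) + (c - b) := by omega
  rw [seg, seg, seg, ← List.map_append, h2, ← List.range'_append_1]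
  congr 3; omega

theorem seg_succ {α : Type*} (f : ℕ → α) {a b : ℕ} (h : a ≤ b) :
    seg f a (b + 1) = seg f a b ++ [f b] := by
  rw [← seg_append f h (Nat.le_succ b)]; simp [seg]

theorem seg_cons {α : Type*} (f : ℕ → α) {a b : ℕ} (h : a < b) :
    seg f a b = f a :: seg f (a + 1) b := by
  rw [← seg_append f (Nat.le_succ a) h]; simp [seg]

theorem seg_congr {α : Type*} {f g : ℕ → α} {a b : ℕ} (h : ∀ k, a ≤ k → k < b → f k = g k) :
    seg f a b = seg g a b := by
  apply List.map_congr_left; intro k hk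
  rw [List.mem_range'_1] at hk; exact h k hk.1 (by omega)

theorem mem_seg {α : Type*} {f : ℕ → α} {a b : ℕ} {x : α} :
    x ∈ seg f a b ↔ ∃ k, a ≤ k ∧ k < b ∧ f k = x := by
  simp only [seg, List.mem_map, List.mem_range'_1]
  constructor
  · rintro ⟨k, hk, rfl⟩; exact ⟨k, hk.1, by omega, rfl⟩
  · rintro ⟨k, h₁, h₂, rfl⟩; exact ⟨k, ⟨h₁, by omega⟩, rfl⟩

theorem getElem_seg {α : Type*} (f : ℕ → α) (a b k : ℕ) (h : k < (seg f a b).length) :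
    (seg f a b)[k] = f (a + k) := by
  simp [seg]

/-! ## Filtering a segment into another array -/

/-- Append the entries of array `src` at `lo, …, hi - 1` that satisfy `T` to array `dst`, at the
position held in variable `8`. The test may refer to variable `7`, the current index. -/
def appendIf {d : ℕ} (src dst : ℕ) (lo hi : NExp) (T : Test d) : Prog d :=
  .seq (.assign 11 hi) (.seq (.assign 7 lo) (Prog.forLoop
    (.ite T (.seq (.setNat dst (.var 8) (.read src (.var 7)))
      (.assign 8 (.plus (.var 8) (.const 1)))) .skip)))

/-- The test is evaluated in the intermediate memories of the loop, so its meaning `τ` is required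
in every memory that agrees with `σ` outside the arrays that the loop writes. The lower end is
evaluated after the upper end has been stored in array `11`, hence the form of its hypothesis. -/
theorem appendIf_spec {d : ℕ} (src dst : ℕ) (lo hi : NExp) (T : Test d) (hsd : src ≠ dst)
    (hs : src ≠ 7 ∧ src ≠ 8 ∧ src ≠ 11) (hd : dst ≠ 7 ∧ dst ≠ 8 ∧ dst ≠ 11) :
    ∃ C, ∀ (I : Input d) (σ : Store) (x y : ℕ) (τ : ℕ → Bool),
      (∀ v, lo.val (σ.setNat 11 0 v) = x) → hi.val σ = y → x ≤ y →
      (∀ σ' : Store, σ'.real = σ.real →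
        (∀ a, a ≠ 7 → a ≠ 8 → a ≠ 11 → a ≠ dst → σ'.nat a = σ.nat a) →
        ∀ k, x ≤ k → k < y → σ'.nat 7 0 = k → (T.Holds I σ' ↔ τ (σ.nat src k) = true)) →
      ∃ t σ', Exec I (appendIf src dst lo hi T) σ t σ' ∧ t ≤ C * (y - x + 1) ∧
        σ'.nat 8 0 = σ.nat 8 0 + ((seg (σ.nat src) x y).filter τ).length ∧
        seg (σ'.nat dst) (σ.nat 8 0) (σ'.nat 8 0) = (seg (σ.nat src) x y).filter τ ∧
        (∀ k, k < σ.nat 8 0 ∨ σ'.nat 8 0 ≤ k → σ'.nat dst k = σ.nat dst k) ∧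
        σ'.real = σ.real ∧
        ∀ a, a ≠ 7 → a ≠ 8 → a ≠ 11 → a ≠ dst → σ'.nat a = σ.nat a := by
  set body : Prog d := .ite T (.seq (.setNat dst (.var 8) (.read src (.var 7)))
      (.assign 8 (.plus (.var 8) (.const 1)))) .skip with hbody
  refine ⟨body.bound + 20 + (hi.cost + lo.cost + 4), fun I σ x y τ hlo hhi hxy hT => ?_⟩
  set p₀ := σ.nat 8 0
  have hst : body.Straight := by simp [hbody, Prog.Straight]
  let Inv : ℕ → Store → Prop := fun k σ' =>
    σ'.real = σ.real ∧ (∀ a, a ≠ 7 → a ≠ 8 → a ≠ 11 → a ≠ dst → σ'.nat a = σ.nat a) ∧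
    σ'.nat 8 0 = p₀ + ((seg (σ.nat src) x k).filter τ).length ∧
    seg (σ'.nat dst) p₀ (σ'.nat 8 0) = (seg (σ.nat src) x k).filter τ ∧
    (∀ k, k < p₀ ∨ σ'.nat 8 0 ≤ k → σ'.nat dst k = σ.nat dst k)
  obtain ⟨t, σ', e, ht, hr, hn, h8, hseg, hun⟩ := exec_forLoop (I := I) (body := body) Inv
    body.bound x y (by simp [hbody, Prog.WritesNat, hd.1.symm])
    (by simp [hbody, Prog.WritesNat, hd.2.2.symm]) (by
      rintro k σ' hxk hky h7 ⟨hr, hn, h8, hseg, hun⟩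
      obtain ⟨t, ht, e⟩ := body.exec_eval I hst σ'
      refine ⟨t, _, e, ht, ?_⟩
      have hTk := hT σ' hr hn k hxk hky h7
      have hsrc : σ'.nat src k = σ.nat src k := by rw [hn src hs.1 hs.2.1 hs.2.2 hsd]
      simp only [hbody, Prog.eval, NExp.val, h7]
      by_cases hτ : τ (σ.nat src k) = true
      · rw [if_pos (hTk.2 hτ)]
        have hd1 := hd.1; have hd2 := hd.2.1
        refine ⟨by simpa using hr, ?_, ?_, ?_, ?_⟩
        · intro a h7 h8 h11 hda
          rw [Store.setNat_nat_of_ne _ _ _ h7, Store.setNat_nat_of_ne _ _ _ h8,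
            Store.setNat_nat_of_ne _ _ _ hda, hn a h7 h8 h11 hda]
        · simp [Store.setNat_nat, hd2.symm, seg_succ _ hxk, List.filter_append, hτ, h8]; omega
        · have : ∀ k' , ((((σ'.setNat dst (σ'.nat 8 0) (σ'.nat src k)).setNat 8 0
              ((σ'.setNat dst (σ'.nat 8 0) (σ'.nat src k)).nat 8 0 + 1)).setNat 7 0 (k + 1)).nat
              dst) k' = if k' = σ'.nat 8 0 then σ.nat src k else σ'.nat dst k' := by
            intro k'; simp [Store.setNat_nat, hd1, hd2, hsrc]
          have h8' : (((σ'.setNat dst (σ'.nat 8 0) (σ'.nat src k)).setNat 8 0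
              ((σ'.setNat dst (σ'.nat 8 0) (σ'.nat src k)).nat 8 0 + 1)).setNat 7 0 (k + 1)).nat
              8 0 = σ'.nat 8 0 + 1 := by simp [Store.setNat_nat, hd2.symm]
          rw [h8', seg_succ _ (by omega), this, if_pos rfl, seg_succ _ hxk, List.filter_append,
            ← hseg]
          congr 1
          · apply seg_congr; intro k' _ hk'; rw [this, if_neg (by omega)]
          · simp [hτ]
        · intro k' hk'
          simp only [Store.setNat_nat] at hk' ⊢
          simp only [hd1, hd2, hd2.symm, false_and, if_false, true_and] at hk' ⊢
          simp at hk'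
          rw [if_neg (by omega)]
          exact hun k' (by omega)
      · rw [if_neg (mt hTk.1 hτ)]
        have hd1 := hd.1
        refine ⟨by simpa using hr, ?_, ?_, ?_, ?_⟩
        · intro a h7 h8 h11 hda
          rw [Store.setNat_nat_of_ne _ _ _ h7, hn a h7 h8 h11 hda]
        · simp [Store.setNat_nat, seg_succ _ hxk, List.filter_append, hτ, h8]
        · rw [Store.setNat_nat_of_ne _ _ _ hd1, Store.setNat_nat_of_ne _ _ _ (by decide), hseg,
            seg_succ _ hxk, List.filter_append]
          simp [hτ]
        · rw [Store.setNat_nat_of_ne _ _ _ hd1, Store.setNat_nat_of_ne _ _ _ (by decide)]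
          exact hun)
    ((σ.setNat 11 0 y).setNat 7 0 x) (by simp [Store.setNat_nat]) (by simp [Store.setNat_nat]) hxy
    (by
      refine ⟨rfl, ?_, ?_, ?_, ?_⟩
      · intro a h7 h8 h11 hda
        rw [Store.setNat_nat_of_ne _ _ _ h7, Store.setNat_nat_of_ne _ _ _ h11]
      · simp [Store.setNat_nat, seg_self, p₀]
      · have : ((σ.setNat 11 0 y).setNat 7 0 x).nat 8 0 = p₀ := by simp [Store.setNat_nat, p₀]
        rw [this, seg_self, seg_self]; rfl
      · intro k hk
        rw [Store.setNat_nat_of_ne _ _ _ hd.1, Store.setNat_nat_of_ne _ _ _ hd.2.2])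
  have e₁ : Exec I (.assign 11 hi) σ _ _ := .setNat 11 (.const 0) hi σ
  have e₂ : Exec I (.assign 7 lo) _ _ _ := .setNat 7 (.const 0) lo
    (σ.setNat 11 ((NExp.const 0).val σ) (hi.val σ))
  simp only [NExp.val, hhi, hlo] at e₁ e₂
  refine ⟨_, σ', .seq e₁ (.seq e₂ e), ?_, h8, hseg, hun, hr, hn⟩
  rw [add_mul]
  have : hi.cost + lo.cost + 4 ≤ (hi.cost + lo.cost + 4) * (y - x + 1) :=
    Nat.le_mul_of_pos_right _ (by omega)
  simp only [NExp.cost]; omega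

/-! ## Finding a sparse window -/

/-- A test that always holds. -/
abbrev Test.true {d : ℕ} : Test d := .natLe (.const 0) (.const 0)

theorem copy_spec {d : ℕ} (src dst : ℕ) (lo hi : NExp) (hsd : src ≠ dst)
    (hs : src ≠ 7 ∧ src ≠ 8 ∧ src ≠ 11) (hd : dst ≠ 7 ∧ dst ≠ 8 ∧ dst ≠ 11) :
    ∃ C, ∀ (I : Input d) (σ : Store) (x y : ℕ),
      (∀ v, lo.val (σ.setNat 11 0 v) = x) → hi.val σ = y → x ≤ y →
      ∃ t σ', Exec I (appendIf src dst lo hi .true) σ t σ' ∧ t ≤ C * (y - x + 1) ∧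
        σ'.nat 8 0 = σ.nat 8 0 + (y - x) ∧
        seg (σ'.nat dst) (σ.nat 8 0) (σ'.nat 8 0) = seg (σ.nat src) x y ∧
        (∀ k, k < σ.nat 8 0 ∨ σ'.nat 8 0 ≤ k → σ'.nat dst k = σ.nat dst k) ∧
        σ'.real = σ.real ∧
        ∀ a, a ≠ 7 → a ≠ 8 → a ≠ 11 → a ≠ dst → σ'.nat a = σ.nat a := by
  obtain ⟨C, h⟩ := appendIf_spec (d := d) src dst lo hi .true hsd hs hd
  refine ⟨C, fun I σ x y hlo hhi hxy => ?_⟩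
  simpa using h I σ x y (fun _ => .true) hlo hhi hxy (by simp [Test.Holds])

/-- The key of the handle in the current cell of array `23`. -/
abbrev windowKey {d : ℕ} : RExp d := .read 5 (.read 23 (.var 7))

/-- Halve the window between the real variables `1` and `2`, and keep the half with fewer keys. -/
def windowStep {d : ℕ} : Prog d :=
  .seq (.seq (.assignReal 8 (.divide (.plus (.var 1) (.var 2)) (.ofNat (.const 2))))
    (.assign 8 (.const 0)))
  (.seq (appendIf 23 24 (.const 0) (.var 10) (.not (.realLe (.var 8) windowKey)))
  (.seq (.seq (.assign 12 (.var 8)) (.assign 8 (.const 0)))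
  (.seq (appendIf 23 25 (.const 0) (.var 10) (.realLe (.var 8) windowKey))
  (.seq (.seq (.assign 13 (.var 8)) (.assign 8 (.const 0)))
  (.seq (.ite (.natLe (.var 12) (.var 13))
      (.seq (.assignReal 2 (.var 8)) (appendIf 24 23 (.const 0) (.var 12) .true))
      (.seq (.assignReal 1 (.var 8)) (appendIf 25 23 (.const 0) (.var 13) .true)))
    (.assign 10 (.var 8)))))))

/-- The keys below the midpoint and the keys from the midpoint on partition the list, so the shorter
of the two sublists has at most half of the entries. -/
theorem windowStep_spec {d : ℕ} : ∃ C, ∀ (I : Input d) (σ : Store),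
    ∃ t σ', Exec I windowStep σ t σ' ∧ t ≤ C * (σ.nat 10 0 + 1) ∧
      σ'.nat 10 0 ≤ σ.nat 10 0 / 2 ∧
      ((σ'.real 1 0 = σ.real 1 0 ∧ σ'.real 2 0 = (σ.real 1 0 + σ.real 2 0) / 2 ∧
        seg (σ'.nat 23) 0 (σ'.nat 10 0) = (seg (σ.nat 23) 0 (σ.nat 10 0)).filter
          (fun h => ¬ (σ.real 1 0 + σ.real 2 0) / 2 ≤ σ.real 5 h)) ∨
       (σ'.real 2 0 = σ.real 2 0 ∧ σ'.real 1 0 = (σ.real 1 0 + σ.real 2 0) / 2 ∧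
        seg (σ'.nat 23) 0 (σ'.nat 10 0) = (seg (σ.nat 23) 0 (σ.nat 10 0)).filter
          (fun h => (σ.real 1 0 + σ.real 2 0) / 2 ≤ σ.real 5 h))) := by
  obtain ⟨C₁, s₁⟩ := appendIf_spec (d := d) 23 24 (.const 0) (.var 10)
    (.not (.realLe (.var 8) windowKey)) (by decide) (by decide) (by decide)
  obtain ⟨C₂, s₂⟩ := appendIf_spec (d := d) 23 25 (.const 0) (.var 10)
    (.realLe (.var 8) windowKey) (by decide) (by decide) (by decide)
  obtain ⟨C₃, s₃⟩ := copy_spec (d := d) 24 23 (.const 0) (.var 12)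
    (by decide) (by decide) (by decide)
  obtain ⟨C₄, s₄⟩ := copy_spec (d := d) 25 23 (.const 0) (.var 13)
    (by decide) (by decide) (by decide)
  refine ⟨C₁ + C₂ + C₃ + C₄ + 200, fun I σ => ?_⟩
  set c := σ.nat 10 0 with hc
  set mid := (σ.real 1 0 + σ.real 2 0) / 2 with hmid
  obtain ⟨t₁, b₁, e₁⟩ := Prog.exec_eval I (.seq
    (.assignReal 8 (.divide (.plus (.var 1) (.var 2)) (.ofNat (.const 2))))
    (.assign 8 (.const 0))) (by simp [Prog.Straight]) σ
  simp only [Prog.bound, RExp.cost, NExp.cost] at b₁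
  simp only [Prog.eval, NExp.val, RExp.val] at e₁
  set σ₁ := (σ.setReal 8 0 ((σ.real 1 0 + σ.real 2 0) / ((2 : ℕ) : ℝ))).setNat 8 0 0 with hσ₁
  have r₁ : ∀ a, a ≠ 8 → σ₁.real a = σ.real a := fun a ha => by
    rw [hσ₁, Store.setNat_real, Store.setReal_real_of_ne _ _ _ ha]
  have m₁ : σ₁.real 8 0 = mid := by simp [hσ₁, Store.setReal_real, hmid]
  have n₁ : ∀ a, a ≠ 8 → σ₁.nat a = σ.nat a := fun a ha => by
    rw [hσ₁, Store.setNat_nat_of_ne _ _ _ ha, Store.setReal_nat]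
  have p₁ : σ₁.nat 8 0 = 0 := by simp [hσ₁, Store.setNat_nat]
  obtain ⟨t₂, σ₂, e₂, b₂, p₂, f₂, -, r₂, n₂⟩ := s₁ I σ₁ 0 c (fun h => ¬ mid ≤ σ.real 5 h)
    (by simp [NExp.val]) (by simp [NExp.val, n₁, hc]) (by omega) (by
      intro σ' hr hn k _ _ h7
      simp [Test.Holds, RExp.val, NExp.val, h7, hr, hn, m₁, r₁])
  rw [p₁, n₁ 23 (by decide)] at p₂ f₂
  obtain ⟨t₃, b₃, e₃⟩ := Prog.exec_eval I (.seq (.assign 12 (.var 8)) (.assign 8 (.const 0)))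
    (by simp [Prog.Straight]) σ₂
  simp only [Prog.bound, NExp.cost] at b₃
  simp only [Prog.eval, NExp.val] at e₃
  set σ₃ := (σ₂.setNat 12 0 (σ₂.nat 8 0)).setNat 8 0 0 with hσ₃
  have r₃ : σ₃.real = σ₁.real := by rw [← r₂]; rfl
  have p₃ : σ₃.nat 8 0 = 0 := by simp [hσ₃, Store.setNat_nat]
  have n₃ : ∀ a, a ≠ 8 → a ≠ 12 → σ₃.nat a = σ₂.nat a := fun a h h' => by
    rw [hσ₃, Store.setNat_nat_of_ne _ _ _ h, Store.setNat_nat_of_ne _ _ _ h']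
  obtain ⟨t₄, σ₄, e₄, b₄, p₄, f₄, -, r₄, n₄⟩ := s₂ I σ₃ 0 c (fun h => mid ≤ σ.real 5 h)
    (by simp [NExp.val]) (by simp [NExp.val, n₃, n₂, n₁, hc]) (by omega) (by
      intro σ' hr hn k _ _ h7
      simp [Test.Holds, RExp.val, NExp.val, h7, hr, hn, r₃, m₁, r₁, n₃, n₂])
  have h23 : σ₃.nat 23 = σ.nat 23 := by simp [n₃, n₂, n₁]
  rw [p₃, h23] at p₄ f₄
  have h12 : σ₄.nat 12 0 = σ₂.nat 8 0 := by simp [n₄, hσ₃, Store.setNat_nat]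
  have h24 : σ₄.nat 24 = σ₂.nat 24 := by simp [n₄, n₃]
  obtain ⟨t₅, b₅, e₅⟩ := Prog.exec_eval I (.seq (.assign 13 (.var 8)) (.assign 8 (.const 0)))
    (by simp [Prog.Straight]) σ₄
  simp only [Prog.bound, NExp.cost] at b₅
  simp only [Prog.eval, NExp.val] at e₅
  set σ₅ := (σ₄.setNat 13 0 (σ₄.nat 8 0)).setNat 8 0 0 with hσ₅
  have r₅ : σ₅.real = σ₁.real := by rw [← r₃, ← r₄]; rfl
  have p₅ : σ₅.nat 8 0 = 0 := by simp [hσ₅, Store.setNat_nat]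
  have n₅ : ∀ a, a ≠ 8 → a ≠ 13 → σ₅.nat a = σ₄.nat a := fun a h h' => by
    rw [hσ₅, Store.setNat_nat_of_ne _ _ _ h, Store.setNat_nat_of_ne _ _ _ h']
  have h13 : σ₅.nat 13 0 = σ₄.nat 8 0 := by simp [hσ₅, Store.setNat_nat]
  have hsum : σ₂.nat 8 0 + σ₄.nat 8 0 = c := by
    rw [p₂, p₄]
    have := List.length_eq_length_filter_add (l := seg (σ.nat 23) 0 c)
      (fun h => decide (mid ≤ σ.real 5 h))
    rw [length_seg] at this
    simp only [decide_not]
    omega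
  by_cases hle : σ₂.nat 8 0 ≤ σ₄.nat 8 0
  · have hT : (Test.natLe (.var 12) (.var 13) : Test d).Holds I σ₅ := by
      simp [Test.Holds, NExp.val, h13, n₅, h12, hle]
    obtain ⟨t₇, σ₇, e₇, b₇, p₇, f₇, -, r₇, n₇⟩ := s₃ I (σ₅.setReal 2 0 (σ₅.real 8 0)) 0
      (σ₂.nat 8 0) (by simp [NExp.val]) (by simp [NExp.val, n₅, h12]) (by omega)
    rw [Store.setReal_nat, p₅] at p₇ f₇
    refine ⟨_, _, .seq e₁ (.seq e₂ (.seq e₃ (.seq e₄ (.seq e₅ (.seq (.iteTrue hT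
      (.seq (.setReal _ _ _ _) e₇)) (.setNat _ _ _ _)))))), ?_, ?_, .inl ⟨?_, ?_, ?_⟩⟩
    · have : C₃ * (σ₂.nat 8 0 - 0 + 1) ≤ C₃ * (c + 1) := Nat.mul_le_mul_left _ (by omega)
      simp only [NExp.cost, RExp.cost, Test.cost, add_mul, Nat.sub_zero] at *
      have : 0 ≤ C₄ * (c + 1) := Nat.zero_le _
      omega
    · simp [Store.setNat_nat, NExp.val, p₇]; omega
    · simp [r₇, Store.setReal_real, r₅, r₁, NExp.val]
    · simp [r₇, Store.setReal_real, r₅, m₁, NExp.val]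
    · rw [Store.setNat_nat_of_ne _ _ _ (by decide)]
      simp only [Store.setNat_nat, NExp.val, and_self, if_true]
      rw [f₇, n₅ 24 (by decide) (by decide), h24, f₂]
  · have hT : ¬ (Test.natLe (.var 12) (.var 13) : Test d).Holds I σ₅ := by
      simp [Test.Holds, NExp.val, h13, n₅, h12, lt_of_not_ge hle]
    obtain ⟨t₇, σ₇, e₇, b₇, p₇, f₇, -, r₇, n₇⟩ := s₄ I (σ₅.setReal 1 0 (σ₅.real 8 0)) 0
      (σ₄.nat 8 0) (by simp [NExp.val]) (by simp [NExp.val, h13]) (by omega)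
    rw [Store.setReal_nat, p₅] at p₇ f₇
    refine ⟨_, _, .seq e₁ (.seq e₂ (.seq e₃ (.seq e₄ (.seq e₅ (.seq (.iteFalse hT
      (.seq (.setReal _ _ _ _) e₇)) (.setNat _ _ _ _)))))), ?_, ?_, .inr ⟨?_, ?_, ?_⟩⟩
    · have : C₄ * (σ₄.nat 8 0 - 0 + 1) ≤ C₄ * (c + 1) := Nat.mul_le_mul_left _ (by omega)
      simp only [NExp.cost, RExp.cost, Test.cost, add_mul, Nat.sub_zero] at *
      have : 0 ≤ C₃ * (c + 1) := Nat.zero_le _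
      omega
    · simp [Store.setNat_nat, NExp.val, p₇]; omega
    · simp [r₇, Store.setReal_real, r₅, r₁, NExp.val]
    · simp [r₇, Store.setReal_real, r₅, m₁, NExp.val]
    · rw [Store.setNat_nat_of_ne _ _ _ (by decide)]
      simp only [Store.setNat_nat, NExp.val, and_self, if_true]
      rw [f₇, n₅ 25 (by decide) (by decide), f₄]

/-- Shrink the window between the real variables `1` and `2` until it contains at most as many keys as
variable `2` says. -/
def window {d : ℕ} : Prog d := .while (.not (.natLe (.var 10) (.var 2))) windowStep

theorem window_writesNat {d a : ℕ} (h : (window : Prog d).WritesNat a) :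
    a ∈ [7, 8, 10, 11, 12, 13, 23, 24, 25] := by
  simp [window, windowStep, appendIf, Prog.forLoop, Prog.WritesNat] at h
  simp; tauto

theorem window_writesReal {d a : ℕ} (h : (window : Prog d).WritesReal a) : a ∈ [1, 2, 8] := by
  simp [window, windowStep, appendIf, Prog.forLoop, Prog.WritesReal] at h
  simp; tauto

theorem filter_filter_of_imp {α : Type*} {p q : α → Bool} (h : ∀ x, p x = .true → q x = .true)
    (l : List α) : (l.filter q).filter p = l.filter p := by
  rw [List.filter_filter]; congr; ext x
  by_cases hx : p x = .true
  · simp [hx, h x hx]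
  · simp [hx]

/-- A halving step halves the width and at least halves the number of keys, so width divided by
count never falls below its initial value, which is at least the initial width over `N`. A step is
made only while there are more than `m` keys, where `m` is the value of variable `2`; hence the
width after it is at least `m / (2 * N)` of the initial width. The counts decrease geometrically, so
the total time is linear. -/
theorem window_spec {d : ℕ} : ∃ C, ∀ (I : Input d) (σ : Store) (N : ℕ) (l : List ℕ),
    seg (σ.nat 23) 0 (σ.nat 10 0) = l → l.length ≤ N → σ.nat 2 0 ≤ N →
    σ.real 1 0 ≤ σ.real 2 0 →
    ∃ t σ', Exec I window σ t σ' ∧ t ≤ C * (l.length + 1) ∧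
      σ.real 1 0 ≤ σ'.real 1 0 ∧ σ'.real 1 0 ≤ σ'.real 2 0 ∧ σ'.real 2 0 ≤ σ.real 2 0 ∧
      (l.filter (fun h => σ'.real 1 0 < σ.real 5 h ∧ σ.real 5 h < σ'.real 2 0)).length
        ≤ σ.nat 2 0 ∧
      (σ.real 2 0 - σ.real 1 0) * σ.nat 2 0 ≤ (σ'.real 2 0 - σ'.real 1 0) * (2 * N) := by
  obtain ⟨C, hC⟩ := windowStep_spec (d := d)
  refine ⟨4 * C + 30, fun I σ N l hl hlN hmN hLH => ?_⟩
  have hlc : l.length = σ.nat 10 0 := by rw [← hl]; simp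
  obtain ⟨t, σ', e, ht, ⟨h₁, h₂, h₃, h₄, h₅, h₆, h₇, h₈⟩, hb⟩ := exec_while (I := I)
    (b := .not (.natLe (.var 10) (.var 2))) (p := windowStep)
    (fun σ' => σ.real 1 0 ≤ σ'.real 1 0 ∧ σ'.real 1 0 ≤ σ'.real 2 0 ∧
      σ'.real 2 0 ≤ σ.real 2 0 ∧ σ'.real 5 = σ.real 5 ∧ σ'.nat 2 = σ.nat 2 ∧
      -- The current list may also contain keys outside the window, since all keys of the segment
      -- are loaded at the start. Only the keys strictly inside matter, and none of these is lost.
      l.filter (fun h => σ'.real 1 0 < σ.real 5 h ∧ σ.real 5 h < σ'.real 2 0) =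
        (seg (σ'.nat 23) 0 (σ'.nat 10 0)).filter
          (fun h => σ'.real 1 0 < σ.real 5 h ∧ σ.real 5 h < σ'.real 2 0) ∧
      (σ.real 2 0 - σ.real 1 0) * σ.nat 2 0 ≤ (σ'.real 2 0 - σ'.real 1 0) * (2 * N) ∧
      (σ.real 2 0 - σ.real 1 0) * σ'.nat 10 0 ≤ (σ'.real 2 0 - σ'.real 1 0) * N)
    (fun σ' => (4 * C + 20) * σ'.nat 10 0) (by
      rintro σ₁ ⟨h₁, h₂, h₃, h₄, h₅, h₆, h₇, h₈⟩ hb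
      simp only [Test.Holds, NExp.val, not_le, h₅] at hb
      obtain ⟨t, σ', e, ht, hcnt, hor⟩ := hC I σ₁
      have hr5 : σ'.real 5 = σ₁.real 5 := e.real_eq (fun h => by
        have := window_writesReal (d := d) (a := 5) h; simp at this)
      have hn2 : σ'.nat 2 = σ₁.nat 2 := e.nat_eq (fun h => by
        have := window_writesNat (d := d) (a := 2) h; simp at this)
      have hD : 0 ≤ σ.real 2 0 - σ.real 1 0 := by linarith
      have hc1 : (σ.nat 2 0 : ℝ) ≤ σ₁.nat 10 0 := by exact_mod_cast hb.le
      have hc2 : 2 * (σ'.nat 10 0 : ℝ) ≤ σ₁.nat 10 0 := by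
        have : 2 * σ'.nat 10 0 ≤ σ₁.nat 10 0 := by omega
        exact_mod_cast this
      have a₁ := mul_le_mul_of_nonneg_left hc1 hD
      have a₂ := mul_le_mul_of_nonneg_left hc2 hD
      refine ⟨t, σ', e, ?_, ?_⟩
      · rcases hor with ⟨hL, hH, hs⟩ | ⟨hH, hL, hs⟩
        · rw [hL, hH, hr5, hn2, hs]
          refine ⟨h₁, by linarith, by linarith, h₄, h₅, ?_, by linarith, by linarith⟩
          rw [h₄, filter_filter_of_imp (fun h => by simp), ← filter_filter_of_imp
            (p := fun h => decide (σ₁.real 1 0 < σ.real 5 h ∧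
              σ.real 5 h < (σ₁.real 1 0 + σ₁.real 2 0) / 2)) (fun h => ?_), h₆,
            filter_filter_of_imp (fun h => ?_)]
          all_goals
            simp only [decide_eq_true_eq]; rintro ⟨a, b⟩; exact ⟨a, by linarith⟩
        · rw [hL, hH, hr5, hn2, hs]
          refine ⟨by linarith, by linarith, h₃, h₄, h₅, ?_, by linarith, by linarith⟩
          rw [h₄, filter_filter_of_imp (fun h => ?_), ← filter_filter_of_imp
            (p := fun h => decide ((σ₁.real 1 0 + σ₁.real 2 0) / 2 < σ.real 5 h ∧
              σ.real 5 h < σ₁.real 2 0)) (fun h => ?_), h₆, filter_filter_of_imp (fun h => ?_)]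
          · simp only [decide_eq_true_eq]; rintro ⟨a, b⟩; exact ⟨by linarith, b⟩
          · simp only [decide_eq_true_eq]; rintro ⟨a, b⟩; exact ⟨by linarith, b⟩
          · simp only [decide_eq_true_eq]; rintro ⟨a, b⟩; exact a.le
      · have := hcnt
        have hpos : 1 ≤ σ₁.nat 10 0 := by omega
        simp only [Test.cost, NExp.cost]
        have : (4 * C + 20) * σ'.nat 10 0 ≤ (4 * C + 20) * (σ₁.nat 10 0 / 2) :=
          Nat.mul_le_mul_left _ hcnt
        have h2 : (4 * C + 20) * (σ₁.nat 10 0 / 2) = (2 * C + 10) * (2 * (σ₁.nat 10 0 / 2)) := by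
          ring
        have h3 : (2 * C + 10) * (2 * (σ₁.nat 10 0 / 2)) ≤ (2 * C + 10) * σ₁.nat 10 0 :=
          Nat.mul_le_mul_left _ (by omega)
        nlinarith) σ ⟨le_rfl, hLH, le_rfl, rfl, rfl, by rw [hl], by
          have : (σ.nat 2 0 : ℝ) ≤ N := by exact_mod_cast hmN
          nlinarith, by
          have : (σ.nat 10 0 : ℝ) ≤ N := by exact_mod_cast hlc ▸ hlN
          nlinarith⟩
  refine ⟨t, σ', e, ?_, h₁, h₂, h₃, ?_, h₇⟩
  · rw [hlc]; simp only [Test.cost, NExp.cost] at ht; nlinarith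
  · simp only [Test.Holds, NExp.val, not_not, h₅] at hb
    rw [h₆]; refine (List.length_filter_le _ _).trans ?_
    simpa using hb

/-! ## Choosing the separator of a segment -/

/-- The `e`-fold half of `x`. -/
def NExp.halves (x : NExp) : ℕ → NExp
  | 0 => x
  | e + 1 => .half (x.halves e)

theorem NExp.val_halves (σ : Store) (x : NExp) (e : ℕ) :
    (x.halves e).val σ = x.val σ / 2 ^ e := by
  induction e with
  | zero => simp [NExp.halves]
  | succ e ih => rw [NExp.halves, NExp.val, ih, Nat.div_div_eq_div_mul, pow_succ]

/-- Equality of natural numbers. -/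
def Test.natEq {d : ℕ} (x y : NExp) : Test d := .and (.natLe x y) (.natLe y x)

theorem Test.holds_natEq {d : ℕ} (I : Input d) (σ : Store) (x y : NExp) :
    (Test.natEq x y).Holds I σ ↔ x.val σ = y.val σ := by
  simp only [Test.natEq, Test.Holds]; omega

/-- Compute the quantiles in direction `j`, the `j`-th coordinate of the center, and update the longest
side seen so far. -/
def quantileStep {d : ℕ} (j : Fin d) : Prog d :=
  .seq (.assignReal 9 (.rep (.read (100 + j) (.plus (.var 4) (.var 6))) j))
  (.seq (.assignReal 10 (.rep (.read (100 + j) (.minus (.var 5) (.plus (.const 1) (.var 6)))) j))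
  (.seq (.setReal 6 (.const j) (.divide (.plus (.var 9) (.var 10)) (.ofNat (.const 2))))
  (.ite (.realLe (.minus (.var 10) (.var 9)) (.var 0)) .skip
    (.seq (.assignReal 0 (.minus (.var 10) (.var 9)))
    (.seq (.assign 9 (.const j))
    (.seq (.assignReal 1 (.var 9)) (.assignReal 2 (.var 10))))))))

/-- Compute the box of quantiles. -/
def quantiles (d : ℕ) : Prog d :=
  .seq (.seq (.assignReal 0 (.ofNat (.const 0)))
    (.seq (.assignReal 1 (.ofNat (.const 0))) (.seq (.assignReal 2 (.ofNat (.const 0)))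
      (.assign 9 (.const 0)))))
    (Prog.seqList quantileStep (List.finRange d))

theorem straight_quantiles (d : ℕ) : (quantiles d).Straight :=
  ⟨by simp [Prog.Straight], Prog.straight_seqList (fun j => by
    simp [quantileStep, Prog.Straight]) _⟩

theorem eval_quantileStep {d : ℕ} (I : Input d) (σ : Store) (j : Fin d) (lo hi : ℝ)
    (hlo : lo = I.rep (σ.nat (100 + j) (σ.nat 4 0 + σ.nat 6 0)) j)
    (hhi : hi = I.rep (σ.nat (100 + j) (σ.nat 5 0 - (1 + σ.nat 6 0))) j) :
    let σ' := (quantileStep j).eval I σ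
    (∀ a, a ≠ 9 → σ'.nat a = σ.nat a) ∧
    (∀ k, σ'.real 6 k = if k = j then (lo + hi) / 2 else σ.real 6 k) ∧
    (hi - lo ≤ σ.real 0 0 → σ'.nat 9 = σ.nat 9 ∧ σ'.real 0 = σ.real 0 ∧ σ'.real 1 = σ.real 1 ∧
      σ'.real 2 = σ.real 2) ∧
    (σ.real 0 0 < hi - lo → σ'.nat 9 0 = j ∧ σ'.real 0 0 = hi - lo ∧ σ'.real 1 0 = lo ∧
      σ'.real 2 0 = hi) := by
  intro σ'
  by_cases h : hi - lo ≤ σ.real 0 0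
  · have : σ' = ((σ.setReal 9 0 lo).setReal 10 0 hi).setReal 6 j ((lo + hi) / 2) := by
      simp only [σ', quantileStep, Prog.eval, Test.Holds, RExp.val, NExp.val,
        Store.setReal_real, Store.setReal_nat]
      simp [h, ← hlo, ← hhi]
    rw [this]
    refine ⟨fun a _ => rfl, fun k => by simp [Store.setReal_real], fun _ => ⟨rfl, ?_, ?_, ?_⟩,
      fun h' => absurd h (not_le.2 h')⟩
    all_goals
      rw [Store.setReal_real_of_ne _ _ _ (by decide), Store.setReal_real_of_ne _ _ _ (by decide),
        Store.setReal_real_of_ne _ _ _ (by decide)]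
  · have : σ' = ((((((σ.setReal 9 0 lo).setReal 10 0 hi).setReal 6 j ((lo + hi) / 2)).setReal 0 0
        (hi - lo)).setNat 9 0 j).setReal 1 0 lo).setReal 2 0 hi := by
      simp only [σ', quantileStep, Prog.eval, Test.Holds, RExp.val, NExp.val,
        Store.setReal_real, Store.setReal_nat, Store.setNat_real]
      simp [h, ← hlo, ← hhi]
    rw [this]
    refine ⟨fun a ha => ?_, fun k => by simp [Store.setReal_real], fun h' => absurd h' h,
      fun _ => ?_⟩
    · simp only [Store.setReal_nat]; exact Store.setNat_nat_of_ne _ _ _ ha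
    · simp [Store.setReal_real, Store.setNat_nat]

/-- The record starts at `0`, so it ends as the maximum of `0` and the longest side. If no side is
positive, the two window ends remain equal, and this is the degenerate alternative of the last
clause. -/
theorem eval_quantiles {d : ℕ} (hd : 1 ≤ d) (I : Input d) (σ : Store) (lo hi : Fin d → ℝ)
    (hlo : ∀ j, lo j = I.rep (σ.nat (100 + j) (σ.nat 4 0 + σ.nat 6 0)) j)
    (hhi : ∀ j, hi j = I.rep (σ.nat (100 + j) (σ.nat 5 0 - (1 + σ.nat 6 0))) j) :
    let σ' := (quantiles d).eval I σ
    (∀ a, a ≠ 9 → σ'.nat a = σ.nat a) ∧ 0 ≤ σ'.real 0 0 ∧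
    (∀ j, hi j - lo j ≤ σ'.real 0 0) ∧ (∀ j : Fin d, σ'.real 6 j = (lo j + hi j) / 2) ∧
    ∃ j : Fin d, σ'.nat 9 0 = j ∧ ((σ'.real 0 0 = 0 ∧ σ'.real 1 0 = σ'.real 2 0) ∨
      (σ'.real 0 0 = hi j - lo j ∧ 0 < σ'.real 0 0 ∧
        σ'.real 1 0 = lo j ∧ σ'.real 2 0 = hi j)) := by
  -- Generalized for the induction: `s` is the set of directions that have been treated already.
  suffices H : ∀ (js : List (Fin d)) (s : Finset (Fin d)) (σ₁ : Store),
      (∀ a, a ≠ 9 → σ₁.nat a = σ.nat a) → 0 ≤ σ₁.real 0 0 →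
      (∀ j ∈ s, hi j - lo j ≤ σ₁.real 0 0) →
      (∀ j ∈ s, σ₁.real 6 j = (lo j + hi j) / 2) →
      (∃ j : Fin d, σ₁.nat 9 0 = j ∧ ((σ₁.real 0 0 = 0 ∧ σ₁.real 1 0 = σ₁.real 2 0) ∨
        (σ₁.real 0 0 = hi j - lo j ∧ 0 < σ₁.real 0 0 ∧
          σ₁.real 1 0 = lo j ∧ σ₁.real 2 0 = hi j))) →
      let σ' := (Prog.seqList quantileStep js).eval I σ₁
      (∀ a, a ≠ 9 → σ'.nat a = σ.nat a) ∧ 0 ≤ σ'.real 0 0 ∧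
      (∀ j, j ∈ s ∨ j ∈ js → hi j - lo j ≤ σ'.real 0 0) ∧
      (∀ j, j ∈ s ∨ j ∈ js → σ'.real 6 j = (lo j + hi j) / 2) ∧
      (∃ j : Fin d, σ'.nat 9 0 = j ∧ ((σ'.real 0 0 = 0 ∧ σ'.real 1 0 = σ'.real 2 0) ∨
        (σ'.real 0 0 = hi j - lo j ∧ 0 < σ'.real 0 0 ∧
          σ'.real 1 0 = lo j ∧ σ'.real 2 0 = hi j))) by
    have := H (List.finRange d) ∅ ((((σ.setReal 0 0 0).setReal 1 0 0).setReal 2 0 0).setNat 9 0 0)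
      (fun a ha => by simp [Store.setNat_nat_of_ne _ _ _ ha]) (by simp [Store.setReal_real])
      (by simp) (by simp) ⟨⟨0, hd⟩, by simp [Store.setReal_real, Store.setNat_nat]⟩
    simpa [quantiles, Prog.eval, RExp.val, NExp.val] using this
  intro js
  induction js with
  | nil =>
    intro s σ₁ h₁ h₂ h₃ h₄ h₅
    simp only [Prog.seqList, Prog.eval, List.not_mem_nil, or_false]
    exact ⟨h₁, h₂, h₃, h₄, h₅⟩
  | cons j js ih =>
    intro s σ₁ h₁ h₂ h₃ h₄ h₅
    obtain ⟨g₁, g₂, g₃, g₄⟩ := eval_quantileStep I σ₁ j (lo j) (hi j)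
      (by rw [hlo, h₁ _ (by omega), h₁ _ (by omega), h₁ _ (by omega)])
      (by rw [hhi, h₁ _ (by omega), h₁ _ (by omega), h₁ _ (by omega)])
    have hC : ∀ j' ∈ insert j s, ((quantileStep j).eval I σ₁).real 6 j' = (lo j' + hi j') / 2 := by
      intro j' hj'
      rw [g₂]
      by_cases hjj : j' = j
      · subst hjj; simp
      · rw [if_neg (by simpa [Fin.ext_iff] using hjj)]
        exact h₄ j' ((Finset.mem_insert.1 hj').resolve_left hjj)
    have := ih (insert j s) ((quantileStep j).eval I σ₁) (fun a ha => by rw [g₁ a ha, h₁ a ha])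
      ?_ ?_ hC ?_
    · simp only [Prog.seqList, Prog.eval]
      simp only [Finset.mem_insert] at this
      refine ⟨this.1, this.2.1, fun j' hj' => this.2.2.1 j' ?_, fun j' hj' => this.2.2.2.1 j' ?_,
        this.2.2.2.2⟩ <;>
      · rw [List.mem_cons] at hj'; tauto
    · rcases le_or_gt (hi j - lo j) (σ₁.real 0 0) with h | h
      · rw [(g₃ h).2.1]; exact h₂
      · rw [(g₄ h).2.1]; linarith
    · intro j' hj'
      rcases le_or_gt (hi j - lo j) (σ₁.real 0 0) with h | h
      · rw [(g₃ h).2.1]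
        rcases Finset.mem_insert.1 hj' with rfl | hj'
        · exact h
        · exact h₃ j' hj'
      · rw [(g₄ h).2.1]
        rcases Finset.mem_insert.1 hj' with rfl | hj'
        · exact le_rfl
        · exact (h₃ j' hj').trans h.le
    · rcases le_or_gt (hi j - lo j) (σ₁.real 0 0) with h | h
      · obtain ⟨k₁, k₂, k₃, k₄⟩ := g₃ h
        rw [k₁, k₂, k₃, k₄]; exact h₅
      · obtain ⟨k₁, k₂, k₃, k₄⟩ := g₄ h
        exact ⟨j, k₁, .inr ⟨k₂, by rw [k₂]; linarith, k₃, k₄⟩⟩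

/-- The handle at the current position of the segment. -/
abbrev current : NExp := .read 100 (.var 7)

/-- Run `body` for all positions of the segment. -/
def forSegment {d : ℕ} (body : Prog d) : Prog d :=
  .seq (.seq (.assign 7 (.var 4)) (.assign 11 (.var 5))) body.forLoop

/-- Common loop for the two kinds of keys. Keys are stored by handle and `v` depends on the handle
only, so a repeated handle would be overwritten by the same value and no injectivity is needed. -/
theorem fillKey_spec {d : ℕ} (body : Prog d) (hs : body.Straight)
    (hn : ∀ a, ¬ body.WritesNat a) : ∃ C, ∀ (I : Input d) (σ : Store) (v : ℕ → ℝ),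
    σ.nat 4 0 ≤ σ.nat 5 0 →
    (∀ σ' : Store, (∀ a, a ≠ 7 → a ≠ 11 → σ'.nat a = σ.nat a) →
      (∀ a, ¬ body.WritesReal a → σ'.real a = σ.real a) →
      (body.eval I σ').real 5 = Function.update (σ'.real 5) (σ'.nat 100 (σ'.nat 7 0))
        (v (σ'.nat 100 (σ'.nat 7 0)))) →
    ∃ t σ', Exec I (forSegment body) σ t σ' ∧ t ≤ C * (σ.nat 5 0 - σ.nat 4 0 + 1) ∧
      ∀ h ∈ seg (σ.nat 100) (σ.nat 4 0) (σ.nat 5 0), σ'.real 5 h = v h := by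
  refine ⟨body.bound + 40, fun I σ v hab hb => ?_⟩
  obtain ⟨t₁, b₁, e₁⟩ := Prog.exec_eval I (.seq (.assign 7 (.var 4)) (.assign 11 (.var 5)))
    (by simp [Prog.Straight]) σ
  simp only [Prog.bound, NExp.cost] at b₁
  simp only [Prog.eval, NExp.val] at e₁
  set σ₁ := (σ.setNat 7 0 (σ.nat 4 0)).setNat 11 0 ((σ.setNat 7 0 (σ.nat 4 0)).nat 5 0) with hσ₁
  have n₁ : ∀ a, a ≠ 7 → a ≠ 11 → σ₁.nat a = σ.nat a := fun a h h' => by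
    rw [hσ₁, Store.setNat_nat_of_ne _ _ _ h', Store.setNat_nat_of_ne _ _ _ h]
  obtain ⟨t₂, σ₂, e₂, b₂, i₂⟩ := exec_forLoop (I := I) (body := body)
    (fun k σ' => (∀ a, a ≠ 7 → a ≠ 11 → σ'.nat a = σ.nat a) ∧
      (∀ a, ¬ body.WritesReal a → σ'.real a = σ.real a) ∧
      ∀ h ∈ seg (σ.nat 100) (σ.nat 4 0) k, σ'.real 5 h = v h)
    body.bound (σ.nat 4 0) (σ.nat 5 0) (hn 7) (hn 11) (by
      rintro k σ' hk hk' h7 ⟨g₁, g₂, g₃⟩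
      obtain ⟨t, ht, e⟩ := body.exec_eval I hs σ'
      have h5 := hb σ' g₁ g₂
      rw [h7, g₁ 100 (by decide) (by decide)] at h5
      refine ⟨t, _, e, ht, fun a h h' => ?_, fun a ha => ?_, fun h hh => ?_⟩
      · rw [Store.setNat_nat_of_ne _ _ _ h, e.nat_eq (hn a), g₁ a h h']
      · rw [Store.setNat_real, e.real_eq ha, g₂ a ha]
      · rw [Store.setNat_real, h5, Function.update_apply]
        split_ifs with hc
        · rw [hc]
        · rw [seg_succ _ hk, List.mem_append, List.mem_singleton] at hh
          exact g₃ h (hh.resolve_right hc)) σ₁ (by simp [hσ₁, Store.setNat_nat])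
    (by simp [hσ₁, Store.setNat_nat]) hab ⟨n₁, fun a _ => rfl, by simp [seg_self]⟩
  refine ⟨_, σ₂, .seq e₁ e₂, ?_, i₂.2.2⟩
  simp only [add_mul] at b₂ ⊢; omega

/-- Store the coordinate of the current point in the selected direction as its key. -/
def coordKey (d : ℕ) : Prog d :=
  Prog.seqList (fun j : Fin d => .ite (.natEq (.var 9) (.const j))
    (.setReal 5 current (.rep current j)) .skip) (List.finRange d)

/-- The selected direction is known only at run time, whereas the coordinate in `RExp.rep` is fixed
in the program text. So the program compares the direction with each of the `d` possible values. -/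
theorem eval_coordKey {d : ℕ} (I : Input d) (σ : Store) (j : Fin d) (hj : σ.nat 9 0 = j) :
    ((coordKey d).eval I σ).real 5 = Function.update (σ.real 5) (σ.nat 100 (σ.nat 7 0))
        (I.rep (σ.nat 100 (σ.nat 7 0)) j) := by
  have H : ∀ (js : List (Fin d)) (σ₁ : Store), σ₁.nat = σ.nat →
      ((Prog.seqList (fun j : Fin d => .ite (.natEq (.var 9) (.const j))
        (.setReal 5 current (.rep current j)) .skip) js).eval I σ₁).real 5 =
      if j ∈ js then Function.update (σ₁.real 5) (σ.nat 100 (σ.nat 7 0))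
        (I.rep (σ.nat 100 (σ.nat 7 0)) j) else σ₁.real 5 := by
    intro js
    induction js with
    | nil => intro σ₁ _; simp [Prog.seqList, Prog.eval]
    | cons i js ih =>
      intro σ₁ h₁
      simp only [Prog.seqList, Prog.eval, Test.holds_natEq, NExp.val, h₁, hj, Fin.val_inj,
        RExp.val]
      by_cases hi : j = i
      · subst hi
        rw [if_pos rfl, ih _ (by simpa using h₁)]
        simp [Store.setReal]
      · rw [if_neg hi, ih _ h₁]
        simp [hi]
  rw [coordKey, H _ σ rfl, if_pos (List.mem_finRange j)]

/-- Make real variable `9` at least `x`. -/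
def raise {d : ℕ} (x : RExp d) : Prog d := .ite (.realLe x (.var 9)) .skip (.assignReal 9 x)

/-- Store the distance of the current point from the center as its key. -/
def distKey (d : ℕ) : Prog d :=
  .seq (.assignReal 9 (.ofNat (.const 0)))
  (.seq (Prog.seqList (fun j : Fin d => .seq
    (raise (.minus (.rep current j) (.read 6 (.const j))))
    (raise (.minus (.read 6 (.const j)) (.rep current j)))) (List.finRange d))
  (.setReal 5 current (.var 9)))

theorem eval_raise {d : ℕ} (I : Input d) (σ : Store) (x : RExp d) :
    (raise x).eval I σ = σ.setReal 9 0 (max (σ.real 9 0) (x.val I σ)) := by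
  by_cases h : (Test.realLe x (.var 9)).Holds I σ
  · have h' : x.val I σ ≤ σ.real 9 0 := h
    rw [raise, Prog.eval, if_pos h, Prog.eval, max_eq_left h']
    cases σ; simp [Store.setReal]
  · have h' : ¬ x.val I σ ≤ σ.real 9 0 := h
    rw [raise, Prog.eval, if_neg h, max_eq_right (le_of_not_ge h')]; rfl

/-- The metric on `Pt d` is the maximum metric, so the distance is the largest of `0` and the signed
coordinate differences in both directions. -/
theorem eval_distKey {d : ℕ} (I : Input d) (σ : Store) (c : Pt d)
    (hc : ∀ j : Fin d, σ.real 6 j = c j) :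
    ((distKey d).eval I σ).real 5 = Function.update (σ.real 5) (σ.nat 100 (σ.nat 7 0))
        (dist (I.rep (σ.nat 100 (σ.nat 7 0))) c) := by
  set h := σ.nat 100 (σ.nat 7 0) with hh
  -- The running maximum is described by its upper bounds, the form in which `dist_pi_le_iff`
  -- describes the distance.
  have H : ∀ (js : List (Fin d)) (σ₁ : Store), σ₁.nat = σ.nat →
      (∀ a, a ≠ 9 → σ₁.real a = σ.real a) → 0 ≤ σ₁.real 9 0 →
      let σ' := (Prog.seqList (fun j : Fin d => .seq
        (raise (.minus (.rep current j) (.read 6 (.const j))))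
        (raise (.minus (.read 6 (.const j)) (.rep current j)))) js).eval I σ₁
      σ'.nat = σ.nat ∧ (∀ a, a ≠ 9 → σ'.real a = σ.real a) ∧ 0 ≤ σ'.real 9 0 ∧
      ∀ r, 0 ≤ r → (σ'.real 9 0 ≤ r ↔ σ₁.real 9 0 ≤ r ∧ ∀ j ∈ js, dist (I.rep h j) (c j) ≤ r) := by
    intro js
    induction js with
    | nil =>
      intro σ₁ h₁ h₂ h₃
      simp only [Prog.seqList, Prog.eval]
      exact ⟨h₁, h₂, h₃, by simp⟩
    | cons i js ih =>
      intro σ₁ h₁ h₂ h₃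
      simp only [Prog.seqList, Prog.eval, eval_raise, RExp.val, NExp.val, Store.setReal_real,
        Store.setReal_nat, h₁, ← hh]
      simp only [and_self, if_true, false_and, if_false, (by decide : ¬ (6 = 9)),
        h₂ 6 (by decide), hc]
      obtain ⟨g₁, g₂, g₃, g₄⟩ := ih ((σ₁.setReal 9 0 (max (σ₁.real 9 0) (I.rep h i - c i))).setReal
        9 0 (max (max (σ₁.real 9 0) (I.rep h i - c i)) (c i - I.rep h i))) h₁
        (fun a ha => by rw [Store.setReal_real_of_ne _ _ _ ha, Store.setReal_real_of_ne _ _ _ ha,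
          h₂ a ha]) (by simp [Store.setReal_real, h₃])
      refine ⟨g₁, g₂, g₃, fun r hr => ?_⟩
      rw [g₄ r hr]
      simp only [Store.setReal_real, and_self, if_true, max_le_iff, List.forall_mem_cons,
        Real.dist_eq, abs_le]
      constructor
      · rintro ⟨⟨⟨a, b⟩, e⟩, f⟩; exact ⟨a, ⟨by linarith, by linarith⟩, f⟩
      · rintro ⟨a, ⟨b, e⟩, f⟩; exact ⟨⟨⟨a, by linarith⟩, by linarith⟩, f⟩
  obtain ⟨g₁, g₂, g₃, g₄⟩ := H (List.finRange d) (σ.setReal 9 0 0) rfl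
    (fun a ha => Store.setReal_real_of_ne _ _ _ ha) (by simp [Store.setReal_real])
  simp only [distKey, Prog.eval, RExp.val, NExp.val, Nat.cast_zero]
  set σ' := (Prog.seqList (fun j : Fin d => Prog.seq
        (raise (.minus (.rep current j) (.read 6 (.const j))))
        (raise (.minus (.read 6 (.const j)) (.rep current j)))) (List.finRange d)).eval I
        (σ.setReal 9 0 0) with hσ'
  have hd : σ'.real 9 0 = dist (I.rep h) c := by
    apply le_antisymm
    · rw [g₄ _ dist_nonneg]
      exact ⟨by simp [Store.setReal_real], fun j _ => dist_le_pi_dist _ _ j⟩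
    · rw [dist_pi_le_iff g₃]
      exact fun j => ((g₄ _ g₃).1 le_rfl).2 j (List.mem_finRange j)
  rw [g₁, ← hh, hd]
  simp [Store.setReal, g₂ 5]

/-- Copy the handles of the segment to array `23`. -/
def loadWindow {d : ℕ} : Prog d :=
  .seq (.assign 8 (.const 0))
    (.seq (appendIf 100 23 (.var 4) (.var 5) .true) (.assign 10 (.var 8)))

theorem loadWindow_spec {d : ℕ} : ∃ C, ∀ (I : Input d) (σ : Store), σ.nat 4 0 ≤ σ.nat 5 0 →
    ∃ t σ', Exec I loadWindow σ t σ' ∧ t ≤ C * (σ.nat 5 0 - σ.nat 4 0 + 1) ∧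
      seg (σ'.nat 23) 0 (σ'.nat 10 0) = seg (σ.nat 100) (σ.nat 4 0) (σ.nat 5 0) := by
  obtain ⟨C, hC⟩ := copy_spec (d := d) 100 23 (.var 4) (.var 5) (by decide) (by decide) (by decide)
  refine ⟨C + 10, fun I σ hab => ?_⟩
  obtain ⟨t, σ', e, ht, h8, hs, -⟩ := hC I (σ.setNat 8 0 0) (σ.nat 4 0) (σ.nat 5 0)
    (by simp [NExp.val, Store.setNat_nat]) (by simp [NExp.val, Store.setNat_nat]) hab
  refine ⟨_, _, .seq (.setNat _ _ _ _) (.seq e (.setNat _ _ _ _)), ?_, ?_⟩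
  · simp only [NExp.cost, add_mul]; omega
  · rw [Store.setNat_nat_of_ne _ _ _ (by decide)]
    simp only [Store.setNat_nat, NExp.val, and_self, if_true] at hs ⊢
    rw [hs, Store.setNat_nat_of_ne _ _ _ (by decide)]

/-- The cube with center `c` and side `R` and its translate with center `c'` are obtained from the box
with corners `lo` and `hi`; there are sparse windows for the distances from `c`, and for the
coordinates in the direction of the translation. -/
structure IsCut {d : ℕ} (rep : ℕ → Pt d) (l : List ℕ) (m N : ℕ) (lo hi : Fin d → ℝ) (w R : ℝ)
    (c c' : Pt d) : Prop where
  nonneg : 0 ≤ w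
  le : ∀ j, hi j - lo j ≤ w
  center : ∀ j, c j = (lo j + hi j) / 2
  split : 0 < w → ∃ (j : Fin d) (x y : ℝ), hi j - lo j = w ∧ lo j ≤ x ∧ x ≤ y ∧ y ≤ hi j ∧
    (l.filter (fun h => x < rep h j ∧ rep h j < y)).length ≤ m ∧ w * m ≤ (y - x) * (2 * N) ∧
    c' = Function.update c j ((x + y) / 2 - R / 2)
  sphere : ∃ x y : ℝ, w / 2 ≤ x ∧ x ≤ y ∧ y ≤ w / 2 + w ∧
    (l.filter (fun h => x < dist (rep h) c ∧ dist (rep h) c < y)).length ≤ m ∧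
    w * m ≤ (y - x) * (2 * N) ∧ R = x + y

/-- Compute two cubes. -/
def cutPhase (d : ℕ) : Prog d :=
  .seq (quantiles d)
  (.seq loadWindow
  (.seq (forSegment (coordKey d))
  (.seq window
  (.seq (.assignReal 3 (.divide (.plus (.var 1) (.var 2)) (.ofNat (.const 2))))
  (.seq loadWindow
  (.seq (forSegment (distKey d))
  (.seq (.seq (.assignReal 1 (.divide (.var 0) (.ofNat (.const 2))))
    (.assignReal 2 (.plus (.var 1) (.var 0))))
  (.seq window
  (.seq (.assignReal 4 (.plus (.var 1) (.var 2)))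
  (.seq (Prog.seqList (fun j : Fin d => .setReal 7 (.const j) (.read 6 (.const j)))
      (List.finRange d))
  (.setReal 7 (.var 9)
    (.minus (.var 3) (.divide (.var 4) (.ofNat (.const 2)))))))))))))))

theorem cutPhase_writesNat {d a : ℕ} (h : (cutPhase d).WritesNat a) :
    a ∈ [7, 8, 9, 10, 11, 12, 13, 23, 24, 25] := by
  have h9 := @window_writesNat d a
  simp [cutPhase, quantiles, quantileStep, loadWindow, appendIf, Prog.forLoop, Prog.WritesNat,
    Prog.writesNat_seqList, forSegment, coordKey, distKey, raise] at h h9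
  simp; tauto

theorem eval_copyCenter {d : ℕ} (I : Input d) (σ : Store) :
    let σ' := (Prog.seqList (fun j : Fin d => .setReal 7 (.const j) (.read 6 (.const j)))
      (List.finRange d)).eval I σ
    σ'.nat = σ.nat ∧ (∀ a, a ≠ 7 → σ'.real a = σ.real a) ∧
    ∀ j : Fin d, σ'.real 7 j = σ.real 6 j := by
  have H : ∀ (js : List (Fin d)) (σ₁ : Store), σ₁.nat = σ.nat →
      (∀ a, a ≠ 7 → σ₁.real a = σ.real a) →
      let σ' := (Prog.seqList (fun j : Fin d => .setReal 7 (.const j) (.read 6 (.const j)))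
        js).eval I σ₁
      σ'.nat = σ.nat ∧ (∀ a, a ≠ 7 → σ'.real a = σ.real a) ∧
      ∀ j : Fin d, σ₁.real 7 j = σ.real 6 j ∨ j ∈ js → σ'.real 7 j = σ.real 6 j := by
    intro js
    induction js with
    | nil => intro σ₁ h₁ h₂; exact ⟨h₁, h₂, by simp [Prog.seqList, Prog.eval]⟩
    | cons i js ih =>
      intro σ₁ h₁ h₂
      obtain ⟨g₁, g₂, g₃⟩ := ih (σ₁.setReal 7 i (σ₁.real 6 i)) h₁
        (fun a ha => by rw [Store.setReal_real_of_ne _ _ _ ha, h₂ a ha])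
      refine ⟨g₁, g₂, fun j hj => g₃ j ?_⟩
      rw [Store.setReal_real, h₂ 6 (by decide), List.mem_cons] at *
      by_cases hji : (j : ℕ) = i
      · simp [hji]
      · simp only [hji, and_false, if_false]
        exact hj.imp_right (fun h => h.resolve_left (fun h' => hji (by rw [h'])))
  obtain ⟨g₁, g₂, g₃⟩ := H (List.finRange d) σ rfl (fun _ _ => rfl)
  exact ⟨g₁, g₂, fun j => g₃ j (.inr (List.mem_finRange j))⟩

-- The window search runs twice on the segment: with the coordinates in the longest direction on the
-- corresponding side of the box, and with the distances from `c` between `w / 2` and `3 * w / 2`.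
-- For `0 < w` both intervals have length `w`, so the same lower bound holds for both windows. The
-- cut is the midpoint of the first window, and `R = x + y` makes the half side of the cube the
-- midpoint of the second.
set_option maxHeartbeats 2000000 in
theorem cutPhase_spec {d : ℕ} (hd : 1 ≤ d) : ∃ C, ∀ (I : Input d) (σ : Store) (N : ℕ) (lo hi : Fin d → ℝ),
    σ.nat 4 0 < σ.nat 5 0 → σ.nat 5 0 - σ.nat 4 0 ≤ N → σ.nat 2 0 ≤ N →
    (∀ j, lo j = I.rep (σ.nat (100 + j) (σ.nat 4 0 + σ.nat 6 0)) j) →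
    (∀ j, hi j = I.rep (σ.nat (100 + j) (σ.nat 5 0 - (1 + σ.nat 6 0))) j) →
    (∀ j, lo j ≤ hi j) →
    ∃ t σ', Exec I (cutPhase d) σ t σ' ∧ t ≤ C * (σ.nat 5 0 - σ.nat 4 0 + 1) ∧
      IsCut I.rep (seg (σ.nat 100) (σ.nat 4 0) (σ.nat 5 0)) (σ.nat 2 0) N lo hi
        (σ'.real 0 0) (σ'.real 4 0) (fun j => σ'.real 6 j) (fun j => σ'.real 7 j) := by
  obtain ⟨C₂, s₂⟩ := loadWindow_spec (d := d)
  obtain ⟨C₃, s₃⟩ := fillKey_spec (coordKey d)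
    (Prog.straight_seqList (fun j => by simp [Prog.Straight]) _)
    (by simp [coordKey, Prog.writesNat_seqList, Prog.WritesNat])
  obtain ⟨C₄, s₄⟩ := window_spec (d := d)
  obtain ⟨C₇, s₇⟩ := fillKey_spec (distKey d)
    ⟨by simp [Prog.Straight], Prog.straight_seqList (fun j => by
      simp [Prog.Straight, raise]) _, by simp [Prog.Straight]⟩
    (by simp [distKey, raise, Prog.writesNat_seqList, Prog.WritesNat])
  set q₁₁ : Prog d := Prog.seqList (fun j : Fin d => .setReal 7 (.const j) (.read 6 (.const j)))
      (List.finRange d) with hq₁₁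
  refine ⟨(quantiles d).bound + C₂ + C₃ + C₄ + C₂ + C₇ + C₄ + q₁₁.bound + 100,
    fun I σ N lo hi hab hbN hmN hlo hhi hlohi => ?_⟩
  obtain ⟨a, ha⟩ : ∃ a, a = σ.nat 4 0 := ⟨_, rfl⟩
  obtain ⟨b, hb⟩ : ∃ b, b = σ.nat 5 0 := ⟨_, rfl⟩
  obtain ⟨m, hm⟩ : ∃ m, m = σ.nat 2 0 := ⟨_, rfl⟩
  obtain ⟨f, hf⟩ : ∃ f, f = σ.nat 100 := ⟨_, rfl⟩
  rw [← ha, ← hb] at hab hbN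
  rw [← hm] at hmN
  rw [← ha, ← hb, ← hm, ← hf]
  set l := seg f a b with hl
  have hll : l.length = b - a := by simp [hl]
  obtain ⟨t₁, b₁, e₁⟩ := Prog.exec_eval I (quantiles d) (straight_quantiles d) σ
  obtain ⟨n₁', w0, hw, hc, j, hj, hor⟩ := eval_quantiles hd I σ lo hi hlo hhi
  set σ₁ := (quantiles d).eval I σ
  set U := [7, 8, 9, 10, 11, 12, 13, 23, 24, 25] with hU
  have n₁ : ∀ x, x ∉ U → σ₁.nat x = σ.nat x := fun x hx => n₁' x (by
    rintro rfl; exact hx (by decide))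
  obtain ⟨t₂, σ₂, e₂, b₂, f₂⟩ := s₂ I σ₁ (by
    rw [n₁ 4 (by decide), n₁ 5 (by decide), ← ha, ← hb]; omega)
  have hload : ∀ x, (loadWindow : Prog d).WritesNat x → x ∈ U ∧ x ≠ 9 := fun x hx => by
    simp [loadWindow, appendIf, Prog.forLoop, Prog.WritesNat, hU] at hx ⊢; omega
  have hloadR : ∀ x, ¬ (loadWindow : Prog d).WritesReal x := fun x => by
    simp [loadWindow, appendIf, Prog.forLoop, Prog.WritesReal]
  have hwin : ∀ x, (window : Prog d).WritesNat x → x ∈ U ∧ x ≠ 9 := fun x hx => by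
    have := window_writesNat hx; simp [hU] at this ⊢; omega
  have n₂ : ∀ x, x ∉ U → σ₂.nat x = σ.nat x := fun x hx => by
    rw [e₂.nat_eq (fun h => hx (hload x h).1), n₁ x hx]
  have r₂ : ∀ x, σ₂.real x = σ₁.real x := fun x => e₂.real_eq (hloadR x)
  have j₂ : σ₂.nat 9 0 = j := by rw [e₂.nat_eq (fun h => (hload 9 h).2 rfl), hj]
  obtain ⟨t₃, σ₃, e₃, b₃, f₃⟩ := s₃ I σ₂ (fun h => I.rep h j) (by
    rw [n₂ 4 (by decide), n₂ 5 (by decide), ← ha, ← hb]; omega) (by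
    intro σ' hn _
    exact eval_coordKey I σ' j (by rw [hn 9 (by decide) (by decide), j₂]))
  have hco : ∀ x, (forSegment (coordKey d)).WritesNat x → x = 7 ∨ x = 11 := fun x hx => by
    simp [forSegment, coordKey, Prog.forLoop, Prog.WritesNat, Prog.writesNat_seqList] at hx; omega
  have n₃ : ∀ x, x ∉ [7, 11] → σ₃.nat x = σ₂.nat x := fun x hx => e₃.nat_eq (fun h => by
    simp at hx; have := hco x h; omega)
  have N₃ : ∀ x, x ∉ U → σ₃.nat x = σ.nat x := fun x hx => by
    rw [n₃ x (fun h => hx (by simp [hU] at h ⊢; omega)), n₂ x hx]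
  have j₃ : σ₃.nat 9 0 = j := by rw [n₃ 9 (by decide), j₂]
  have r₃ : ∀ x, x ≠ 5 → σ₃.real x = σ₁.real x := fun x hx => by
    rw [e₃.real_eq (fun h => by
      simp [forSegment, coordKey, Prog.forLoop, Prog.WritesReal, Prog.writesReal_seqList] at h
      exact hx h.2), r₂]
  rw [n₁ 4 (by decide), n₁ 5 (by decide), n₁ 100 (by decide), ← ha, ← hb, ← hf] at f₂
  rw [n₁ 4 (by decide), n₁ 5 (by decide), ← ha, ← hb] at b₂
  rw [n₂ 4 (by decide), n₂ 5 (by decide), n₂ 100 (by decide), ← ha, ← hb, ← hf] at f₃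
  rw [n₂ 4 (by decide), n₂ 5 (by decide), ← ha, ← hb] at b₃
  have hm₃ : σ₃.nat 2 0 = m := by rw [N₃ 2 (by decide), hm]
  obtain ⟨t₄, σ₄, e₄, b₄, v₁, v₂, v₃, v₄, v₅⟩ := s₄ I σ₃ N l (by
    rw [n₃ 23 (by decide), n₃ 10 (by decide), f₂]) (by omega) (by omega) (by
      rw [r₃ 1 (by decide), r₃ 2 (by decide)]
      rcases hor with ⟨-, h⟩ | ⟨-, -, h, h'⟩
      · exact h.le
      · rw [h, h']; exact hlohi j)
  rw [hm₃] at v₄ v₅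
  rw [r₃ 1 (by decide)] at v₁ v₅
  rw [r₃ 2 (by decide)] at v₃ v₅
  rw [hll] at b₄
  have N₄ : ∀ x, x ∉ U → σ₄.nat x = σ.nat x := fun x hx => by
    rw [e₄.nat_eq (fun h => hx (hwin x h).1), N₃ x hx]
  have j₄ : σ₄.nat 9 0 = j := by rw [e₄.nat_eq (fun h => (hwin 9 h).2 rfl), j₃]
  have r₄ : ∀ x, x ∉ [1, 2, 8] → σ₄.real x = σ₃.real x :=
    fun x hx => e₄.real_eq (fun h => hx (window_writesReal h))
  rw [List.filter_congr (q := fun h => decide (σ₄.real 1 0 < I.rep h j ∧ I.rep h j < σ₄.real 2 0))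
    (fun h hh => by rw [f₃ h hh])] at v₄
  obtain ⟨t₅, b₅, e₅⟩ := Prog.exec_eval I (.assignReal 3 (.divide (.plus (.var 1) (.var 2))
    (.ofNat (.const 2)))) (by simp [Prog.Straight]) σ₄
  simp only [Prog.bound, NExp.cost, RExp.cost] at b₅
  simp only [Prog.eval, NExp.val, RExp.val] at e₅
  set cut := (σ₄.real 1 0 + σ₄.real 2 0) / 2 with hcut
  set σ₅ := σ₄.setReal 3 0 ((σ₄.real 1 0 + σ₄.real 2 0) / ((2 : ℕ) : ℝ)) with hσ₅
  have c₅ : σ₅.real 3 0 = cut := by simp [hσ₅, Store.setReal_real, hcut]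
  obtain ⟨t₆, σ₆, e₆, b₆, f₆⟩ := s₂ I σ₅ (by
    rw [hσ₅, Store.setReal_nat, N₄ 4 (by decide), N₄ 5 (by decide), ← ha, ← hb]; omega)
  rw [hσ₅, Store.setReal_nat, N₄ 4 (by decide), N₄ 5 (by decide), ← ha, ← hb] at b₆
  rw [hσ₅, Store.setReal_nat, N₄ 4 (by decide), N₄ 5 (by decide), N₄ 100 (by decide), ← ha, ← hb,
    ← hf] at f₆
  have N₆ : ∀ x, x ∉ U → σ₆.nat x = σ.nat x := fun x hx => by
    rw [e₆.nat_eq (fun h => hx (hload x h).1), hσ₅, Store.setReal_nat, N₄ x hx]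
  have j₆ : σ₆.nat 9 0 = j := by
    rw [e₆.nat_eq (fun h => (hload 9 h).2 rfl), hσ₅, Store.setReal_nat, j₄]
  have r₆ : ∀ x, σ₆.real x = σ₅.real x := fun x => e₆.real_eq (hloadR x)
  have R₆ : ∀ x, x ∉ [1, 2, 3, 5, 8] → σ₆.real x = σ₁.real x := fun x hx => by
    simp at hx
    rw [r₆, hσ₅, Store.setReal_real_of_ne _ _ _ (by omega), r₄ x (by simp; omega),
      r₃ x (by omega)]
  set c : Pt d := fun j => σ₁.real 6 j with hcdef
  obtain ⟨t₇, σ₇, e₇, b₇, f₇⟩ := s₇ I σ₆ (fun h => dist (I.rep h) c) (by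
    rw [N₆ 4 (by decide), N₆ 5 (by decide), ← ha, ← hb]; omega) (by
    intro σ' _ hr
    refine eval_distKey I σ' c fun j => ?_
    rw [hr 6 (by simp [distKey, raise, Prog.writesReal_seqList, Prog.WritesReal]),
      R₆ 6 (by decide)])
  rw [N₆ 4 (by decide), N₆ 5 (by decide), ← ha, ← hb] at b₇
  rw [N₆ 4 (by decide), N₆ 5 (by decide), N₆ 100 (by decide), ← ha, ← hb, ← hf] at f₇
  have n₇ : ∀ x, x ∉ [7, 11] → σ₇.nat x = σ₆.nat x := fun x hx => e₇.nat_eq (by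
    simp [forSegment, distKey, raise, Prog.forLoop, Prog.WritesNat, Prog.writesNat_seqList] at hx ⊢
    tauto)
  have r₇ : ∀ x, x ∉ [5, 9] → σ₇.real x = σ₆.real x := fun x hx => e₇.real_eq (by
    simp [forSegment, distKey, raise, Prog.forLoop, Prog.WritesReal, Prog.writesReal_seqList]
      at hx ⊢
    tauto)
  have j₇ : σ₇.nat 9 0 = j := by rw [n₇ 9 (by decide), j₆]
  obtain ⟨t₈, b₈, e₈⟩ := Prog.exec_eval I (.seq (.assignReal 1 (.divide (.var 0) (.ofNat (.const 2))))
    (.assignReal 2 (.plus (.var 1) (.var 0)))) (by simp [Prog.Straight]) σ₇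
  simp only [Prog.bound, NExp.cost, RExp.cost] at b₈
  set σ₈ := Prog.eval I (.seq (.assignReal 1 (.divide (.var 0) (.ofNat (.const 2))))
    (.assignReal 2 (.plus (.var 1) (.var 0)))) σ₇ with hσ₈
  set w := σ₁.real 0 0 with hwdef
  have w₇ : σ₇.real 0 0 = w := by rw [r₇ 0 (by decide), R₆ 0 (by decide)]
  have n₈ : σ₈.nat = σ₇.nat := rfl
  have x₈ : σ₈.real 1 0 = w / 2 := by
    simp [hσ₈, Prog.eval, Store.setReal_real, RExp.val, NExp.val, w₇]
  have y₈ : σ₈.real 2 0 = w / 2 + w := by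
    simp [hσ₈, Prog.eval, Store.setReal_real, RExp.val, NExp.val, w₇]
  have r₈ : ∀ x, x ∉ [1, 2] → σ₈.real x = σ₇.real x := fun x hx => e₈.real_eq (by
    simp [Prog.WritesReal] at hx ⊢; exact hx)
  have m₈ : σ₈.nat 2 0 = m := by rw [n₈, n₇ 2 (by decide), N₆ 2 (by decide), hm]
  obtain ⟨t₉, σ₉, e₉, b₉, u₁, u₂, u₃, u₄, u₅⟩ := s₄ I σ₈ N l (by
    rw [n₈, n₇ 23 (by decide), n₇ 10 (by decide), f₆]) (by omega) (by omega)
    (by rw [x₈, y₈]; linarith)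
  rw [x₈] at u₁ u₅
  rw [y₈] at u₃ u₅
  rw [m₈] at u₄ u₅
  rw [hll] at b₉
  rw [List.filter_congr (q := fun h => decide (σ₉.real 1 0 < dist (I.rep h) c ∧
    dist (I.rep h) c < σ₉.real 2 0))
    (fun h hh => by rw [r₈ 5 (by decide), f₇ h hh])] at u₄
  have j₉ : σ₉.nat 9 0 = j := by rw [e₉.nat_eq (fun h => (hwin 9 h).2 rfl), n₈, j₇]
  have r₉ : ∀ x, x ∉ [1, 2, 8] → σ₉.real x = σ₈.real x :=
    fun x hx => e₉.real_eq (fun h => hx (window_writesReal h))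
  set R := σ₉.real 1 0 + σ₉.real 2 0 with hR
  set σ₁₀ := σ₉.setReal 4 0 R with hσ₁₀
  have e₁₀ : Exec I (.assignReal 4 (.plus (.var 1) (.var 2))) σ₉ _ σ₁₀ := .setReal _ _ _ _
  obtain ⟨t₁₁, b₁₁, e₁₁⟩ := q₁₁.exec_eval I
    (Prog.straight_seqList (fun j => by simp [Prog.Straight]) _) σ₁₀
  obtain ⟨n₁₁, r₁₁, c₁₁⟩ := eval_copyCenter I σ₁₀
  rw [← hq₁₁] at n₁₁ r₁₁ c₁₁
  set σ₁₁ := q₁₁.eval I σ₁₀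
  have e₁₂ : Exec I (.setReal 7 (.var 9)
    (.minus (.var 3) (.divide (.var 4) (.ofNat (.const 2))))) σ₁₁ _ _ := .setReal _ _ _ _
  simp only [NExp.val, RExp.val, NExp.cost, RExp.cost] at e₁₂ e₁₀
  have j₁₁ : σ₁₁.nat 9 0 = j := by rw [n₁₁, hσ₁₀, Store.setReal_nat, j₉]
  have R₁₁ : ∀ x, x ∉ [1, 2, 4, 5, 7, 8, 9] → σ₁₁.real x = σ₆.real x := fun x hx => by
    simp at hx
    rw [r₁₁ x (by omega), hσ₁₀, Store.setReal_real_of_ne _ _ _ (by omega), r₉ x (by simp; omega),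
      r₈ x (by simp; omega), r₇ x (by simp; omega)]
  have cut₁₁ : σ₁₁.real 3 0 = cut := by rw [R₁₁ 3 (by decide), r₆, c₅]
  have R4 : σ₁₁.real 4 0 = R := by
    rw [r₁₁ 4 (by decide), hσ₁₀]; simp [Store.setReal_real]
  have w₁₁ : σ₁₁.real 0 0 = w := by rw [R₁₁ 0 (by decide), R₆ 0 (by decide)]
  have c6 : ∀ i : Fin d, σ₁₁.real 6 i = c i := fun i => by
    rw [R₁₁ 6 (by decide), R₆ 6 (by decide)]
  rw [j₁₁, cut₁₁, R4] at e₁₂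
  refine ⟨_, _, .seq e₁ (.seq e₂ (.seq e₃ (.seq e₄ (.seq e₅ (.seq e₆ (.seq e₇ (.seq e₈ (.seq e₉
    (.seq e₁₀ (.seq e₁₁ e₁₂)))))))))), ?_, ?_⟩
  · have h₁ := Nat.le_mul_of_pos_right (quantiles d).bound (show 0 < b - a + 1 by omega)
    have h₂ := Nat.le_mul_of_pos_right q₁₁.bound (show 0 < b - a + 1 by omega)
    simp only [add_mul _ _ (b - a + 1)]
    omega
  · have hcd : (fun i : Fin d => (σ₁₁.setReal 7 j (cut - R / ((2 : ℕ) : ℝ))).real 6 i) = c := by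
      funext i; rw [Store.setReal_real_of_ne _ _ _ (by decide), c6]
    have hcd' : (fun i : Fin d => (σ₁₁.setReal 7 j (cut - R / ((2 : ℕ) : ℝ))).real 7 i) =
        Function.update c j (cut - R / 2) := by
      funext i
      rw [Store.setReal_real, Function.update_apply, c₁₁, hσ₁₀,
        Store.setReal_real_of_ne _ _ _ (by decide), r₉ 6 (by decide), r₈ 6 (by decide),
        r₇ 6 (by decide), R₆ 6 (by decide)]
      simp [Fin.ext_iff, hcdef]
    rw [hcd, hcd', Store.setReal_real_of_ne _ _ _ (by decide),
      Store.setReal_real_of_ne _ _ _ (by decide), w₁₁, R4]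
    -- The splitting window is claimed only for `0 < w`; otherwise the direction and the window ends
    -- of the first search carry no information.
    refine ⟨w0, hw, hc, fun hpos => ?_, _, _, u₁, u₂, u₃, u₄, by linarith, rfl⟩
    rcases hor with ⟨h, -⟩ | ⟨h, -, h', h''⟩
    · exact absurd h hpos.ne'
    · rw [h'] at v₁ v₅
      rw [h''] at v₃ v₅
      exact ⟨j, _, _, h.symm, v₁, v₂, v₃, v₄, by rw [h]; exact v₅, rfl⟩

/-! ## Rearranging a segment -/

open scoped Classical in
/-- The class of an object: `1`, `2`, `3` for the objects on the two sides of the cut of the cube `Q`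
and outside of `Q`; and `0` or `7` for the objects of the first or second set that the separator
meets. -/
noncomputable def cutClass {d : ℕ} (I : Input d) (w : ℝ) (Q Q' : Set (Pt d)) (h : ℕ) : ℕ :=
  if w ≤ 0 then (if h + 1 ≤ I.m₁ then 0 else 7)
  else if I.obj h ⊆ Q then
    if I.obj h ⊆ Q' then 1 else if Disjoint (I.obj h) Q' then 2
    else (if h + 1 ≤ I.m₁ then 0 else 7)
  else if Disjoint (I.obj h) Q then 3 else (if h + 1 ≤ I.m₁ then 0 else 7)

/-- Classify the current handle as an object that the separator meets. -/
def classifyMet {d : ℕ} : Prog d :=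
  .ite (.natLe (.plus current (.const 1)) (.var 0)) (.setNat 22 current (.const 0))
    (.setNat 22 current (.const 7))

/-- Classify the current handle. -/
def classify (d : ℕ) : Prog d :=
  .ite (.realLe (.var 0) (.ofNat (.const 0))) classifyMet
  (.ite (.inside current (fun j => .read 6 (.const j)) (.var 4))
    (.ite (.inside current (fun j => .read 7 (.const j)) (.var 4)) (.setNat 22 current (.const 1))
      (.ite (.outside current (fun j => .read 7 (.const j)) (.var 4))
        (.setNat 22 current (.const 2)) classifyMet))
    (.ite (.outside current (fun j => .read 6 (.const j)) (.var 4))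
      (.setNat 22 current (.const 3)) classifyMet))

theorem eval_classify {d : ℕ} (I : Input d) (σ : Store) (h0 : σ.nat 0 0 = I.m₁) (Q Q' : Set (Pt d))
    (hQ : Q = cube (fun j => σ.real 6 j) (σ.real 4 0))
    (hQ' : Q' = cube (fun j => σ.real 7 j) (σ.real 4 0)) :
    (classify d).eval I σ = σ.setNat 22 (σ.nat 100 (σ.nat 7 0))
      (cutClass I (σ.real 0 0) Q Q' (σ.nat 100 (σ.nat 7 0))) := by
  have hmet : (classifyMet : Prog d).eval I σ = σ.setNat 22 (σ.nat 100 (σ.nat 7 0))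
      (if σ.nat 100 (σ.nat 7 0) + 1 ≤ I.m₁ then 0 else 7) := by
    by_cases h : σ.nat 100 (σ.nat 7 0) + 1 ≤ I.m₁
    · have h' : (Test.natLe (.plus current (.const 1)) (.var 0) : Test d).Holds I σ := by
        simpa [Test.Holds, NExp.val, h0] using h
      simp [classifyMet, Prog.eval, h', h, NExp.val]
    · have h' : ¬ (Test.natLe (.plus current (.const 1)) (.var 0) : Test d).Holds I σ := by
        simpa [Test.Holds, NExp.val, h0] using h
      simp [classifyMet, Prog.eval, h', h, NExp.val]
  have i1 : (Test.realLe (.var 0) (.ofNat (.const 0)) : Test d).Holds I σ ↔ σ.real 0 0 ≤ 0 := by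
    simp [Test.Holds, RExp.val, NExp.val]
  have i2 : (Test.inside current (fun j => .read 6 (.const j)) (.var 4) : Test d).Holds I σ ↔
      I.obj (σ.nat 100 (σ.nat 7 0)) ⊆ Q := by
    simp [Test.Holds, RExp.val, NExp.val, hQ]
  have i3 : (Test.inside current (fun j => .read 7 (.const j)) (.var 4) : Test d).Holds I σ ↔
      I.obj (σ.nat 100 (σ.nat 7 0)) ⊆ Q' := by
    simp [Test.Holds, RExp.val, NExp.val, hQ']
  have i4 : (Test.outside current (fun j => .read 7 (.const j)) (.var 4) : Test d).Holds I σ ↔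
      Disjoint (I.obj (σ.nat 100 (σ.nat 7 0))) Q' := by
    simp [Test.Holds, RExp.val, NExp.val, hQ']
  have i5 : (Test.outside current (fun j => .read 6 (.const j)) (.var 4) : Test d).Holds I σ ↔
      Disjoint (I.obj (σ.nat 100 (σ.nat 7 0))) Q := by
    simp [Test.Holds, RExp.val, NExp.val, hQ]
  rw [cutClass, classify]
  simp only [Prog.eval]
  by_cases h1 : σ.real 0 0 ≤ 0
  · rw [if_pos (i1.2 h1), if_pos h1, hmet]
  rw [if_neg (mt i1.1 h1), if_neg h1]
  by_cases h2 : I.obj (σ.nat 100 (σ.nat 7 0)) ⊆ Q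
  · rw [if_pos (i2.2 h2), if_pos h2]
    by_cases h3 : I.obj (σ.nat 100 (σ.nat 7 0)) ⊆ Q'
    · rw [if_pos (i3.2 h3), if_pos h3]; rfl
    rw [if_neg (mt i3.1 h3), if_neg h3]
    by_cases h4 : Disjoint (I.obj (σ.nat 100 (σ.nat 7 0))) Q'
    · rw [if_pos (i4.2 h4), if_pos h4]; rfl
    · rw [if_neg (mt i4.1 h4), if_neg h4, hmet]
  · rw [if_neg (mt i2.1 h2), if_neg h2]
    by_cases h5 : Disjoint (I.obj (σ.nat 100 (σ.nat 7 0))) Q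
    · rw [if_pos (i5.2 h5), if_pos h5]; rfl
    · rw [if_neg (mt i5.1 h5), if_neg h5, hmet]

theorem classify_spec {d : ℕ} : ∃ C, ∀ (I : Input d) (σ : Store) (Q Q' : Set (Pt d)),
    σ.nat 4 0 ≤ σ.nat 5 0 → σ.nat 0 0 = I.m₁ →
    Q = cube (fun j => σ.real 6 j) (σ.real 4 0) → Q' = cube (fun j => σ.real 7 j) (σ.real 4 0) →
    ∃ t σ', Exec I (forSegment (classify d)) σ t σ' ∧ t ≤ C * (σ.nat 5 0 - σ.nat 4 0 + 1) ∧
      ∀ h ∈ seg (σ.nat 100) (σ.nat 4 0) (σ.nat 5 0),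
        σ'.nat 22 h = cutClass I (σ.real 0 0) Q Q' h := by
  have hs : (classify d).Straight := by simp [classify, classifyMet, Prog.Straight]
  have hn : ∀ a, (classify d).WritesNat a → a = 22 := fun a h => by
    simp [classify, classifyMet, Prog.WritesNat] at h; omega
  have hr : ∀ a, ¬ (classify d).WritesReal a := fun a => by
    simp [classify, classifyMet, Prog.WritesReal]
  refine ⟨(classify d).bound + 40, fun I σ Q Q' hab h0 hQ hQ' => ?_⟩
  obtain ⟨t₁, b₁, e₁⟩ := Prog.exec_eval I (.seq (.assign 7 (.var 4)) (.assign 11 (.var 5)))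
    (by simp [Prog.Straight]) σ
  simp only [Prog.bound, NExp.cost] at b₁
  simp only [Prog.eval, NExp.val] at e₁
  set σ₁ := (σ.setNat 7 0 (σ.nat 4 0)).setNat 11 0 ((σ.setNat 7 0 (σ.nat 4 0)).nat 5 0) with hσ₁
  have n₁ : ∀ a, a ≠ 7 → a ≠ 11 → σ₁.nat a = σ.nat a := fun a h h' => by
    rw [hσ₁, Store.setNat_nat_of_ne _ _ _ h', Store.setNat_nat_of_ne _ _ _ h]
  obtain ⟨t₂, σ₂, e₂, b₂, i₂⟩ := exec_forLoop (I := I) (body := classify d)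
    (fun k σ' => (∀ a, a ≠ 7 → a ≠ 11 → a ≠ 22 → σ'.nat a = σ.nat a) ∧ σ'.real = σ.real ∧
      ∀ h ∈ seg (σ.nat 100) (σ.nat 4 0) k, σ'.nat 22 h = cutClass I (σ.real 0 0) Q Q' h)
    (classify d).bound (σ.nat 4 0) (σ.nat 5 0) (fun h => by have := hn _ h; omega)
    (fun h => by have := hn _ h; omega) (by
      rintro k σ' hk hk' h7 ⟨g₁, g₂, g₃⟩
      obtain ⟨t, ht, e⟩ := (classify d).exec_eval I hs σ'
      have h5 := eval_classify I σ' (by rw [g₁ 0 (by decide) (by decide) (by decide), h0]) Q Q'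
        (by rw [g₂, hQ]) (by rw [g₂, hQ'])
      rw [h7, g₁ 100 (by decide) (by decide) (by decide), g₂] at h5
      refine ⟨t, _, e, ht, fun a h h' h'' => ?_, ?_, fun h hh => ?_⟩
      · rw [Store.setNat_nat_of_ne _ _ _ h, e.nat_eq (fun hw => h'' (hn a hw)), g₁ a h h' h'']
      · rw [Store.setNat_real, ← g₂]; funext a; exact e.real_eq (hr a)
      · rw [Store.setNat_nat_of_ne _ _ _ (by decide), h5, Store.setNat_nat]
        simp only [true_and]
        split_ifs with hc
        · rw [hc]
        · rw [seg_succ _ hk, List.mem_append, List.mem_singleton] at hh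
          exact g₃ h (hh.resolve_right hc)) σ₁ (by simp [hσ₁, Store.setNat_nat])
    (by simp [hσ₁, Store.setNat_nat]) hab ⟨fun a h h' _ => n₁ a h h', rfl, by simp [seg_self]⟩
  refine ⟨_, σ₂, .seq e₁ e₂, ?_, i₂.2.2⟩
  simp only [add_mul] at b₂ ⊢; omega

/-- Count the handles of the segment that are in class `c` and satisfy `T`, in cell `c` of array
`out`. -/
def countStep {d : ℕ} (out : ℕ) (T : Test d) (c : ℕ) : Prog d :=
  .seq (.assign 8 (.const 0))
    (.seq (appendIf 100 26 (.var 4) (.var 5) (.and (.natEq (.read 22 current) (.const c)) T))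
      (.setNat out (.const c) (.var 8)))

theorem countStep_spec {d : ℕ} (out c : ℕ) (T : Test d) (hout : out ∈ [28, 29]) :
    ∃ C, ∀ (I : Input d) (σ : Store) (τ : ℕ → Bool), σ.nat 4 0 ≤ σ.nat 5 0 →
    (∀ σ' : Store, σ'.nat 0 = σ.nat 0 → σ'.nat 100 = σ.nat 100 → (T.Holds I σ' ↔
      τ (σ.nat 100 (σ'.nat 7 0)) = true)) →
    ∃ t σ', Exec I (countStep out T c) σ t σ' ∧ t ≤ C * (σ.nat 5 0 - σ.nat 4 0 + 1) ∧
      σ'.real = σ.real ∧ (∀ a, a ∉ [7, 8, 11, 26, out] → σ'.nat a = σ.nat a) ∧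
      ∀ k, σ'.nat out k = if k = c then ((seg (σ.nat 100) (σ.nat 4 0) (σ.nat 5 0)).filter
        (fun h => σ.nat 22 h = c ∧ τ h = true)).length else σ.nat out k := by
  obtain ⟨C, hC⟩ := appendIf_spec (d := d) 100 26 (.var 4) (.var 5)
    (.and (.natEq (.read 22 current) (.const c)) T) (by decide) (by decide) (by decide)
  refine ⟨C + 10, fun I σ τ hab hT => ?_⟩
  obtain ⟨t, σ', e, ht, h8, -, -, hr, hn⟩ := hC I (σ.setNat 8 0 0) (σ.nat 4 0) (σ.nat 5 0)
    (fun h => σ.nat 22 h = c ∧ τ h = true) (by simp [NExp.val, Store.setNat_nat])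
    (by simp [NExp.val, Store.setNat_nat]) hab (by
      intro σ' _ hn k _ _ h7
      have hn' : ∀ a, a ∉ [7, 8, 11, 26] → σ'.nat a = σ.nat a := fun a ha => by
        simp at ha
        rw [hn a (by omega) (by omega) (by omega) (by omega),
          Store.setNat_nat_of_ne _ _ _ (by omega)]
      simp only [Test.Holds, Test.holds_natEq, NExp.val, hn' 22 (by decide), hn' 100 (by decide),
        Store.setNat_nat_of_ne _ _ _ (show (100 : ℕ) ≠ 8 by decide),
        hT σ' (hn' 0 (by decide)) (hn' 100 (by decide)), h7, decide_eq_true_eq])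
  simp only [Store.setNat_nat, and_self, if_true, zero_add,
    Store.setNat_nat_of_ne _ _ _ (show (100 : ℕ) ≠ 8 by decide)] at h8
  refine ⟨_, _, .seq (.setNat _ _ _ _) (.seq e (.setNat _ _ _ _)), ?_, ?_, ?_, ?_⟩
  · simp only [NExp.cost, add_mul]; omega
  · rw [Store.setNat_real, hr]; rfl
  · intro a ha
    simp at ha
    rw [Store.setNat_nat_of_ne _ _ _ (by omega), hn a (by omega) (by omega) (by omega) (by omega),
          Store.setNat_nat_of_ne _ _ _ (by omega)]
  · intro k
    simp only [Store.setNat_nat, NExp.val, true_and, h8]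
    split_ifs with h
    · rfl
    · simp at hout
      rw [hn out (by omega) (by omega) (by omega) (by omega),
          Store.setNat_nat_of_ne _ _ _ (by omega)]

/-- Count the objects of the two sets in the three classes. -/
def counts (d : ℕ) : Prog d :=
  let A : Test d := .natLe (.plus current (.const 1)) (.var 0)
  .seq (countStep 28 A 1) (.seq (countStep 28 A 2) (.seq (countStep 28 A 3)
    (.seq (countStep 29 A.not 1) (.seq (countStep 29 A.not 2) (countStep 29 A.not 3)))))

theorem counts_spec {d : ℕ} : ∃ C, ∀ (I : Input d) (σ : Store) (cls : ℕ → ℕ) (l : List ℕ),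
    l = seg (σ.nat 100) (σ.nat 4 0) (σ.nat 5 0) → σ.nat 4 0 ≤ σ.nat 5 0 →
    σ.nat 0 0 = I.m₁ → (∀ h ∈ l, σ.nat 22 h = cls h) →
    ∃ t σ', Exec I (counts d) σ t σ' ∧ t ≤ C * (σ.nat 5 0 - σ.nat 4 0 + 1) ∧
      (∀ a, a ∉ [7, 8, 11, 26, 28, 29] → σ'.nat a = σ.nat a) ∧
      ∀ k ∈ [1, 2, 3], σ'.nat 28 k = (l.filter (fun h => cls h = k ∧ h < I.m₁)).length ∧
        σ'.nat 29 k = (l.filter (fun h => cls h = k ∧ ¬ h < I.m₁)).length := by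
  let A : Test d := .natLe (.plus current (.const 1)) (.var 0)
  obtain ⟨C₁, s₁⟩ := countStep_spec (d := d) 28 1 A (by decide)
  obtain ⟨C₂, s₂⟩ := countStep_spec (d := d) 28 2 A (by decide)
  obtain ⟨C₃, s₃⟩ := countStep_spec (d := d) 28 3 A (by decide)
  obtain ⟨C₄, s₄⟩ := countStep_spec (d := d) 29 1 A.not (by decide)
  obtain ⟨C₅, s₅⟩ := countStep_spec (d := d) 29 2 A.not (by decide)
  obtain ⟨C₆, s₆⟩ := countStep_spec (d := d) 29 3 A.not (by decide)
  refine ⟨C₁ + C₂ + C₃ + C₄ + C₅ + C₆, fun I σ cls l hl hab h0 hcls => ?_⟩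
  have hA : ∀ σ₀ : Store, σ₀.nat 0 0 = I.m₁ → ∀ σ' : Store, σ'.nat 0 = σ₀.nat 0 →
      σ'.nat 100 = σ₀.nat 100 →
      (A.Holds I σ' ↔ (fun h => decide (h < I.m₁)) (σ₀.nat 100 (σ'.nat 7 0)) = true) := by
    intro σ₀ h σ' h1 h2
    simp only [A, Test.Holds, NExp.val, h1, h, h2, decide_eq_true_eq]; omega
  have hA' : ∀ σ₀ : Store, σ₀.nat 0 0 = I.m₁ → ∀ σ' : Store, σ'.nat 0 = σ₀.nat 0 →
      σ'.nat 100 = σ₀.nat 100 →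
      (A.not.Holds I σ' ↔ (fun h => decide (¬ h < I.m₁)) (σ₀.nat 100 (σ'.nat 7 0)) = true) := by
    intro σ₀ h σ' h1 h2
    rw [Test.Holds, hA σ₀ h σ' h1 h2]; simp
  have fr : ∀ {σ₁ σ₂ : Store} {x : ℕ}, x = 28 ∨ x = 29 →
      (∀ a, a ∉ [7, 8, 11, 26, 28, 29] → σ₁.nat a = σ.nat a) →
      (∀ a, a ∉ [7, 8, 11, 26, x] → σ₂.nat a = σ₁.nat a) →
      (∀ a, a ∉ [7, 8, 11, 26, 28, 29] → σ₂.nat a = σ.nat a) := by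
    intro σ₁ σ₂ x hx h h' a ha
    simp at ha
    rw [h' a (by simp; omega), h a (by simp; omega)]
  have gen : ∀ (σ₀ : Store) (P : ℕ → Bool) (k : ℕ),
      (∀ a, a ∉ [7, 8, 11, 26, 28, 29] → σ₀.nat a = σ.nat a) →
      ((seg (σ₀.nat 100) (σ₀.nat 4 0) (σ₀.nat 5 0)).filter
        (fun h => σ₀.nat 22 h = k ∧ P h = true)).length =
      (l.filter (fun h => cls h = k ∧ P h = true)).length := by
    intro σ₀ P k h
    rw [h 100 (by decide), h 4 (by decide), h 5 (by decide), ← hl, h 22 (by decide)]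
    congr 1
    exact List.filter_congr (fun x hx => by rw [hcls x hx])
  have F₀ : ∀ a, a ∉ [7, 8, 11, 26, 28, 29] → σ.nat a = σ.nat a := fun _ _ => rfl
  obtain ⟨t₁, σ₁, e₁, b₁, -, n₁, c₁⟩ := s₁ I σ (fun h => decide (h < I.m₁)) hab (hA σ h0)
  have F₁ := fr (.inl rfl) F₀ n₁
  obtain ⟨t₂, σ₂, e₂, b₂, -, n₂, c₂⟩ := s₂ I σ₁ (fun h => decide (h < I.m₁)) (by
    rw [F₁ 4 (by decide), F₁ 5 (by decide)]; exact hab) (hA σ₁ (by rw [F₁ 0 (by decide), h0]))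
  have F₂ := fr (.inl rfl) F₁ n₂
  obtain ⟨t₃, σ₃, e₃, b₃, -, n₃, c₃⟩ := s₃ I σ₂ (fun h => decide (h < I.m₁)) (by
    rw [F₂ 4 (by decide), F₂ 5 (by decide)]; exact hab) (hA σ₂ (by rw [F₂ 0 (by decide), h0]))
  have F₃ := fr (.inl rfl) F₂ n₃
  obtain ⟨t₄, σ₄, e₄, b₄, -, n₄, c₄⟩ := s₄ I σ₃ (fun h => decide (¬ h < I.m₁)) (by
    rw [F₃ 4 (by decide), F₃ 5 (by decide)]; exact hab) (hA' σ₃ (by rw [F₃ 0 (by decide), h0]))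
  have F₄ := fr (.inr rfl) F₃ n₄
  obtain ⟨t₅, σ₅, e₅, b₅, -, n₅, c₅⟩ := s₅ I σ₄ (fun h => decide (¬ h < I.m₁)) (by
    rw [F₄ 4 (by decide), F₄ 5 (by decide)]; exact hab) (hA' σ₄ (by rw [F₄ 0 (by decide), h0]))
  have F₅ := fr (.inr rfl) F₄ n₅
  obtain ⟨t₆, σ₆, e₆, b₆, -, n₆, c₆⟩ := s₆ I σ₅ (fun h => decide (¬ h < I.m₁)) (by
    rw [F₅ 4 (by decide), F₅ 5 (by decide)]; exact hab) (hA' σ₅ (by rw [F₅ 0 (by decide), h0]))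
  have F₆ := fr (.inr rfl) F₅ n₆
  refine ⟨_, σ₆, .seq e₁ (.seq e₂ (.seq e₃ (.seq e₄ (.seq e₅ e₆)))), ?_, F₆, ?_⟩
  · rw [F₁ 4 (by decide), F₁ 5 (by decide)] at b₂
    rw [F₂ 4 (by decide), F₂ 5 (by decide)] at b₃
    rw [F₃ 4 (by decide), F₃ 5 (by decide)] at b₄
    rw [F₄ 4 (by decide), F₄ 5 (by decide)] at b₅
    rw [F₅ 4 (by decide), F₅ 5 (by decide)] at b₆
    simp only [add_mul _ _ (σ.nat 5 0 - σ.nat 4 0 + 1)]; omega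
  · have h28 : ∀ k, σ₆.nat 28 k = σ₃.nat 28 k := fun k => by
      rw [n₆ 28 (by decide), n₅ 28 (by decide), n₄ 28 (by decide)]
    have h29 : σ₃.nat 29 = σ.nat 29 := by
      rw [n₃ 29 (by decide), n₂ 29 (by decide), n₁ 29 (by decide)]
    have G : ∀ σ₀ : Store, (∀ a, a ∉ [7, 8, 11, 26, 28, 29] → σ₀.nat a = σ.nat a) → ∀ k,
        ((seg (σ₀.nat 100) (σ₀.nat 4 0) (σ₀.nat 5 0)).filter
          (fun h => σ₀.nat 22 h = k ∧ decide (h < I.m₁) = true)).length =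
        (l.filter (fun h => cls h = k ∧ h < I.m₁)).length := fun σ₀ h k => by
      rw [gen σ₀ (fun h => decide (h < I.m₁)) k h]; simp only [decide_eq_true_eq]
    have G' : ∀ σ₀ : Store, (∀ a, a ∉ [7, 8, 11, 26, 28, 29] → σ₀.nat a = σ.nat a) → ∀ k,
        ((seg (σ₀.nat 100) (σ₀.nat 4 0) (σ₀.nat 5 0)).filter
          (fun h => σ₀.nat 22 h = k ∧ decide (¬ h < I.m₁) = true)).length =
        (l.filter (fun h => cls h = k ∧ ¬ h < I.m₁)).length := fun σ₀ h k => by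
      rw [gen σ₀ (fun h => decide (¬ h < I.m₁)) k h]; simp only [decide_eq_true_eq]
    simp only [G _ F₀, G _ F₁, G _ F₂] at c₁ c₂ c₃
    simp only [G' _ F₃, G' _ F₄, G' _ F₅] at c₄ c₅ c₆
    simp only [List.forall_mem_cons, h28, c₁, c₂, c₃, c₄, c₅, c₆]
    simp

/-- The label of a handle: the class, increased by three for classes with more objects of the first than
of the second set. -/
def label (cls A B : ℕ → ℕ) (h : ℕ) : ℕ :=
  if cls h ∈ [1, 2, 3] ∧ ¬ A (cls h) ≤ B (cls h) then cls h + 3 else cls h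

/-- The entries of a list, sorted stably by their labels below `k`. -/
def bucket (lab : ℕ → ℕ) (l : List ℕ) (k : ℕ) : List ℕ :=
  (List.range k).flatMap (fun i => l.filter (fun h => lab h = i))

theorem bucket_succ (lab : ℕ → ℕ) (l : List ℕ) (k : ℕ) :
    bucket lab l (k + 1) = bucket lab l k ++ l.filter (fun h => lab h = k) := by
  simp [bucket, List.range_succ]

theorem bucket_zero (lab : ℕ → ℕ) (l : List ℕ) : bucket lab l 0 = [] := by simp [bucket]

theorem bucket_perm_filter (lab : ℕ → ℕ) (l : List ℕ) (k : ℕ) :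
    (bucket lab l k).Perm (l.filter (fun h => lab h < k)) := by
  induction k with
  | zero => simp [bucket_zero]
  | succ k ih =>
    rw [bucket_succ]
    have h := List.filter_append_perm (fun h => decide (lab h < k))
      (l.filter (fun h => lab h < k + 1))
    rw [List.filter_filter, List.filter_filter] at h
    refine List.Perm.trans ?_ h
    refine (ih.trans (List.Perm.of_eq ?_)).append (List.Perm.of_eq ?_)
    · refine List.filter_congr (fun x _ => ?_)
      rw [← Bool.decide_and, decide_eq_decide]; omega
    · refine List.filter_congr (fun x _ => ?_)
      rw [← decide_not, ← Bool.decide_and, decide_eq_decide]; omega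

theorem bucket_perm {lab : ℕ → ℕ} {l : List ℕ} {k : ℕ} (h : ∀ x ∈ l, lab x < k) :
    (bucket lab l k).Perm l := by
  refine (bucket_perm_filter lab l k).trans (List.Perm.of_eq ?_)
  rw [List.filter_eq_self]; simpa using h

/-- The handle at the current position is labelled `k`. -/
def labelTest {d : ℕ} (j k : ℕ) : Test d :=
  let c : NExp := .read 22 (.read (100 + j) (.var 7))
  if k = 0 ∨ 7 ≤ k then .natEq c (.const k)
  else if k ≤ 3 then .and (.natEq c (.const k)) (.natLe (.read 28 (.const k)) (.read 29 (.const k)))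
  else .and (.natEq c (.const (k - 3)))
    (.not (.natLe (.read 28 (.const (k - 3))) (.read 29 (.const (k - 3)))))

/-- Labels are not stored. Labels `0` and `7` are read off from the class alone; labels `1, 2, 3`
and `4, 5, 6` belong to the same three classes and are told apart by the counts of the two sets. -/
theorem holds_labelTest {d : ℕ} (I : Input d) (σ : Store) (j k : ℕ) (cls A B : ℕ → ℕ) (hk : k < 8)
    (hcls : σ.nat 22 (σ.nat (100 + j) (σ.nat 7 0)) = cls (σ.nat (100 + j) (σ.nat 7 0)))
    (hmem : cls (σ.nat (100 + j) (σ.nat 7 0)) ∈ [0, 1, 2, 3, 7])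
    (hA : ∀ c ∈ [1, 2, 3], σ.nat 28 c = A c) (hB : ∀ c ∈ [1, 2, 3], σ.nat 29 c = B c) :
    (labelTest j k : Test d).Holds I σ ↔ label cls A B (σ.nat (100 + j) (σ.nat 7 0)) = k := by
  set h := σ.nat (100 + j) (σ.nat 7 0) with hh
  have e1 : cls h ∈ [1, 2, 3] ↔ cls h = 1 ∨ cls h = 2 ∨ cls h = 3 := by simp
  simp only [List.mem_cons, List.not_mem_nil, or_false] at hmem
  unfold labelTest label
  simp only [e1]
  by_cases h1 : k = 0 ∨ 7 ≤ k
  · rw [if_pos h1, Test.holds_natEq]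
    simp only [NExp.val, ← hh, hcls]
    split_ifs <;> omega
  rw [if_neg h1]
  by_cases h2 : k ≤ 3
  · have hk' : k ∈ [1, 2, 3] := by simp; omega
    rw [if_pos h2, Test.Holds, Test.holds_natEq, Test.Holds]
    simp only [NExp.val, ← hh, hcls, hA k hk', hB k hk']
    split_ifs with h3
    · constructor
      · rintro ⟨rfl, h4⟩; exact absurd h4 h3.2
      · omega
    · constructor
      · exact fun h => h.1
      · rintro rfl; exact ⟨rfl, by by_contra h4; exact h3 ⟨by omega, h4⟩⟩
  · have hk' : k - 3 ∈ [1, 2, 3] := by simp; omega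
    rw [if_neg h2, Test.Holds, Test.holds_natEq, Test.Holds, Test.Holds]
    simp only [NExp.val, ← hh, hcls, hA _ hk', hB _ hk']
    split_ifs with h3
    · constructor
      · omega
      · intro h4
        have : cls h = k - 3 := by omega
        exact ⟨this, this ▸ h3.2⟩
    · constructor
      · rintro ⟨h4, h5⟩; exact absurd ⟨by omega, h4 ▸ h5⟩ h3
      · omega

/-- Append the handles with the labels `0, …, k - 1` to array `26`, and note the positions where the
blocks start in array `27`. -/
def passes {d : ℕ} (j : ℕ) : ℕ → Prog d
  | 0 => .skip
  | k + 1 => .seq (passes j k) (.seq (.setNat 27 (.const k) (.var 8))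
      (appendIf (100 + j) 26 (.var 4) (.var 5) (labelTest j k)))

/-- Sort the segment of the `j`-th list by labels. -/
def rearrange {d : ℕ} (j : ℕ) : Prog d :=
  .seq (.assign 8 (.var 4)) (.seq (passes j 8) (.seq (.setNat 27 (.const 8) (.var 8))
    (.seq (.assign 8 (.var 4)) (appendIf 26 (100 + j) (.var 4) (.var 5) .true))))

/-- Each label has its own pass through the segment. A pass keeps the order of the handles that it
selects, so the sort is stable; this is what preserves the coordinate orders within the blocks. -/
theorem passes_spec {d : ℕ} (j k : ℕ) (hk : k ≤ 8) : ∃ C, ∀ (I : Input d) (σ : Store)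
    (l : List ℕ) (cls A B : ℕ → ℕ),
    l = seg (σ.nat (100 + j)) (σ.nat 4 0) (σ.nat 5 0) → σ.nat 4 0 ≤ σ.nat 5 0 →
    (∀ h ∈ l, σ.nat 22 h = cls h ∧ cls h ∈ [0, 1, 2, 3, 7]) →
    (∀ c ∈ [1, 2, 3], σ.nat 28 c = A c ∧ σ.nat 29 c = B c) →
    ∃ t σ', Exec I (passes j k) σ t σ' ∧ t ≤ C * (σ.nat 5 0 - σ.nat 4 0 + 1) ∧
      (∀ a, a ∉ [7, 8, 11, 26, 27] → σ'.nat a = σ.nat a) ∧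
      σ'.nat 8 0 = σ.nat 8 0 + (bucket (label cls A B) l k).length ∧
      seg (σ'.nat 26) (σ.nat 8 0) (σ'.nat 8 0) = bucket (label cls A B) l k ∧
      (∀ i < k, σ'.nat 27 i = σ.nat 8 0 + (bucket (label cls A B) l i).length) := by
  induction k with
  | zero =>
    refine ⟨1, fun I σ l cls A B hl hab hcls hAB => ⟨1, σ, .skip σ, by omega, fun _ _ => rfl, ?_⟩⟩
    simp [bucket_zero, seg_self]
  | succ k ih =>
    obtain ⟨C₁, s₁⟩ := ih (by omega)
    obtain ⟨C₂, s₂⟩ := appendIf_spec (d := d) (100 + j) 26 (.var 4) (.var 5) (labelTest j k)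
      (by omega) (by omega) (by decide)
    refine ⟨C₁ + C₂ + 4, fun I σ l cls A B hl hab hcls hAB => ?_⟩
    obtain ⟨t₁, σ₁, e₁, b₁, n₁, p₁, f₁, i₁⟩ := s₁ I σ l cls A B hl hab hcls hAB
    have N₁ : ∀ a, a ∉ [7, 8, 11, 26, 27] → (σ₁.setNat 27 k (σ₁.nat 8 0)).nat a = σ.nat a :=
      fun a ha => by
        rw [Store.setNat_nat_of_ne _ _ _ (by simp at ha; omega), n₁ a ha]
    have hs : ∀ a, a ≠ 27 → (σ₁.setNat 27 k (σ₁.nat 8 0)).nat a = σ₁.nat a := fun a ha =>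
      Store.setNat_nat_of_ne _ _ _ ha
    have h100 : 100 + j ∉ [7, 8, 11, 26, 27] := by simp; omega
    obtain ⟨t₂, σ₂, e₂, b₂, p₂, f₂, u₂, -, n₂⟩ := s₂ I (σ₁.setNat 27 k (σ₁.nat 8 0)) (σ.nat 4 0)
      (σ.nat 5 0) (fun h => label cls A B h = k)
      (fun v => by
        rw [NExp.val, Store.setNat_nat_of_ne _ _ _ (by decide), N₁ 4 (by decide)]; rfl)
      (by rw [NExp.val, N₁ 5 (by decide)]; rfl) hab (by
        intro σ' _ hn x hx hx' h7
        have hn' : ∀ a, a ∉ [7, 8, 11, 26, 27] → σ'.nat a = σ.nat a := fun a ha => by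
          have ha' := ha
          simp at ha'
          rw [hn a (by omega) (by omega) (by omega) (by omega), N₁ a ha]
        have hx : σ.nat (100 + j) x ∈ l := by rw [hl, mem_seg]; exact ⟨x, hx, hx', rfl⟩
        rw [holds_labelTest I σ' j k cls A B (by omega)
          (by rw [hn' 22 (by decide), h7, hn' _ h100]; exact (hcls _ hx).1)
          (by rw [h7, hn' _ h100]; exact (hcls _ hx).2)
          (fun c hc => by rw [hn' 28 (by decide)]; exact (hAB c hc).1)
          (fun c hc => by rw [hn' 29 (by decide)]; exact (hAB c hc).2), h7, hn' _ h100, N₁ _ h100]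
        simp)
    rw [N₁ _ h100, ← hl, hs 8 (by decide), p₁, add_assoc] at p₂
    rw [N₁ _ h100, ← hl, hs 8 (by decide)] at f₂
    rw [hs 8 (by decide), hs 26 (by decide)] at u₂
    refine ⟨_, σ₂, .seq e₁ (.seq (.setNat _ _ _ _) e₂), ?_, ?_, ?_, ?_, ?_⟩
    · simp only [NExp.cost, add_mul _ _ (σ.nat 5 0 - σ.nat 4 0 + 1)]; omega
    · intro a ha
      have ha' := ha
      simp at ha'
      rw [n₂ a (by omega) (by omega) (by omega) (by omega), N₁ a ha]
    · rw [p₂, bucket_succ, List.length_append]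
    · rw [← seg_append _ (b := σ₁.nat 8 0) (by omega) (by omega), f₂, bucket_succ, ← f₁]
      congr 1
      exact seg_congr (fun x _ hx => u₂ x (.inl hx))
    · intro i hi
      rw [n₂ 27 (by decide) (by decide) (by decide) (by decide), Store.setNat_nat]
      rcases Nat.lt_succ_iff_lt_or_eq.1 hi with h | rfl
      · rw [if_neg (by omega), i₁ i h]
      · rw [if_pos ⟨rfl, rfl⟩, p₁]

/-- The sorted list is built in array `26` at the same positions as the segment and then copied
back, so the block starts in array `27` are positions in the rearranged array itself. -/
theorem rearrange_spec {d : ℕ} (j : ℕ) : ∃ C, ∀ (I : Input d) (σ : Store)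
    (l : List ℕ) (cls A B : ℕ → ℕ),
    l = seg (σ.nat (100 + j)) (σ.nat 4 0) (σ.nat 5 0) → σ.nat 4 0 ≤ σ.nat 5 0 →
    (∀ h ∈ l, σ.nat 22 h = cls h ∧ cls h ∈ [0, 1, 2, 3, 7]) →
    (∀ c ∈ [1, 2, 3], σ.nat 28 c = A c ∧ σ.nat 29 c = B c) →
    ∃ t σ', Exec I (rearrange j) σ t σ' ∧ t ≤ C * (σ.nat 5 0 - σ.nat 4 0 + 1) ∧
      (∀ a, a ∉ [7, 8, 11, 26, 27, 100 + j] → σ'.nat a = σ.nat a) ∧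
      seg (σ'.nat (100 + j)) (σ.nat 4 0) (σ.nat 5 0) = bucket (label cls A B) l 8 ∧
      (∀ k, k < σ.nat 4 0 ∨ σ.nat 5 0 ≤ k → σ'.nat (100 + j) k = σ.nat (100 + j) k) ∧
      (∀ i ≤ 8, σ'.nat 27 i = σ.nat 4 0 + (bucket (label cls A B) l i).length) := by
  obtain ⟨C₁, s₁⟩ := passes_spec (d := d) j 8 le_rfl
  obtain ⟨C₂, s₂⟩ := copy_spec (d := d) 26 (100 + j) (.var 4) (.var 5)
    (by omega) (by decide) (by omega)
  refine ⟨C₁ + C₂ + 20, fun I σ l cls A B hl hab hcls hAB => ?_⟩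
  have hN : ∀ a, a ≠ 8 → (σ.setNat 8 0 (σ.nat 4 0)).nat a = σ.nat a := fun a ha =>
      Store.setNat_nat_of_ne _ _ _ ha
  obtain ⟨t₁, σ₁, e₁, b₁, n₁, p₁, f₁, i₁⟩ := s₁ I (σ.setNat 8 0 (σ.nat 4 0)) l cls A B
    (by rw [hN _ (by omega), hN _ (by decide), hN _ (by decide), hl])
    (by rw [hN _ (by decide), hN _ (by decide)]; exact hab)
    (by rw [hN _ (by decide)]; exact hcls)
    (by rw [hN 28 (by decide), hN 29 (by decide)]; exact hAB)
  have h8 : (σ.setNat 8 0 (σ.nat 4 0)).nat 8 0 = σ.nat 4 0 := by simp [Store.setNat_nat]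
  rw [h8] at p₁ f₁ i₁
  rw [hN _ (by decide), hN _ (by decide)] at b₁
  have hlen : (bucket (label cls A B) l 8).length = σ.nat 5 0 - σ.nat 4 0 := by
    rw [(bucket_perm (fun x hx => ?_)).length_eq, hl, length_seg]
    have h2 := (hcls x hx).2
    simp only [List.mem_cons, List.not_mem_nil, or_false] at h2
    unfold label
    split_ifs with h
    · have := h.1; simp at this; omega
    · omega
  have hp : σ₁.nat 8 0 = σ.nat 5 0 := by omega
  have N₁ : ∀ a, a ∉ [7, 8, 11, 26, 27] → σ₁.nat a = σ.nat a := fun a ha => by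
    rw [n₁ a ha, hN a (by simp at ha; omega)]
  set σ₂ := (σ₁.setNat 27 8 (σ₁.nat 8 0)).setNat 8 0 (σ.nat 4 0) with hσ₂
  have N₂ : ∀ a, a ∉ [7, 8, 11, 26, 27] → σ₂.nat a = σ.nat a := fun a ha => by
    have ha' := ha
    simp at ha'
    rw [hσ₂, Store.setNat_nat_of_ne _ _ _ (by omega), Store.setNat_nat_of_ne _ _ _ (by omega),
      N₁ a ha]
  have h26 : σ₂.nat 26 = σ₁.nat 26 := by
    rw [hσ₂, Store.setNat_nat_of_ne _ _ _ (by omega), Store.setNat_nat_of_ne _ _ _ (by omega)]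
  obtain ⟨t₂, σ₃, e₂, b₂, p₂, f₂, u₂, -, n₂⟩ := s₂ I σ₂ (σ.nat 4 0) (σ.nat 5 0)
    (fun v => by rw [NExp.val, Store.setNat_nat_of_ne _ _ _ (by decide), N₂ 4 (by decide)]; rfl)
    (by rw [NExp.val, N₂ 5 (by decide)]; rfl) hab
  have h8' : σ₂.nat 8 0 = σ.nat 4 0 := by simp [hσ₂, Store.setNat_nat]
  have h100 : 100 + j ∉ [7, 8, 11, 26, 27] := by simp; omega
  rw [h8'] at p₂ f₂ u₂
  have hp₂ : σ₃.nat 8 0 = σ.nat 5 0 := by omega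
  rw [hp₂] at f₂ u₂
  rw [h26, ← hp, f₁, hp] at f₂
  rw [N₂ _ h100] at u₂
  have E : Exec I (.assign 8 (.var 4)) (σ₁.setNat 27 8 (σ₁.nat 8 0)) _ _ := .setNat _ _ _ _
  have hE : ((NExp.var 4).val (σ₁.setNat 27 8 (σ₁.nat 8 0))) = σ.nat 4 0 := by
    rw [NExp.val, Store.setNat_nat_of_ne _ _ _ (by decide), N₁ 4 (by decide)]; rfl
  rw [hE] at E
  refine ⟨_, σ₃, .seq (.setNat _ _ _ _) (.seq e₁ (.seq (.setNat _ _ _ _) (.seq E e₂))),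
    ?_, ?_, f₂, u₂, ?_⟩
  · simp only [NExp.cost, add_mul _ _ (σ.nat 5 0 - σ.nat 4 0 + 1)]; omega
  · intro a ha
    simp at ha
    rw [n₂ a (by omega) (by omega) (by omega) (by omega), N₂ a (by simp; omega)]
  · intro i hi
    rw [n₂ 27 (by decide) (by decide) (by decide) (by omega), hσ₂,
      Store.setNat_nat_of_ne _ _ _ (by decide), Store.setNat_nat]
    rcases Nat.lt_or_eq_of_le hi with h | rfl
    · rw [if_neg (by omega), i₁ i h]
    · rw [if_pos ⟨rfl, rfl⟩, p₁]

/-- The lists for different coordinates are permutations of each other, so their blocks have equal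
lengths and the recorded positions fit all of them. The list `js` must be nonempty because array
`27` would otherwise not be written. -/
theorem rearrangeAll_spec {d : ℕ} (js : List ℕ) (hne : js ≠ []) (hnd : js.Nodup) :
    ∃ C, ∀ (I : Input d) (σ : Store) (l : List ℕ) (cls A B : ℕ → ℕ),
    (∀ j ∈ js, (seg (σ.nat (100 + j)) (σ.nat 4 0) (σ.nat 5 0)).Perm l) → σ.nat 4 0 ≤ σ.nat 5 0 →
    (∀ h ∈ l, σ.nat 22 h = cls h ∧ cls h ∈ [0, 1, 2, 3, 7]) →
    (∀ c ∈ [1, 2, 3], σ.nat 28 c = A c ∧ σ.nat 29 c = B c) →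
    ∃ t σ', Exec I (Prog.seqList rearrange js) σ t σ' ∧ t ≤ C * (σ.nat 5 0 - σ.nat 4 0 + 1) ∧
      (∀ a, a ∉ [7, 8, 11, 26, 27] → (∀ j ∈ js, a ≠ 100 + j) → σ'.nat a = σ.nat a) ∧
      (∀ j ∈ js, seg (σ'.nat (100 + j)) (σ.nat 4 0) (σ.nat 5 0) =
        bucket (label cls A B) (seg (σ.nat (100 + j)) (σ.nat 4 0) (σ.nat 5 0)) 8) ∧
      (∀ j ∈ js, ∀ k, k < σ.nat 4 0 ∨ σ.nat 5 0 ≤ k → σ'.nat (100 + j) k = σ.nat (100 + j) k) ∧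
      (∀ i ≤ 8, σ'.nat 27 i = σ.nat 4 0 + (bucket (label cls A B) l i).length) := by
  induction js with
  | nil => exact absurd rfl hne
  | cons j js ih =>
    obtain ⟨C₁, s₁⟩ := rearrange_spec (d := d) j
    have hj : ∀ i ∈ js, i ≠ j := fun i hi h => (List.nodup_cons.1 hnd).1 (h ▸ hi)
    have hperm : ∀ {l l' : List ℕ} (lab : ℕ → ℕ) (i : ℕ), l.Perm l' →
        (bucket lab l i).length = (bucket lab l' i).length := fun lab i h =>
      ((List.Perm.flatMap_left _ (fun k _ => h.filter _))).length_eq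
    by_cases hjs : js = []
    · subst hjs
      refine ⟨C₁ + 1, fun I σ l cls A B hl hab hcls hAB => ?_⟩
      have hl' := hl j (by simp)
      obtain ⟨t₁, σ₁, e₁, b₁, n₁, f₁, u₁, p₁⟩ := s₁ I σ _ cls A B rfl hab
        (fun h hh => hcls h (hl'.mem_iff.1 hh)) hAB
      refine ⟨_, σ₁, .seq e₁ (.skip _), ?_, fun a ha ha' => n₁ a ?_, ?_, ?_, ?_⟩
      · rw [add_mul]; omega
      · have := ha' j (by simp); simp at ha ⊢; omega
      · simpa using f₁
      · simpa using u₁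
      · intro i hi; rw [p₁ i hi, hperm _ i hl']
    · obtain ⟨C₂, s₂⟩ := ih hjs (List.nodup_cons.1 hnd).2
      refine ⟨C₁ + C₂, fun I σ l cls A B hl hab hcls hAB => ?_⟩
      have hl' := hl j (by simp)
      obtain ⟨t₁, σ₁, e₁, b₁, n₁, f₁, u₁, p₁⟩ := s₁ I σ _ cls A B rfl hab
        (fun h hh => hcls h (hl'.mem_iff.1 hh)) hAB
      have n4 : σ₁.nat 4 = σ.nat 4 := n₁ 4 (by simp; omega)
      have n5 : σ₁.nat 5 = σ.nat 5 := n₁ 5 (by simp; omega)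
      have nj : ∀ i ∈ js, σ₁.nat (100 + i) = σ.nat (100 + i) := fun i hi =>
        n₁ _ (by have := hj i hi; simp; omega)
      obtain ⟨t₂, σ₂, e₂, b₂, n₂, f₂, u₂, p₂⟩ := s₂ I σ₁ l cls A B
        (fun i hi => by rw [n4, n5, nj i hi]; exact hl i (List.mem_cons_of_mem _ hi))
        (by rw [n4, n5]; exact hab) (by rw [n₁ 22 (by simp; omega)]; exact hcls)
        (by rw [n₁ 28 (by simp; omega), n₁ 29 (by simp; omega)]; exact hAB)
      rw [n4, n5] at b₂ f₂ u₂
      rw [n4] at p₂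
      have nj₂ : σ₂.nat (100 + j) = σ₁.nat (100 + j) :=
        n₂ _ (by simp; omega) (fun i hi => by have := hj i hi; omega)
      refine ⟨_, σ₂, .seq e₁ e₂, by rw [add_mul]; omega, fun a ha ha' => ?_, ?_, ?_, p₂⟩
      · rw [n₂ a ha (fun i hi => ha' i (List.mem_cons_of_mem _ hi)), n₁ a]
        have := ha' j (by simp); simp at ha ⊢; omega
      · intro i hi
        rcases List.mem_cons.1 hi with rfl | hi
        · rw [nj₂, f₁]
        · rw [f₂ i hi, nj i hi]
      · intro i hi
        rcases List.mem_cons.1 hi with rfl | hi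
        · rw [nj₂]; exact u₁
        · rw [← nj i hi]; exact u₂ i hi

/-- The stack of segments that are still to be processed. -/
def stack (σ : Store) : List (ℕ × ℕ) := seg (fun i => (σ.nat 20 i, σ.nat 21 i)) 0 (σ.nat 3 0)

/-- Push block `k` on the stack unless it is empty. -/
def pushStep {d : ℕ} (k : ℕ) : Prog d :=
  .ite (.natLe (.plus (.read 27 (.const k)) (.const 1)) (.read 27 (.const (k + 1))))
    (.seq (.setNat 20 (.var 3) (.read 27 (.const k)))
    (.seq (.setNat 21 (.var 3) (.read 27 (.const (k + 1))))
    (.assign 3 (.plus (.var 3) (.const 1))))) .skip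

theorem eval_pushes {d : ℕ} (I : Input d) (ks : List ℕ) (σ : Store) :
    let σ' := (Prog.seqList (pushStep (d := d)) ks).eval I σ
    (∀ a, a ∉ [3, 20, 21] → σ'.nat a = σ.nat a) ∧
    stack σ' = stack σ ++ (ks.map (fun k => (σ.nat 27 k, σ.nat 27 (k + 1)))).filter
      (fun p => p.1 < p.2) := by
  induction ks generalizing σ with
  | nil => simp [Prog.seqList, Prog.eval]
  | cons k ks ih =>
    obtain ⟨h₁, h₂⟩ := ih ((pushStep (d := d) k).eval I σ)
    by_cases h : σ.nat 27 k + 1 ≤ σ.nat 27 (k + 1)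
    · have hT : (Test.natLe (.plus (.read 27 (.const k)) (.const 1))
        (.read 27 (.const (k + 1))) : Test d).Holds I σ := h
      have he : (pushStep (d := d) k).eval I σ = ((σ.setNat 20 (σ.nat 3 0) (σ.nat 27 k)).setNat 21
          (σ.nat 3 0) (σ.nat 27 (k + 1))).setNat 3 0 (σ.nat 3 0 + 1) := by
        simp [pushStep, Prog.eval, hT, NExp.val, Store.setNat_nat]
      have hn : ∀ a, a ∉ [3, 20, 21] → ((pushStep (d := d) k).eval I σ).nat a = σ.nat a := by
        intro a ha
        simp at ha
        rw [he, Store.setNat_nat_of_ne _ _ _ (by omega), Store.setNat_nat_of_ne _ _ _ (by omega),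
          Store.setNat_nat_of_ne _ _ _ (by omega)]
      have hs : stack ((pushStep (d := d) k).eval I σ) =
          stack σ ++ [(σ.nat 27 k, σ.nat 27 (k + 1))] := by
        have h3 : ((pushStep (d := d) k).eval I σ).nat 3 0 = σ.nat 3 0 + 1 := by
          simp [he, Store.setNat_nat]
        rw [stack, h3, seg_succ _ (Nat.zero_le _), he]
        congr 1
        · apply seg_congr
          intro x _ hx
          simp [Store.setNat_nat, hx.ne]
        · simp [Store.setNat_nat]
      simp only [Prog.seqList, Prog.eval]
      refine ⟨fun a ha => by rw [h₁ a ha, hn a ha], ?_⟩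
      rw [h₂, hs, hn 27 (by decide), List.map_cons, List.filter_cons_of_pos (by simpa using h),
        List.append_assoc, List.singleton_append]
    · have hT : ¬ (Test.natLe (.plus (.read 27 (.const k)) (.const 1))
        (.read 27 (.const (k + 1))) : Test d).Holds I σ := h
      have he : (pushStep (d := d) k).eval I σ = σ := by
        simp [pushStep, Prog.eval, hT]
      simp only [Prog.seqList, Prog.eval]
      rw [he] at h₁ h₂ ⊢
      refine ⟨h₁, ?_⟩
      rw [h₂, List.map_cons, List.filter_cons_of_neg (by simpa using h)]

/-- Take a segment from the stack. -/
def popStep {d : ℕ} (e : ℕ) : Prog d :=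
  .seq (.assign 3 (.minus (.var 3) (.const 1)))
  (.seq (.assign 4 (.read 20 (.var 3)))
  (.seq (.assign 5 (.read 21 (.var 3)))
  (.assign 6 (NExp.halves (.minus (.var 5) (.var 4)) e))))

/-- Process a segment: find a separator, rearrange the segment, and push the parts. -/
def node (d e : ℕ) : Prog d :=
  .seq (popStep e) (.seq (cutPhase d) (.seq (forSegment (classify d)) (.seq (counts d)
    (.seq (Prog.seqList rearrange (List.range d))
      (Prog.seqList pushStep [1, 2, 3, 4, 5, 6])))))

theorem eval_popStep {d : ℕ} (I : Input d) (e : ℕ) (σ : Store) (s : List (ℕ × ℕ)) (a b : ℕ)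
    (hs : stack σ = s ++ [(a, b)]) :
    let σ' := (popStep (d := d) e).eval I σ
    σ'.real = σ.real ∧ (∀ x, x ∉ [3, 4, 5, 6] → σ'.nat x = σ.nat x) ∧ stack σ' = s ∧
    σ'.nat 4 0 = a ∧ σ'.nat 5 0 = b ∧ σ'.nat 6 0 = (b - a) / 2 ^ e := by
  intro σ'
  have hlen : σ.nat 3 0 = s.length + 1 := by
    have := congrArg List.length hs
    simpa [stack] using this
  have hs' := hs
  rw [stack, hlen, seg_succ _ (Nat.zero_le _)] at hs'
  obtain ⟨h1, h2⟩ := List.append_inj' hs' rfl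
  simp only [List.cons.injEq, Prod.mk.injEq, and_true] at h2
  have hσ' : σ' = (((σ.setNat 3 0 s.length).setNat 4 0 a).setNat 5 0 b).setNat 6 0
      ((b - a) / 2 ^ e) := by
    simp [σ', popStep, Prog.eval, NExp.val, NExp.val_halves, Store.setNat_nat, hlen, h2.1, h2.2]
  have hn : ∀ x, x ∉ [3, 4, 5, 6] → σ'.nat x = σ.nat x := fun x hx => by
    simp at hx
    rw [hσ', Store.setNat_nat_of_ne _ _ _ (by omega), Store.setNat_nat_of_ne _ _ _ (by omega),
      Store.setNat_nat_of_ne _ _ _ (by omega), Store.setNat_nat_of_ne _ _ _ (by omega)]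
  refine ⟨by rw [hσ']; rfl, hn, ?_, ?_, ?_, ?_⟩
  · rw [stack, hn 20 (by decide), hn 21 (by decide)]
    have : σ'.nat 3 0 = s.length := by simp [hσ', Store.setNat_nat]
    rw [this, h1]
  all_goals simp [hσ', Store.setNat_nat]

theorem label_lt {cls A B : ℕ → ℕ} {h : ℕ} (hc : cls h ∈ [0, 1, 2, 3, 7]) :
    label cls A B h < 8 := by
  simp only [List.mem_cons, List.not_mem_nil, or_false] at hc
  unfold label
  split_ifs with h
  · have := h.1; simp at this; omega
  · omega

theorem cutClass_mem {d : ℕ} (I : Input d) (w : ℝ) (Q Q' : Set (Pt d)) (h : ℕ) :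
    cutClass I w Q Q' h ∈ [0, 1, 2, 3, 7] := by
  unfold cutClass; split_ifs <;> decide

theorem stack_congr {σ σ' : Store} (h3 : σ'.nat 3 = σ.nat 3) (h20 : σ'.nat 20 = σ.nat 20)
    (h21 : σ'.nat 21 = σ.nat 21) : stack σ' = stack σ := by
  rw [stack, stack, h3, h20, h21]

/-- Only the blocks with labels `1, …, 6` are pushed; the positions of the met objects in blocks `0`
and `7` are final. As the segment is nonempty, constant costs are absorbed in `C * (b - a)`. -/
theorem node_spec {d : ℕ} (hd : 1 ≤ d) (e : ℕ) : ∃ C, ∀ (I : Input d) (σ : Store) (N a b : ℕ)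
    (s : List (ℕ × ℕ)) (l : List ℕ) (lo hi : Fin d → ℝ),
    stack σ = s ++ [(a, b)] → a < b → b - a ≤ N → σ.nat 2 0 ≤ N → σ.nat 0 0 = I.m₁ →
    l = seg (σ.nat 100) a b → (∀ j < d, (seg (σ.nat (100 + j)) a b).Perm l) →
    (∀ j, lo j = I.rep (σ.nat (100 + j) (a + (b - a) / 2 ^ e)) j) →
    (∀ j, hi j = I.rep (σ.nat (100 + j) (b - (1 + (b - a) / 2 ^ e))) j) →
    (∀ j, lo j ≤ hi j) →
    ∃ t σ' w R c c' A B, Exec I (node d e) σ t σ' ∧ t ≤ C * (b - a) ∧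
      IsCut I.rep l (σ.nat 2 0) N lo hi w R c c' ∧
      (∀ k ∈ [1, 2, 3],
        A k = (l.filter (fun h => cutClass I w (cube c R) (cube c' R) h = k ∧ h < I.m₁)).length ∧
        B k = (l.filter (fun h => cutClass I w (cube c R) (cube c' R) h = k ∧
          ¬ h < I.m₁)).length) ∧
      (∀ j < d, seg (σ'.nat (100 + j)) a b =
        bucket (label (cutClass I w (cube c R) (cube c' R)) A B) (seg (σ.nat (100 + j)) a b) 8) ∧
      (∀ j < d, ∀ k, k < a ∨ b ≤ k → σ'.nat (100 + j) k = σ.nat (100 + j) k) ∧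
      σ'.nat 0 = σ.nat 0 ∧ σ'.nat 2 = σ.nat 2 ∧
      stack σ' = s ++ ([1, 2, 3, 4, 5, 6].map (fun k =>
        (a + (bucket (label (cutClass I w (cube c R) (cube c' R)) A B) l k).length,
         a + (bucket (label (cutClass I w (cube c R) (cube c' R)) A B) l (k + 1)).length))).filter
        (fun p => p.1 < p.2) := by
  obtain ⟨C₂, s₂⟩ := cutPhase_spec hd
  obtain ⟨C₃, s₃⟩ := classify_spec (d := d)
  obtain ⟨C₄, s₄⟩ := counts_spec (d := d)
  obtain ⟨C₅, s₅⟩ := rearrangeAll_spec (d := d) (List.range d)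
    (fun h => by have := congrArg List.length h; simp at this; omega) List.nodup_range
  have st₁ : (popStep (d := d) e).Straight := by simp [popStep, Prog.Straight]
  have st₆ : (Prog.seqList (pushStep (d := d)) [1, 2, 3, 4, 5, 6]).Straight :=
    Prog.straight_seqList (fun k => by simp [pushStep, Prog.Straight]) _
  refine ⟨(popStep (d := d) e).bound + 2 * C₂ + 2 * C₃ + 2 * C₄ + 2 * C₅ +
    (Prog.seqList (pushStep (d := d)) [1, 2, 3, 4, 5, 6]).bound,
    fun I σ N a b s l lo hi hs hab hN hmN h0 hl hperm hlo hhi hlohi => ?_⟩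
  obtain ⟨t₁, b₁, e₁⟩ := Prog.exec_eval I (popStep e) st₁ σ
  obtain ⟨-, n₁, k₁, h4, h5, h6⟩ := eval_popStep I e σ s a b hs
  set σ₁ := (popStep e).eval I σ
  have n100 : ∀ j, σ₁.nat (100 + j) = σ.nat (100 + j) := fun j => n₁ _ (by simp; omega)
  obtain ⟨t₂, σ₂, e₂, b₂, cut⟩ := s₂ I σ₁ N lo hi (by omega) (by omega)
    (by rw [n₁ 2 (by decide)]; exact hmN)
    (fun j => by rw [n100, h4, h6]; exact hlo j)
    (fun j => by rw [n100, h5, h6]; exact hhi j) hlohi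
  rw [h4, h5, n₁ 100 (by decide), ← hl, n₁ 2 (by decide)] at cut
  rw [h4, h5] at b₂
  set w := σ₂.real 0 0
  set R := σ₂.real 4 0
  set c : Pt d := fun j => σ₂.real 6 j
  set c' : Pt d := fun j => σ₂.real 7 j
  have n₂ : ∀ x, x ∉ [7, 8, 9, 10, 11, 12, 13, 23, 24, 25] → σ₂.nat x = σ₁.nat x :=
    fun x hx => e₂.nat_eq (fun h => hx (cutPhase_writesNat h))
  obtain ⟨t₃, σ₃, e₃, b₃, cl⟩ := s₃ I σ₂ (cube c R) (cube c' R)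
    (by rw [n₂ 4 (by decide), n₂ 5 (by decide)]; omega)
    (by rw [n₂ 0 (by decide), n₁ 0 (by decide), h0]) rfl rfl
  rw [n₂ 4 (by decide), n₂ 5 (by decide), n₂ 100 (by decide), n₁ 100 (by decide), h4, h5,
    ← hl] at cl
  rw [n₂ 4 (by decide), n₂ 5 (by decide), h4, h5] at b₃
  set cls := cutClass I w (cube c R) (cube c' R)
  have n₃ : ∀ x, x ∉ [7, 11, 22] → σ₃.nat x = σ₂.nat x := fun x hx => e₃.nat_eq (fun h => by
    simp [forSegment, classify, classifyMet, Prog.forLoop, Prog.WritesNat] at h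
    simp at hx; omega)
  have N₃ : ∀ x, x ∉ [7, 8, 9, 10, 11, 12, 13, 22, 23, 24, 25] → σ₃.nat x = σ₁.nat x :=
    fun x hx => by
      simp at hx
      rw [n₃ x (by simp; omega), n₂ x (by simp; omega)]
  obtain ⟨t₄, σ₄, e₄, b₄, n₄, cnt⟩ := s₄ I σ₃ cls l
    (by rw [N₃ 100 (by decide), n₁ 100 (by decide), N₃ 4 (by decide), N₃ 5 (by decide), h4, h5, hl])
    (by rw [N₃ 4 (by decide), N₃ 5 (by decide)]; omega)
    (by rw [N₃ 0 (by decide), n₁ 0 (by decide), h0]) cl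
  rw [N₃ 4 (by decide), N₃ 5 (by decide), h4, h5] at b₄
  have N₄ : ∀ x, x ∉ [7, 8, 9, 10, 11, 12, 13, 22, 23, 24, 25, 26, 28, 29] →
      σ₄.nat x = σ₁.nat x := fun x hx => by
    simp at hx
    rw [n₄ x (by simp; omega), N₃ x (by simp; omega)]
  have N100 : ∀ j, σ₄.nat (100 + j) = σ.nat (100 + j) := fun j => by
    rw [N₄ _ (by simp; omega), n100]
  obtain ⟨t₅, σ₅, e₅, b₅, n₅, f₅, u₅, p₅⟩ := s₅ I σ₄ l cls (σ₄.nat 28) (σ₄.nat 29)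
    (fun j hj => by
      rw [N100, N₄ 4 (by decide), N₄ 5 (by decide), h4, h5]
      exact hperm j (List.mem_range.1 hj))
    (by rw [N₄ 4 (by decide), N₄ 5 (by decide)]; omega)
    (fun h hh => ⟨by rw [n₄ 22 (by decide), cl h hh], cutClass_mem _ _ _ _ _⟩)
    (fun _ _ => ⟨rfl, rfl⟩)
  rw [N₄ 4 (by decide), N₄ 5 (by decide), h4, h5] at b₅ f₅ u₅
  rw [N₄ 4 (by decide), h4] at p₅
  obtain ⟨t₆, b₆, e₆⟩ := Prog.exec_eval I _ st₆ σ₅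
  obtain ⟨n₆, k₆⟩ := eval_pushes (d := d) I [1, 2, 3, 4, 5, 6] σ₅
  set σ₆ := (Prog.seqList (pushStep (d := d)) [1, 2, 3, 4, 5, 6]).eval I σ₅
  have m100 : ∀ x < 100, ∀ j ∈ List.range d, x ≠ 100 + j := fun x hx j _ => by omega
  refine ⟨_, σ₆, w, R, c, c', σ₄.nat 28, σ₄.nat 29,
    .seq e₁ (.seq e₂ (.seq e₃ (.seq e₄ (.seq e₅ e₆)))), ?_, cut, cnt, ?_, ?_, ?_, ?_, ?_⟩
  · have q₁ := Nat.le_mul_of_pos_right (popStep (d := d) e).bound (show 0 < b - a by omega)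
    have q₂ := Nat.le_mul_of_pos_right (Prog.seqList (pushStep (d := d)) [1, 2, 3, 4, 5, 6]).bound
      (show 0 < b - a by omega)
    have q₃ : ∀ K, K * (b - a + 1) ≤ 2 * K * (b - a) := fun K => by
      have : b - a + 1 ≤ 2 * (b - a) := by omega
      calc K * (b - a + 1) ≤ K * (2 * (b - a)) := Nat.mul_le_mul_left _ this
        _ = _ := by ring
    have := q₃ C₂
    have := q₃ C₃
    have := q₃ C₄
    have := q₃ C₅
    simp only [add_mul _ _ (b - a)] at *
    omega
  · intro j hj
    rw [n₆ _ (by simp; omega), f₅ j (List.mem_range.2 hj), N100]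
  · intro j hj k hk
    rw [n₆ _ (by simp; omega), u₅ j (List.mem_range.2 hj) k hk, N100]
  · rw [n₆ 0 (by decide), n₅ 0 (by decide) (m100 0 (by decide)), N₄ 0 (by decide),
      n₁ 0 (by decide)]
  · rw [n₆ 2 (by decide), n₅ 2 (by decide) (m100 2 (by decide)), N₄ 2 (by decide),
      n₁ 2 (by decide)]
  · rw [k₆]
    congr 1
    · rw [stack_congr (n₅ 3 (by decide) (m100 3 (by decide)))
        (n₅ 20 (by decide) (m100 20 (by decide))) (n₅ 21 (by decide) (m100 21 (by decide))),
        stack_congr (N₄ 3 (by decide)) (N₄ 20 (by decide)) (N₄ 21 (by decide)), k₁]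
    · congr 1
      refine List.map_congr_left fun k hk => ?_
      have : k ≤ 6 := by simp at hk; omega
      rw [p₅ k (by omega), p₅ (k + 1) (by omega)]

/-! ## Geometry of the separator -/

/-- Closed balls of the maximum metric are cubes, with half the side length as radius. -/
theorem mem_cube_iff {d : ℕ} {c x : Pt d} {s : ℝ} (hs : 0 ≤ s) : x ∈ cube c s ↔ dist x c ≤ s / 2 := by
  rw [dist_pi_le_iff (by linarith)]
  simp only [cube, Set.mem_ofPred_eq, Real.dist_eq, abs_le]
  refine forall_congr' fun j => ⟨fun h => ⟨by linarith [h.1], by linarith [h.2]⟩,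
    fun h => ⟨by linarith [h.1], by linarith [h.2]⟩⟩

/-- Boundedness makes the set of admissible side lengths nonempty, so its infimum lies above no
smaller bound than it should: some enclosing cube has side less than `r`. The two points are then
compared through its center, so attainment of the infimum is not needed. -/
theorem dist_lt_of_objSize_lt {d : ℕ} {X : Set (Pt d)} (hX : Bornology.IsBounded X) {r : ℝ}
    (hr : objSize X < r) {x y : Pt d} (hx : x ∈ X) (hy : y ∈ X) : dist x y < r := by
  have hne : {s : ℝ | 0 ≤ s ∧ ∃ c : Pt d, X ⊆ cube c s}.Nonempty := by
    obtain ⟨M, hM, hXM⟩ := hX.subset_closedBall_lt 0 (0 : Pt d)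
    refine ⟨2 * M, by linarith, 0, fun z hz => ?_⟩
    rw [mem_cube_iff (by linarith)]
    have := hXM hz
    rw [Metric.mem_closedBall] at this; linarith
  obtain ⟨s, ⟨hs, c, hc⟩, hsr⟩ := exists_lt_of_csInf_lt hne hr
  have h1 := hc hx
  have h2 := hc hy
  rw [mem_cube_iff hs] at h1 h2
  have := dist_triangle_right x y c
  linarith

theorem exists_slot {r : ℝ} (K : ℕ) (hK : 1 ≤ K) (u : ℝ) (hu : 0 ≤ u)
    (huK : u ≤ K * r) : ∃ k < K, k * r ≤ u ∧ u ≤ (k + 1) * r := by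
  induction K, hK using Nat.le_induction with
  | base => exact ⟨0, by omega, by simpa using hu, by simpa using huK⟩
  | succ K hK ih =>
    by_cases h : u ≤ K * r
    · obtain ⟨k, hk, h'⟩ := ih h
      exact ⟨k, by omega, h'⟩
    · exact ⟨K, by omega, (lt_of_not_ge h).le, by push_cast at huK; exact huK⟩

/-- The handles in `H` present pairwise disjoint objects that form an `f`-fat collection. -/
structure IsFatFamily {d : ℕ} (obj : ℕ → Set (Pt d)) (f : ℕ) (H : Finset ℕ) : Prop where
  disjoint : ∀ h ∈ H, ∀ h' ∈ H, h ≠ h' → Disjoint (obj h) (obj h')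
  fat : ∀ (c : Pt d) (r : ℝ), 0 < r → ∃ P : Finset (Pt d), P.card ≤ f ∧
    ∀ h ∈ H, (obj h ∩ cube c r).Nonempty → r ≤ objSize (obj h) → ∃ p ∈ P, p ∈ obj h

theorem IsFatFamily.mono {d : ℕ} {obj : ℕ → Set (Pt d)} {f : ℕ} {H H' : Finset ℕ}
    (h : IsFatFamily obj f H) (hs : H' ⊆ H) : IsFatFamily obj f H' where
  disjoint x hx y hy := h.disjoint x (hs hx) y (hs hy)
  fat c r hr := by
    obtain ⟨P, hP, h'⟩ := h.fat c r hr
    exact ⟨P, hP, fun x hx => h' x (hs hx)⟩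

/-- Only few big objects of a fat family meet a facet of a cube. -/
theorem IsFatFamily.card_le {d : ℕ} {obj : ℕ → Set (Pt d)} {f : ℕ} {H : Finset ℕ}
    (hH : IsFatFamily obj f H) (j : Fin d) (y : ℝ) (c : Pt d) (R r : ℝ) (K : ℕ) (hr : 0 < r)
    (hK : 1 ≤ K) (hRK : R ≤ K * r) (hbig : ∀ h ∈ H, r ≤ objSize (obj h))
    (hmeet : ∀ h ∈ H, ∃ x ∈ obj h, x j = y ∧ dist x c ≤ R / 2) : H.card ≤ K ^ (d - 1) * f := by
  classical
  -- The indices of `K ^ (d - 1)` cubes of side `r`, centered on the hyperplane, that cover the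
  -- slice: `K` slots in every direction except `j`, where one suffices.
  set T : Finset (Fin d → ℕ) :=
    Fintype.piFinset (fun i => if i = j then {0} else Finset.range K) with hT
  have hTc : T.card = K ^ (d - 1) := by
    have : ∀ i : Fin d, (if i = j then ({0} : Finset ℕ) else Finset.range K).card =
        if i = j then 1 else K := fun i => by split_ifs <;> simp
    rw [hT, Fintype.card_piFinset, Finset.prod_congr rfl (fun i _ => this i),
      Finset.prod_ite, Finset.prod_const_one, one_mul, Finset.prod_const]
    congr 1
    rw [Finset.filter_ne' Finset.univ j, Finset.card_erase_of_mem (Finset.mem_univ j),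
      Finset.card_univ, Fintype.card_fin]
  let ctr : (Fin d → ℕ) → Pt d := fun g i =>
    if i = j then y else c i - R / 2 + (g i + 1 / 2) * r
  choose P hPc hP using fun g => hH.fat (ctr g) r hr
  have hsub : H ⊆ T.biUnion (fun g => (P g).biUnion fun p => H.filter (fun h => p ∈ obj h)) := by
    intro h hh
    obtain ⟨x, hx, hxj, hxc⟩ := hmeet h hh
    have hR : 0 ≤ R / 2 := dist_nonneg.trans hxc
    rw [dist_pi_le_iff hR] at hxc
    have hxc' : ∀ i, 0 ≤ x i - (c i - R / 2) ∧ x i - (c i - R / 2) ≤ K * r := fun i => by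
      have := hxc i
      rw [Real.dist_eq, abs_le] at this
      constructor <;> linarith [this.1, this.2]
    choose k hk hk' using fun i => exists_slot K hK _ (hxc' i).1 (hxc' i).2
    let g : Fin d → ℕ := fun i => if i = j then 0 else k i
    have hg : g ∈ T := by
      rw [hT, Fintype.mem_piFinset]
      intro i
      by_cases hi : i = j <;> simp [g, hi, hk]
    have hxg : x ∈ cube (ctr g) r := by
      intro i
      by_cases hi : i = j
      · subst hi; simp only [ctr, if_true, hxj]; constructor <;> linarith
      · simp only [ctr, g, hi, if_false]
        have := hk' i
        constructor <;> nlinarith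
    obtain ⟨p, hp, hph⟩ := hP g h hh ⟨x, hx, hxg⟩ (hbig h hh)
    simp only [Finset.mem_biUnion, Finset.mem_filter]
    exact ⟨g, hg, p, hp, hh, hph⟩
  refine (Finset.card_le_card hsub).trans ?_
  rw [← hTc]
  refine Finset.card_biUnion_le_card_mul _ _ _ fun g _ => ?_
  refine (Finset.card_biUnion_le_card_mul _ _ 1 fun p _ => ?_).trans (by rw [mul_one]; exact hPc g)
  -- The objects are pairwise disjoint, so each of the at most `f` piercing points of a small cube
  -- accounts for at most one object.
  rw [Finset.card_le_one]
  intro h hh h' hh'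
  rw [Finset.mem_filter] at hh hh'
  by_contra hne
  exact Set.disjoint_left.1 (hH.disjoint h hh.1 h' hh'.1 hne) hh.2 hh'.2

/-- A connected set that meets a cube and is not contained in it meets the boundary. -/
theorem exists_mem_sphere {d : ℕ} {X : Set (Pt d)} (hX : IsConnected X) {c : Pt d} {R : ℝ}
    (hR : 0 < R) (h1 : ¬ X ⊆ cube c R) (h2 : ¬ Disjoint X (cube c R)) :
    ∃ x ∈ X, dist x c = R / 2 ∧ ∃ j, x j = c j + R / 2 ∨ x j = c j - R / 2 := by
  obtain ⟨y, hy, hyc⟩ := Set.not_subset.1 h1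
  obtain ⟨z, hz, hzc⟩ := Set.not_disjoint_iff.1 h2
  rw [mem_cube_iff hR.le] at hyc hzc
  -- The distance from the center takes values on both sides of `R / 2`, so the intermediate value
  -- theorem on the connected set yields a point at distance exactly `R / 2`.
  have hcont : ContinuousOn (fun x : Pt d => dist x c) X := by fun_prop
  obtain ⟨x, hx, hxc⟩ := hX.isPreconnected.intermediate_value hz hy hcont
    ⟨hzc, (lt_of_not_ge hyc).le⟩
  refine ⟨x, hx, hxc, ?_⟩
  -- In the maximum metric some coordinate attains this distance, so the point lies on a facet.
  by_contra hcon
  push Not at hcon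
  have : dist x c < R / 2 := by
    rw [dist_pi_lt_iff (by linarith)]
    intro j
    have hle : dist (x j) (c j) ≤ R / 2 := hxc ▸ dist_le_pi_dist x c j
    refine lt_of_le_of_ne hle fun heq => ?_
    rw [Real.dist_eq] at heq
    rcases abs_choice (x j - c j) with h | h
    · exact (hcon j).1 (by linarith)
    · exact (hcon j).2 (by linarith)
  exact this.ne hxc

/-- A connected set in a cube that meets a half-space and its complement meets the hyperplane. -/
theorem exists_mem_hyperplane {d : ℕ} {X : Set (Pt d)} (hX : IsConnected X) {c : Pt d} {R t : ℝ}
    {j : Fin d} (hR : 0 < R) (hQ : X ⊆ cube c R) (ht : c j - R / 2 ≤ t) (ht' : t ≤ c j + R / 2)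
    (h1 : ¬ X ⊆ cube (Function.update c j (t - R / 2)) R)
    (h2 : ¬ Disjoint X (cube (Function.update c j (t - R / 2)) R)) :
    ∃ x ∈ X, dist x c ≤ R / 2 ∧ x j = t := by
  -- The translated cube has its upper facet in direction `j` at `t` and its lower facet at `t - R`,
  -- not above the lower facet of the original cube. So within the original cube it is the
  -- half-space `x j ≤ t`.
  have key : ∀ x ∈ X, x ∈ cube (Function.update c j (t - R / 2)) R ↔ x j ≤ t := by
    intro x hx
    have hxc := hQ hx
    constructor
    · intro h; have := (h j).2; simp at this; exact this
    · intro h i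
      by_cases hi : i = j
      · subst hi; have := hxc i; simp only [Function.update_self]
        constructor <;> linarith [this.1]
      · simpa [hi] using hxc i
  obtain ⟨y, hy, hyc⟩ := Set.not_subset.1 h1
  obtain ⟨z, hz, hzc⟩ := Set.not_disjoint_iff.1 h2
  rw [key y hy] at hyc
  rw [key z hz] at hzc
  have hcont : ContinuousOn (fun x : Pt d => x j) X := by fun_prop
  obtain ⟨x, hx, hxj⟩ := hX.isPreconnected.intermediate_value hz hy hcont
    ⟨hzc, (lt_of_not_ge hyc).le⟩
  exact ⟨x, hx, (mem_cube_iff hR.le).1 (hQ hx), hxj⟩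

theorem card_filter_toFinset {l : List ℕ} (hl : l.Nodup) (p : ℕ → Prop) [DecidablePred p] :
    (l.toFinset.filter p).card = (l.filter (fun h => p h)).length := by
  rw [← List.toFinset_card_of_nodup (hl.filter _), List.toFinset_filter]
  simp

/-- What the algorithm needs to know about the input. -/
structure Input.IsGood {d : ℕ} (I : Input d) (f : ℕ) : Prop where
  object : ∀ h < I.m₁ + I.m₂, IsObject (I.obj h)
  rep_mem : ∀ h < I.m₁ + I.m₂, I.rep h ∈ I.obj h
  first : IsFatFamily I.obj f (Finset.range I.m₁)
  second : IsFatFamily I.obj f (Finset.Ico I.m₁ (I.m₁ + I.m₂))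

/-- A bound for the objects that meet a set near which there is a sparse window. -/
theorem Input.IsGood.card_le {d : ℕ} {I : Input d} {f : ℕ} (hI : I.IsGood f) {H : Finset ℕ}
    (hH : ∀ h ∈ H, h < I.m₁ + I.m₂) {m B : ℕ} {r : ℝ}
    (hsmall : (H.filter (fun h => objSize (I.obj h) < r)).card ≤ m)
    (hbig : ∀ H' ⊆ H, IsFatFamily I.obj f H' → (∀ h ∈ H', r ≤ objSize (I.obj h)) → H'.card ≤ B) :
    H.card ≤ m + 2 * B := by
  classical
  -- Fatness and disjointness hold within each of the two sets only, so the large objects are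
  -- counted separately for each set; hence the factor `2`.
  have h1 := hbig (H.filter (fun h => r ≤ objSize (I.obj h) ∧ h < I.m₁)) (Finset.filter_subset _ _)
    (hI.first.mono fun h hh => by simp at hh ⊢; exact hh.2.2) (fun h hh => by
      simp at hh; exact hh.2.1)
  have h2 := hbig (H.filter (fun h => r ≤ objSize (I.obj h) ∧ ¬ h < I.m₁)) (Finset.filter_subset _ _)
    (hI.second.mono fun h hh => by
      simp at hh ⊢; exact ⟨hh.2.2, hH h hh.1⟩) (fun h hh => by simp at hh; exact hh.2.1)
  have h3 : H ⊆ H.filter (fun h => objSize (I.obj h) < r) ∪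
      (H.filter (fun h => r ≤ objSize (I.obj h) ∧ h < I.m₁) ∪
       H.filter (fun h => r ≤ objSize (I.obj h) ∧ ¬ h < I.m₁)) := by
    intro h hh
    simp only [Finset.mem_union, Finset.mem_filter, hh, true_and]
    rcases lt_or_ge (objSize (I.obj h)) r with h' | h'
    · exact .inl h'
    · by_cases h'' : h < I.m₁
      · exact .inr (.inl ⟨h', h''⟩)
      · exact .inr (.inr ⟨h', h''⟩)
  have := (Finset.card_le_card h3).trans ((Finset.card_union_le _ _).trans
    (Nat.add_le_add_left (Finset.card_union_le _ _) _))
  omega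

/-- With `K` the number of slots, `K * m ≤ 13 * N`. Raising this to the power `d - 1` and using `N ^
(d - 1) ≤ m ^ d` leaves exactly one factor `m` after cancelling `m ^ (d - 1)`. This balance is the
reason for the choice of the scale `m`. -/
theorem slots_pow_le {d m N : ℕ} (hd : 1 ≤ d) (hm : 1 ≤ m) (hmN : m ≤ N)
    (hN : N ^ (d - 1) ≤ m ^ d) : (12 * N / m + 1) ^ (d - 1) ≤ 13 ^ (d - 1) * m := by
  have h1 : (12 * N / m + 1) * m ≤ 13 * N := by
    have := Nat.div_mul_le_self (12 * N) m
    rw [add_mul]; omega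
  have h2 := Nat.pow_le_pow_left h1 (d - 1)
  rw [mul_pow, mul_pow] at h2
  have h3 : m ^ d = m * m ^ (d - 1) := by
    obtain ⟨k, rfl⟩ : ∃ k, d = k + 1 := ⟨d - 1, by omega⟩
    rw [Nat.add_sub_cancel, pow_succ']
  refine le_of_mul_le_mul_right (a := m ^ (d - 1)) ?_ (by positivity)
  calc _ ≤ 13 ^ (d - 1) * N ^ (d - 1) := h2
    _ ≤ 13 ^ (d - 1) * m ^ d := Nat.mul_le_mul_left _ hN
    _ = _ := by rw [h3, mul_assoc]

/-- The window has width at least `w * m / (2 * N)`, so half of it is at least `w * m / (4 * N)`;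
hence `12 * N / m` slots of that size cover the length `3 * w`. This length bounds the side `R = x +
y` of the cube, as both ends of the distance window are at most `3 * w / 2`. The `+ 1` compensates
the rounding of the quotient. -/
theorem slots_mul_ge {w x y : ℝ} {m N : ℕ} (hm : 1 ≤ m) (hw : 0 < w)
    (h : w * m ≤ (y - x) * (2 * N)) :
    3 * w ≤ ((12 * N / m + 1 : ℕ) : ℝ) * ((y - x) / 2) ∧ x < y := by
  have hm' : (0 : ℝ) < m := by exact_mod_cast hm
  have h1 : 12 * N ≤ (12 * N / m + 1) * m := by
    rw [mul_comm _ m]; exact (Nat.lt_mul_div_succ (12 * N) hm).le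
  have h2 : (12 * N : ℝ) ≤ ((12 * N / m + 1 : ℕ) : ℝ) * m := by exact_mod_cast h1
  have hN : (0 : ℝ) ≤ N := Nat.cast_nonneg N
  have hxy : x < y := by
    by_contra hc
    have : (y - x) * (2 * N) ≤ 0 := mul_nonpos_of_nonpos_of_nonneg (by linarith) (by linarith)
    have : 0 < w * m := mul_pos hw hm'
    linarith
  refine ⟨?_, hxy⟩
  have h3 : 0 < (y - x) / 2 := by linarith
  have h4 := mul_le_mul_of_nonneg_right h2 h3.le
  have h5 : 3 * w * m ≤ ((12 * N / m + 1 : ℕ) : ℝ) * ((y - x) / 2) * m := by nlinarith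
  exact le_of_mul_le_mul_right h5 hm'

/-- The set of handles with few objects that meet the boundary of the cube of a cut. -/
theorem IsCut.card_sphere_le {d : ℕ} (hd : 1 ≤ d) {I : Input d} {f : ℕ} (hI : I.IsGood f)
    {l : List ℕ} (hl : l.Nodup) (hln : ∀ h ∈ l, h < I.m₁ + I.m₂) {m N : ℕ} {lo hi : Fin d → ℝ}
    {w R : ℝ} {c c' : Pt d} (hcut : IsCut I.rep l m N lo hi w R c c') (hm : 1 ≤ m) (hmN : m ≤ N)
    (hN : N ^ (d - 1) ≤ m ^ d) (hw : 0 < w) {H : Finset ℕ} (hHl : H ⊆ l.toFinset)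
    (hH : ∀ h ∈ H, ¬ I.obj h ⊆ cube c R ∧ ¬ Disjoint (I.obj h) (cube c R)) :
    H.card ≤ m + 2 * (2 * d * (13 ^ (d - 1) * m * f)) := by
  classical
  obtain ⟨x, y, hx, hxy, hy, hwin, hwm, rfl⟩ := hcut.sphere
  obtain ⟨hK, hxy'⟩ := slots_mul_ge hm hw hwm
  have hR : 0 < x + y := by linarith
  have hHn : ∀ h ∈ H, h < I.m₁ + I.m₂ := fun h hh => hln h (List.mem_toFinset.1 (hHl hh))
  have hmeet : ∀ h ∈ H, ∃ z ∈ I.obj h, dist z c = (x + y) / 2 ∧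
      ∃ j, z j = c j + (x + y) / 2 ∨ z j = c j - (x + y) / 2 := fun h hh =>
    exists_mem_sphere (hI.object h (hHn h hh)).1 hR (hH h hh).1 (hH h hh).2
  -- The sphere lies in the middle of the window, at distance `(y - x) / 2` from both ends. An
  -- object of smaller size that meets it has its representative strictly inside the window.
  refine hI.card_le hHn (r := (y - x) / 2) ?_ ?_
  · rw [← card_filter_toFinset hl] at hwin
    refine (Finset.card_le_card fun h hh => ?_).trans hwin
    rw [Finset.mem_filter] at hh ⊢
    obtain ⟨z, hz, hzc, -⟩ := hmeet h hh.1
    have h1 := dist_lt_of_objSize_lt (hI.object h (hHn h hh.1)).2 hh.2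
      (hI.rep_mem h (hHn h hh.1)) hz
    have h2 := dist_triangle (I.rep h) z c
    have h3 := dist_triangle_left z c (I.rep h)
    exact ⟨hHl hh.1, by linarith, by linarith⟩
  · intro H' hH' hfat hbig
    -- The boundary consists of `2 * d` facets, indexed by a direction and a side.
    have hsub : H' ⊆ (Finset.univ : Finset (Fin d × Bool)).biUnion (fun p => H'.filter
        (fun h => ∃ z ∈ I.obj h, z p.1 = (if p.2 then c p.1 + (x + y) / 2 else c p.1 - (x + y) / 2) ∧
          dist z c ≤ (x + y) / 2)) := by
      intro h hh
      obtain ⟨z, hz, hzc, j, hj⟩ := hmeet h (hH' hh)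
      simp only [Finset.mem_biUnion, Finset.mem_filter, Finset.mem_univ, true_and]
      rcases hj with hj | hj
      · exact ⟨(j, true), hh, z, hz, by simpa using hj, hzc.le⟩
      · exact ⟨(j, false), hh, z, hz, by simpa using hj, hzc.le⟩
    refine (Finset.card_le_card hsub).trans ((Finset.card_biUnion_le_card_mul _ _
      (13 ^ (d - 1) * m * f) fun p _ => ?_).trans ?_)
    · refine ((hfat.mono (Finset.filter_subset _ _)).card_le p.1 _ c (x + y) ((y - x) / 2)
        (12 * N / m + 1) (by linarith) (Nat.le_add_left 1 _) (by linarith)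
        (fun h hh => hbig h (Finset.mem_filter.1 hh).1)
        (fun h hh => (Finset.mem_filter.1 hh).2)).trans ?_
      exact Nat.mul_le_mul_right _ (slots_pow_le hd hm hmN hN)
    · simp [mul_comm d 2]

/-- The set of handles with few objects in the cube of a cut that meet the splitting hyperplane. -/
theorem IsCut.card_split_le {d : ℕ} (hd : 1 ≤ d) {I : Input d} {f : ℕ} (hI : I.IsGood f)
    {l : List ℕ} (hl : l.Nodup) (hln : ∀ h ∈ l, h < I.m₁ + I.m₂) {m N : ℕ} {lo hi : Fin d → ℝ}
    {w R : ℝ} {c c' : Pt d} (hcut : IsCut I.rep l m N lo hi w R c c') (hm : 1 ≤ m) (hmN : m ≤ N)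
    (hN : N ^ (d - 1) ≤ m ^ d) (hw : 0 < w) {H : Finset ℕ} (hHl : H ⊆ l.toFinset)
    (hH : ∀ h ∈ H, I.obj h ⊆ cube c R ∧ ¬ I.obj h ⊆ cube c' R ∧
      ¬ Disjoint (I.obj h) (cube c' R)) :
    H.card ≤ m + 2 * (13 ^ (d - 1) * m * f) := by
  classical
  obtain ⟨x', y', hx', hxy', hy', -, -, rfl⟩ := hcut.sphere
  obtain ⟨j, x, y, hj, hx, hxy, hy, hwin, hwm, rfl⟩ := hcut.split hw
  obtain ⟨hK, hxy''⟩ := slots_mul_ge hm hw hwm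
  have hR : 0 < x' + y' := by linarith
  have hHn : ∀ h ∈ H, h < I.m₁ + I.m₂ := fun h hh => hln h (List.mem_toFinset.1 (hHl hh))
  have hc := hcut.center j
  have hmeet : ∀ h ∈ H, ∃ z ∈ I.obj h, dist z c ≤ (x' + y') / 2 ∧ z j = (x + y) / 2 :=
    fun h hh => exists_mem_hyperplane (hI.object h (hHn h hh)).1 hR (hH h hh).1 (by linarith)
      (by linarith) (hH h hh).2.1 (hH h hh).2.2
  -- The hyperplane lies in the middle of the coordinate window, and coordinate differences are at
  -- most distances, so small met objects again have representatives strictly inside.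
  refine hI.card_le hHn (r := (y - x) / 2) ?_ ?_
  · rw [← card_filter_toFinset hl] at hwin
    refine (Finset.card_le_card fun h hh => ?_).trans hwin
    rw [Finset.mem_filter] at hh ⊢
    obtain ⟨z, hz, -, hzj⟩ := hmeet h hh.1
    have h1 := dist_lt_of_objSize_lt (hI.object h (hHn h hh.1)).2 hh.2
      (hI.rep_mem h (hHn h hh.1)) hz
    have h2 := (dist_le_pi_dist (I.rep h) z j).trans_lt h1
    rw [Real.dist_eq, abs_lt] at h2
    exact ⟨hHl hh.1, by linarith [h2.1], by linarith [h2.2]⟩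
  · intro H' hH' hfat hbig
    refine (hfat.card_le j ((x + y) / 2) c (x' + y') ((y - x) / 2)
        (12 * N / m + 1) (by linarith) (Nat.le_add_left 1 _) (by linarith) hbig
        (fun h hh => ?_)).trans ?_
    · obtain ⟨z, hz, hzc, hzj⟩ := hmeet h (hH' hh)
      exact ⟨z, hz, hzj, hzc⟩
    · exact Nat.mul_le_mul_right _ (slots_pow_le hd hm hmN hN)

/-- The corners `lo` and `hi` cut off at most `q` and at least `q + 1` points (with ties) in every
direction. -/
structure IsQuantile {d : ℕ} (rep : ℕ → Pt d) (H : Finset ℕ) (q : ℕ) (lo hi : Fin d → ℝ) :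
    Prop where
  lt_lo : ∀ j, (H.filter (fun h => rep h j < lo j)).card ≤ q
  le_lo : ∀ j, q + 1 ≤ (H.filter (fun h => rep h j ≤ lo j)).card
  hi_lt : ∀ j, (H.filter (fun h => hi j < rep h j)).card ≤ q
  hi_le : ∀ j, q + 1 ≤ (H.filter (fun h => hi j ≤ rep h j)).card

theorem IsQuantile.card_outside_le {d : ℕ} {rep : ℕ → Pt d} {H : Finset ℕ} {q : ℕ}
    {lo hi : Fin d → ℝ} (hq : IsQuantile rep H q lo hi) {H' : Finset ℕ} (hs : H' ⊆ H)
    (hH' : ∀ h ∈ H', ∃ j, rep h j < lo j ∨ hi j < rep h j) : H'.card ≤ d * (2 * q) := by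
  classical
  have hsub : H' ⊆ (Finset.univ : Finset (Fin d)).biUnion (fun j =>
      H.filter (fun h => rep h j < lo j) ∪ H.filter (fun h => hi j < rep h j)) := by
    intro h hh
    obtain ⟨j, hj⟩ := hH' h hh
    simp only [Finset.mem_biUnion, Finset.mem_union, Finset.mem_filter, Finset.mem_univ, true_and]
    exact ⟨j, hj.imp (fun h' => ⟨hs hh, h'⟩) (fun h' => ⟨hs hh, h'⟩)⟩
  refine (Finset.card_le_card hsub).trans ((Finset.card_biUnion_le_card_mul _ _ (2 * q)
    fun j _ => ?_).trans (by simp))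
  have := Finset.card_union_le (H.filter (fun h => rep h j < lo j))
    (H.filter (fun h => hi j < rep h j))
  have := hq.lt_lo j
  have := hq.hi_lt j
  omega

/-- At most two objects contain a given point. -/
theorem Input.IsGood.card_point_le {d : ℕ} {I : Input d} {f : ℕ} (hI : I.IsGood f) (p : Pt d)
    {H : Finset ℕ} (hH : ∀ h ∈ H, h < I.m₁ + I.m₂) (hp : ∀ h ∈ H, p ∈ I.obj h) : H.card ≤ 2 := by
  classical
  have h1 : (H.filter (fun h => h < I.m₁)).card ≤ 1 := by
    rw [Finset.card_le_one]
    intro h hh h' hh'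
    rw [Finset.mem_filter] at hh hh'
    by_contra hne
    exact Set.disjoint_left.1 (hI.first.disjoint h (by simpa using hh.2) h' (by simpa using hh'.2)
      hne) (hp h hh.1) (hp h' hh'.1)
  have h2 : (H.filter (fun h => ¬ h < I.m₁)).card ≤ 1 := by
    rw [Finset.card_le_one]
    intro h hh h' hh'
    rw [Finset.mem_filter] at hh hh'
    by_contra hne
    refine Set.disjoint_left.1 (hI.second.disjoint h ?_ h' ?_
      hne) (hp h hh.1) (hp h' hh'.1)
    · simpa using ⟨by simpa using hh.2, hH h hh.1⟩
    · simpa using ⟨by simpa using hh'.2, hH h' hh'.1⟩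
  have := Finset.card_filter_add_card_filter_not (s := H) (fun h => h < I.m₁)
  omega

/-- The constant in the bound for the separators. -/
def sepConst (d f : ℕ) : ℕ := 6 + (4 * d + 2) * 13 ^ (d - 1) * f

/-- Few objects meet the separator. -/
theorem card_met_le {d : ℕ} (hd : 1 ≤ d) {I : Input d} {f : ℕ} (hI : I.IsGood f)
    {l : List ℕ} (hl : l.Nodup) (hln : ∀ h ∈ l, h < I.m₁ + I.m₂) {m N q : ℕ} {lo hi : Fin d → ℝ}
    {w R : ℝ} {c c' : Pt d} (hcut : IsCut I.rep l m N lo hi w R c c') (hm : 1 ≤ m) (hmN : m ≤ N)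
    (hN : N ^ (d - 1) ≤ m ^ d) (hq : IsQuantile I.rep l.toFinset q lo hi)
    (hlen : 4 * d * q ≤ l.length) {H : Finset ℕ} (hHl : H ⊆ l.toFinset)
    (hH : ∀ h ∈ H, cutClass I w (cube c R) (cube c' R) h ∉ [1, 2, 3]) :
    H.card ≤ sepConst d f * m := by
  classical
  rcases le_or_gt w 0 with hw | hw
  -- Degenerate case: the box has shrunk to the point `lo`. At least half of the representatives are
  -- equal to it, but at most two objects contain a given point, so the segment has at most four
  -- objects and all of them may count as met.
  · have h1 := hq.card_outside_le (Finset.filter_subset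
      (fun h => ∃ j, I.rep h j < lo j ∨ hi j < I.rep h j) _) (fun h hh => (Finset.mem_filter.1 hh).2)
    have h2 := hI.card_point_le lo (H := l.toFinset.filter
      (fun h => ¬ ∃ j, I.rep h j < lo j ∨ hi j < I.rep h j))
      (fun h hh => hln h (List.mem_toFinset.1 (Finset.mem_filter.1 hh).1)) (fun h hh => by
        rw [Finset.mem_filter] at hh
        have : lo = I.rep h := by
          funext j
          have h3 := hcut.le j
          have h4 := hh.2
          push Not at h4
          have := h4 j
          linarith [this.1, this.2]
        rw [this]
        exact hI.rep_mem h (hln h (List.mem_toFinset.1 hh.1)))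
    have h3 := Finset.card_filter_add_card_filter_not (s := l.toFinset)
      (fun h => ∃ j, I.rep h j < lo j ∨ hi j < I.rep h j)
    rw [List.toFinset_card_of_nodup hl] at h3
    have h4 : H.card ≤ l.length := by
      rw [← List.toFinset_card_of_nodup hl]; exact Finset.card_le_card hHl
    have h5 : 2 * (d * (2 * q)) ≤ l.length := by
      calc _ = 4 * d * q := by ring
        _ ≤ _ := hlen
    have h6 : 4 * 1 ≤ sepConst d f * m := Nat.mul_le_mul (by unfold sepConst; omega) hm
    omega
  · have h1 := hcut.card_sphere_le hd hI hl hln hm hmN hN hw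
      (H := H.filter (fun h => ¬ I.obj h ⊆ cube c R)) ((Finset.filter_subset _ _).trans hHl)
      (fun h hh => by
        rw [Finset.mem_filter] at hh
        refine ⟨hh.2, fun h' => hH h hh.1 ?_⟩
        rw [cutClass, if_neg (not_le.2 hw), if_neg hh.2, if_pos h']; decide)
    have h2 := hcut.card_split_le hd hI hl hln hm hmN hN hw
      (H := H.filter (fun h => ¬ ¬ I.obj h ⊆ cube c R)) ((Finset.filter_subset _ _).trans hHl)
      (fun h hh => by
        rw [Finset.mem_filter, not_not] at hh
        refine ⟨hh.2, fun h' => hH h hh.1 ?_, fun h' => hH h hh.1 ?_⟩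
        · rw [cutClass, if_neg (not_le.2 hw), if_pos hh.2, if_pos h']; decide
        · rw [cutClass, if_neg (not_le.2 hw), if_pos hh.2, if_pos h']; split_ifs <;> decide)
    have h3 := Finset.card_filter_add_card_filter_not (s := H) (fun h => ¬ I.obj h ⊆ cube c R)
    -- The `6` in `sepConst` is `4 + 1 + 1`: four for the degenerate case, and one `m` each for the
    -- small objects at the sphere and at the hyperplane.
    have h4 : sepConst d f * m = 4 * m + (m + 2 * (2 * d * (13 ^ (d - 1) * m * f))) +
        (m + 2 * (13 ^ (d - 1) * m * f)) := by unfold sepConst; ring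
    omega

/-- Every part has at most a constant fraction of the objects. -/
theorem card_part_le {d : ℕ} {I : Input d} {f : ℕ} (hI : I.IsGood f)
    {l : List ℕ} (hl : l.Nodup) (hln : ∀ h ∈ l, h < I.m₁ + I.m₂) {m N q : ℕ} {lo hi : Fin d → ℝ}
    {w R : ℝ} {c c' : Pt d} (hcut : IsCut I.rep l m N lo hi w R c c') (hm : 1 ≤ m)
    (hq : IsQuantile I.rep l.toFinset q lo hi) (hlen : 4 * d * q ≤ l.length)
    {D : ℕ} (hD : 2 ≤ D) (hDq : l.length ≤ D * (q + 1)) {k : ℕ} (hk : k ∈ [1, 2, 3])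
    {H : Finset ℕ} (hHl : H ⊆ l.toFinset)
    (hH : ∀ h ∈ H, cutClass I w (cube c R) (cube c' R) h = k) :
    D * H.card ≤ (D - 1) * l.length := by
  classical
  rw [← List.toFinset_card_of_nodup hl] at *
  have hHn : ∀ h ∈ H, h < I.m₁ + I.m₂ := fun h hh => hln h (List.mem_toFinset.1 (hHl hh))
  have hmet : ∀ h, (if h + 1 ≤ I.m₁ then 0 else 7) ≠ k := fun h => by
    simp at hk; split_ifs <;> omega
  rcases le_or_gt w 0 with hw | hw
  · have : H = ∅ := Finset.eq_empty_of_forall_notMem fun h hh => by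
      have := hH h hh
      rw [cutClass, if_pos hw] at this
      exact hmet h this
    simp [this]
  obtain ⟨x', y', hx', hxy', hy', -, -, rfl⟩ := hcut.sphere
  obtain ⟨j, x, y, hj, hx, hxy, hy, -, hwm, rfl⟩ := hcut.split hw
  obtain ⟨-, hxy''⟩ := slots_mul_ge hm hw hwm
  have hR : 0 < x' + y' := by linarith
  -- A part that avoids `q + 1` handles of the segment is short enough, since `q + 1` is at least
  -- the fraction `1 / D` of the length.
  have hfin : ∀ {M : Finset ℕ}, M ⊆ l.toFinset → Disjoint H M → q + 1 ≤ M.card →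
      D * H.card ≤ (D - 1) * l.toFinset.card := by
    intro M hM hdis hcard
    have h1 := Finset.card_le_card (Finset.union_subset hHl hM)
    rw [Finset.card_union_of_disjoint hdis] at h1
    have h2 := Nat.mul_le_mul_left D h1
    have h3 := Nat.mul_le_mul_left D hcard
    rw [mul_add] at h2
    rw [Nat.sub_mul, one_mul]; omega
  set c₂ := Function.update c j ((x + y) / 2 - (x' + y') / 2) with hc₂
  have hrep : ∀ h ∈ H, I.rep h ∈ I.obj h := fun h hh => hI.rep_mem h (hHn h hh)
  have hcj := hcut.center j
  have hcls : ∀ h ∈ H, (k = 1 → I.obj h ⊆ cube c₂ (x' + y')) ∧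
      (k = 2 → I.obj h ⊆ cube c (x' + y') ∧ Disjoint (I.obj h) (cube c₂ (x' + y'))) ∧
      (k = 3 → Disjoint (I.obj h) (cube c (x' + y'))) := by
    intro h hh
    have h1 := hH h hh
    rw [cutClass, if_neg (not_le.2 hw)] at h1
    by_cases a1 : I.obj h ⊆ cube c (x' + y')
    · rw [if_pos a1] at h1
      by_cases a2 : I.obj h ⊆ cube c₂ (x' + y')
      · rw [if_pos a2] at h1
        exact ⟨fun _ => a2, fun h => by omega, fun h => by omega⟩
      · rw [if_neg a2] at h1
        by_cases a3 : Disjoint (I.obj h) (cube c₂ (x' + y'))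
        · rw [if_pos a3] at h1
          exact ⟨fun h => by omega, fun _ => ⟨a1, a3⟩, fun h => by omega⟩
        · rw [if_neg a3] at h1
          exact absurd h1 (hmet h)
    · rw [if_neg a1] at h1
      by_cases a4 : Disjoint (I.obj h) (cube c (x' + y'))
      · rw [if_pos a4] at h1
        exact ⟨fun h => by omega, fun h => by omega, fun _ => a4⟩
      · rw [if_neg a4] at h1
        exact absurd h1 (hmet h)
  have hk' : k = 1 ∨ k = 2 ∨ k = 3 := by simpa using hk
  rcases hk' with rfl | rfl | rfl
  -- Below the cut: the cut lies strictly below `hi j`, because the window is nondegenerate, so the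
  -- handles beyond the upper quantile are avoided.
  · refine hfin (Finset.filter_subset (fun h => hi j ≤ I.rep h j) _) ?_ (hq.hi_le j)
    rw [Finset.disjoint_left]
    intro h hh hh'
    have h1 := ((hcls h hh).1 rfl (hrep h hh) j).2
    rw [hc₂, Function.update_self] at h1
    have h2 := (Finset.mem_filter.1 hh').2
    linarith
  -- Above the cut: within the cube, a representative with coordinate at most `lo j` would lie in
  -- the translated cube.
  · refine hfin (Finset.filter_subset (fun h => I.rep h j ≤ lo j) _) ?_ (hq.le_lo j)
    rw [Finset.disjoint_left]
    intro h hh hh'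
    have h2 := (Finset.mem_filter.1 hh').2
    obtain ⟨h3, h4⟩ := (hcls h hh).2.1 rfl
    refine Set.disjoint_left.1 h4 (hrep h hh) fun i => ?_
    have h5 := h3 (hrep h hh)
    by_cases hi : i = j
    · subst hi; rw [hc₂, Function.update_self]
      have := h5 i
      constructor <;> linarith [this.1]
    · rw [hc₂, Function.update_of_ne hi]; exact h5 i
  -- Outside: the half side of the cube is at least `w / 2`, so the cube contains the whole quantile
  -- box. At most `2 * d * q` representatives lie outside, at most half of the segment.
  · have h1 := hq.card_outside_le hHl (fun h hh => by
      by_contra hcon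
      push Not at hcon
      refine Set.disjoint_left.1 ((hcls h hh).2.2 rfl) (hrep h hh) fun i => ?_
      have h1 := hcon i
      have h2 := hcut.center i
      have h3 := hcut.le i
      constructor <;> linarith [h1.1, h1.2])
    have h2 : 2 * H.card ≤ l.toFinset.card := by
      calc 2 * H.card ≤ 2 * (d * (2 * q)) := by omega
        _ = 4 * d * q := by ring
        _ ≤ _ := hlen
    obtain ⟨D', rfl⟩ : ∃ D', D = D' + 2 := ⟨D - 2, by omega⟩
    have h3 := Nat.mul_le_mul_left D' h2
    have : D' + 2 - 1 = D' + 1 := rfl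
    rw [this]
    nlinarith

/-! ## Lists that describe a MIX -/

/-- The change of the number of objects when the handles of a list are processed: objects of the first
set are removed, objects of the second set are added. -/
def walk (m₁ : ℕ) (l : List ℕ) : ℤ := (l.map (fun h => if h < m₁ then (-1 : ℤ) else 1)).sum

@[simp] theorem walk_nil (m₁ : ℕ) : walk m₁ [] = 0 := rfl

theorem walk_append (m₁ : ℕ) (l l' : List ℕ) : walk m₁ (l ++ l') = walk m₁ l + walk m₁ l' := by
  simp [walk]

theorem walk_cons (m₁ h : ℕ) (l : List ℕ) :
    walk m₁ (h :: l) = (if h < m₁ then -1 else 1) + walk m₁ l := by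
  simp [walk]

theorem walk_perm {m₁ : ℕ} {l l' : List ℕ} (h : l.Perm l') : walk m₁ l = walk m₁ l' :=
  (h.map _).sum_eq

theorem walk_eq (m₁ : ℕ) (l : List ℕ) : walk m₁ l =
    ((l.filter (fun h => ¬ h < m₁)).length : ℤ) - (l.filter (fun h => h < m₁)).length := by
  induction l with
  | nil => simp
  | cons h l ih =>
    rw [walk_cons, ih]
    by_cases hh : h < m₁
    · simp [hh]; ring
    · simp [hh, not_lt.1 hh]; ring

theorem neg_length_le_walk (m₁ : ℕ) (l : List ℕ) : -(l.length : ℤ) ≤ walk m₁ l := by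
  rw [walk_eq]
  have := List.length_filter_le (fun h => decide (h < m₁)) l
  omega

theorem walk_of_lt {m₁ : ℕ} {l : List ℕ} (h : ∀ x ∈ l, x < m₁) : walk m₁ l = -l.length := by
  have h1 : l.filter (fun h => ¬ h < m₁) = [] := List.filter_eq_nil_iff.2 (by simpa using h)
  have h2 : l.filter (fun h => h < m₁) = l := List.filter_eq_self.2 (by simpa using h)
  rw [walk_eq, h1, h2]; simp

theorem walk_of_ge {m₁ : ℕ} {l : List ℕ} (h : ∀ x ∈ l, m₁ ≤ x) : walk m₁ l = l.length := by
  have h1 : l.filter (fun h => ¬ h < m₁) = l := List.filter_eq_self.2 (by simpa using h)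
  have h2 : l.filter (fun h => h < m₁) = [] := List.filter_eq_nil_iff.2 (by simpa using h)
  rw [walk_eq, h1, h2]; simp

/-- `t` is a lower bound for the walks of all prefixes. -/
def IsWalkBound (m₁ : ℕ) (l : List ℕ) (t : ℤ) : Prop := ∀ k, t ≤ walk m₁ (l.take k)

theorem IsWalkBound.append {m₁ : ℕ} {l l' : List ℕ} {t : ℤ} (h : IsWalkBound m₁ l t)
    (h' : IsWalkBound m₁ l' (t - walk m₁ l)) : IsWalkBound m₁ (l ++ l') t := by
  intro k
  rw [List.take_append, walk_append]
  rcases le_total k l.length with hk | hk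
  · rw [Nat.sub_eq_zero_of_le hk]; simpa using h k
  · rw [List.take_of_length_le hk]
    have := h' (k - l.length)
    omega

theorem IsWalkBound.mono {m₁ : ℕ} {l : List ℕ} {t t' : ℤ} (h : IsWalkBound m₁ l t) (ht : t' ≤ t) :
    IsWalkBound m₁ l t' := fun k => ht.trans (h k)

/-- Processing the handles of the list in this order keeps the set independent, with loss at most
`g`. -/
structure IsValid {d : ℕ} (I : Input d) (g : ℕ) (l : List ℕ) : Prop where
  indep : l.Pairwise (fun x y => I.m₁ ≤ x → y < I.m₁ → Disjoint (I.obj x) (I.obj y))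
  bound : IsWalkBound I.m₁ l (min 0 (walk I.m₁ l) - g)

theorem IsValid.mono {d : ℕ} {I : Input d} {g g' : ℕ} {l : List ℕ} (h : IsValid I g l)
    (hg : g ≤ g') : IsValid I g' l :=
  ⟨h.indep, h.bound.mono (by omega)⟩

theorem isValid_nil {d : ℕ} (I : Input d) (g : ℕ) : IsValid I g [] :=
  ⟨List.Pairwise.nil, fun k => by simp⟩

/-- The order in which the parts are processed: first the met objects of the first set, then parts that
do not lose objects, then parts that lose objects, then the met objects of the second set. -/
theorem isValid_flatMap {d : ℕ} {I : Input d} {g s : ℕ} {b : ℕ → List ℕ}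
    (h0 : ∀ h ∈ b 0, h < I.m₁) (h7 : ∀ h ∈ b 7, I.m₁ ≤ h)
    (hval : ∀ k, 1 ≤ k → k ≤ 6 → IsValid I g (b k))
    (hpos : ∀ k, 1 ≤ k → k ≤ 3 → 0 ≤ walk I.m₁ (b k))
    (hneg : ∀ k, 4 ≤ k → k ≤ 6 → walk I.m₁ (b k) ≤ 0)
    (hdis : ∀ i j, 1 ≤ i → i < j → j ≤ 6 → ∀ x ∈ b i, ∀ y ∈ b j, Disjoint (I.obj x) (I.obj y))
    (hs : (b 0).length + (b 7).length ≤ s) : IsValid I (g + s) ((List.range 8).flatMap b) := by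
  constructor
  · rw [List.pairwise_flatMap]
    constructor
    · intro k hk
      rw [List.mem_range] at hk
      by_cases hk0 : k = 0
      · subst hk0
        exact List.pairwise_of_forall_mem_list fun x hx y _ h _ => absurd (h0 x hx) (not_lt.2 h)
      by_cases hk7 : k = 7
      · subst hk7
        exact List.pairwise_of_forall_mem_list fun x _ y hy _ h => absurd (h7 y hy) (not_le.2 h)
      exact (hval k (by omega) (by omega)).indep
    · refine List.Pairwise.imp_of_mem (R := (· < ·)) ?_ List.pairwise_lt_range
      intro i j _ hj hij x hx y hy hx' hy'
      rw [List.mem_range] at hj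
      by_cases hi : i = 0
      · subst hi; exact absurd (h0 x hx) (not_lt.2 hx')
      by_cases hj : j = 7
      · subst hj; exact absurd (h7 y hy) (not_le.2 hy')
      exact hdis i j (by omega) hij (by omega) x hx y hy
  · have e : (List.range 8).flatMap b =
        b 0 ++ (b 1 ++ (b 2 ++ (b 3 ++ (b 4 ++ (b 5 ++ (b 6 ++ b 7)))))) := by
      simp [List.range_succ]
    have w0 := walk_of_lt h0
    have w7 := walk_of_ge h7
    have p1 := hpos 1 (by omega) (by omega)
    have p2 := hpos 2 (by omega) (by omega)
    have p3 := hpos 3 (by omega) (by omega)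
    have n4 := hneg 4 (by omega) (by omega)
    have n5 := hneg 5 (by omega) (by omega)
    have n6 := hneg 6 (by omega) (by omega)
    have hv := fun k h h' => (hval k h h').bound
    rw [e]
    simp only [walk_append]
    -- Up to the end of block `3` the walk is at least `-(b 0).length - g`, since blocks `1, 2, 3`
    -- do not lose. From block `4` on, the walks of the blocks up to `6` are nonpositive, so inside
    -- them the walk is at least the total minus `(b 7).length` minus `g`. In block `7` it only
    -- rises.
    refine .append (fun k => ?_) (.append ((hv 1 (by omega) (by omega)).mono ?_)
      (.append ((hv 2 (by omega) (by omega)).mono ?_)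
      (.append ((hv 3 (by omega) (by omega)).mono ?_)
      (.append ((hv 4 (by omega) (by omega)).mono ?_)
      (.append ((hv 5 (by omega) (by omega)).mono ?_)
      (.append ((hv 6 (by omega) (by omega)).mono ?_) (fun k => ?_)))))))
    · have := neg_length_le_walk I.m₁ ((b 0).take k)
      have := List.length_take_le' k (b 0)
      push_cast; omega
    · push_cast; omega
    · push_cast; omega
    · push_cast; omega
    · push_cast; omega
    · push_cast; omega
    · push_cast; omega
    · have := walk_of_ge (l := (b 7).take k) (fun x hx => h7 x (List.mem_of_mem_take hx))
      push_cast; omega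

/-! ### Positions of the blocks within a segment, and the depth of the recursion. -/

theorem seg_flatMap {α : Type*} (f : ℕ → α) (p : ℕ → ℕ) (hp : ∀ k, p k ≤ p (k + 1)) (n : ℕ) :
    seg f (p 0) (p n) = (List.range n).flatMap (fun k => seg f (p k) (p (k + 1))) := by
  induction n with
  | zero => simp [seg_self]
  | succ n ih =>
    rw [List.range_succ, List.flatMap_append, ← ih, List.flatMap_singleton,
      seg_append _ (monotone_nat_of_le_succ hp (Nat.zero_le n)) (hp n)]

theorem seg_eq_of_append {α : Type*} {f : ℕ → α} {a b : ℕ} {x y z : List α}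
    (h : seg f a b = x ++ y ++ z) :
    seg f (a + x.length) (a + x.length + y.length) = y := by
  have hl := congrArg List.length h
  simp at hl
  by_cases hab : a ≤ b
  · rw [← seg_append f (b := a + x.length + y.length) (by omega) (by omega),
      ← seg_append f (a := a) (b := a + x.length) (by omega) (by omega)] at h
    exact (List.append_inj' (List.append_inj h (by simp)).1 (by simp)).2
  · have hx : x = [] := List.length_eq_zero_iff.1 (by omega)
    have hy : y = [] := List.length_eq_zero_iff.1 (by omega)
    subst hx hy; simp [seg_self]

theorem bucket_prefix (lab : ℕ → ℕ) (l : List ℕ) {k n : ℕ} (h : k ≤ n) :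
    ∃ z, bucket lab l n = bucket lab l k ++ z := by
  induction n, h using Nat.le_induction with
  | base => exact ⟨[], by simp⟩
  | succ n _ ih =>
    obtain ⟨z, hz⟩ := ih
    exact ⟨z ++ l.filter (fun h => lab h = n), by rw [bucket_succ, hz, List.append_assoc]⟩

theorem seg_bucket {f : ℕ → ℕ} {a b : ℕ} {lab : ℕ → ℕ} {l : List ℕ} {k n : ℕ}
    (h : seg f a b = bucket lab l n) (hk : k < n) :
    seg f (a + (bucket lab l k).length) (a + (bucket lab l (k + 1)).length) =
      l.filter (fun h => lab h = k) := by
  obtain ⟨z, hz⟩ := bucket_prefix lab l (Nat.succ_le_of_lt hk)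
  rw [hz, bucket_succ] at h
  rw [bucket_succ, List.length_append, ← add_assoc]
  exact seg_eq_of_append h

theorem bucket_length_perm {lab : ℕ → ℕ} {l l' : List ℕ} (h : l.Perm l') (k : ℕ) :
    (bucket lab l k).length = (bucket lab l' k).length :=
  (List.Perm.flatMap_left _ (fun _ _ => h.filter _)).length_eq

/-- The depth of the recursion when the size shrinks by the factor `1 - 1 / D` in every step. -/
noncomputable def depth (D s : ℕ) : ℕ := ⌊Real.log s / Real.log ((D : ℝ) / (D - 1 : ℕ))⌋₊

theorem log_ratio_pos {D : ℕ} (hD : 2 ≤ D) : 0 < Real.log ((D : ℝ) / (D - 1 : ℕ)) := by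
  apply Real.log_pos
  have h1 : (0 : ℝ) < (D - 1 : ℕ) := by exact_mod_cast (by omega : 0 < D - 1)
  rw [lt_div_iff₀ h1, one_mul]
  exact_mod_cast (by omega : D - 1 < D)

/-- Shrinking by the factor `(D - 1) / D` lowers the logarithm by at least `log (D / (D - 1))`, the
unit of the depth. The condition `1 ≤ s'` makes the smaller quotient nonnegative, so that the
natural floor commutes with adding one. -/
theorem depth_succ_le {D s s' : ℕ} (hD : 2 ≤ D) (hs' : 1 ≤ s') (h : D * s' ≤ (D - 1) * s) :
    depth D s' + 1 ≤ depth D s := by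
  have hlog := log_ratio_pos hD
  have h1 : (0 : ℝ) < (D - 1 : ℕ) := by exact_mod_cast (by omega : 0 < D - 1)
  have h2 : (0 : ℝ) < D := by exact_mod_cast (by omega : 0 < D)
  have h3 : (0 : ℝ) < s' := by exact_mod_cast hs'
  have h4 : (D : ℝ) * s' ≤ (D - 1 : ℕ) * s := by exact_mod_cast h
  have h5 : Real.log s' + Real.log ((D : ℝ) / (D - 1 : ℕ)) ≤ Real.log s := by
    rw [← Real.log_mul h3.ne' (by positivity)]
    apply Real.log_le_log (by positivity)
    rw [mul_div_assoc', div_le_iff₀ h1]; linarith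
  have h6 : 0 ≤ Real.log s' / Real.log ((D : ℝ) / (D - 1 : ℕ)) :=
    div_nonneg (Real.log_nonneg (by exact_mod_cast hs')) hlog.le
  rw [depth, depth, ← Nat.floor_add_one h6]
  apply Nat.floor_le_floor
  rw [le_div_iff₀ hlog, add_mul, div_mul_cancel₀ _ hlog.ne', one_mul]
  exact h5

theorem depth_le {D s : ℕ} (hD : 2 ≤ D) (hs : 1 ≤ s) :
    (depth D s : ℝ) ≤ Real.log s / Real.log ((D : ℝ) / (D - 1 : ℕ)) :=
  Nat.floor_le (div_nonneg (Real.log_nonneg (by exact_mod_cast hs)) (log_ratio_pos hD).le)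

/-! ## The effect of processing a segment -/

theorem label_eq_iff {cls A B : ℕ → ℕ} {h k : ℕ} (hc : cls h ∈ [0, 1, 2, 3, 7]) :
    label cls A B h = k ↔ (k = 0 ∨ k = 7) ∧ cls h = k ∨
      (1 ≤ k ∧ k ≤ 3) ∧ cls h = k ∧ A k ≤ B k ∨
      (4 ≤ k ∧ k ≤ 6) ∧ cls h = k - 3 ∧ ¬ A (k - 3) ≤ B (k - 3) := by
  have e1 : cls h ∈ [1, 2, 3] ↔ cls h = 1 ∨ cls h = 2 ∨ cls h = 3 := by simp
  simp only [List.mem_cons, List.not_mem_nil, or_false] at hc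
  unfold label
  simp only [e1]
  constructor
  · split_ifs with h1
    · rintro rfl
      refine .inr (.inr ⟨by omega, by omega, ?_⟩)
      rw [Nat.add_sub_cancel]; exact h1.2
    · rintro rfl
      by_cases h2 : cls h = 0 ∨ cls h = 7
      · exact .inl ⟨h2, rfl⟩
      · refine .inr (.inl ⟨by omega, rfl, ?_⟩)
        by_contra h3; exact h1 ⟨by omega, h3⟩
  · rintro (⟨h1, h2⟩ | ⟨h1, h2, h3⟩ | ⟨h1, h2, h3⟩)
    · rw [if_neg (by omega), h2]
    · rw [if_neg (by rw [h2]; exact fun h => h.2 h3), h2]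
    · rw [if_pos ⟨by omega, by rw [h2]; exact h3⟩]; omega

theorem cutClass_eq_zero {d : ℕ} {I : Input d} {w : ℝ} {Q Q' : Set (Pt d)} {h : ℕ}
    (hc : cutClass I w Q Q' h = 0) : h < I.m₁ := by
  unfold cutClass at hc; split_ifs at hc <;> omega

theorem cutClass_eq_seven {d : ℕ} {I : Input d} {w : ℝ} {Q Q' : Set (Pt d)} {h : ℕ}
    (hc : cutClass I w Q Q' h = 7) : I.m₁ ≤ h := by
  unfold cutClass at hc; split_ifs at hc <;> omega

theorem cutClass_spec {d : ℕ} {I : Input d} {w : ℝ} {Q Q' : Set (Pt d)} {h : ℕ} :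
    (cutClass I w Q Q' h = 1 → I.obj h ⊆ Q ∧ I.obj h ⊆ Q') ∧
    (cutClass I w Q Q' h = 2 → I.obj h ⊆ Q ∧ Disjoint (I.obj h) Q') ∧
    (cutClass I w Q Q' h = 3 → Disjoint (I.obj h) Q) := by
  unfold cutClass
  refine ⟨?_, ?_, ?_⟩ <;> split_ifs <;> intro _ <;> first | omega | tauto

/-- Class `1` lies in both cubes, class `2` in `Q` but off `Q'`, and class `3` off `Q`; so one of
the two cubes separates any two classes. -/
theorem disjoint_of_cutClass {d : ℕ} {I : Input d} {w : ℝ} {Q Q' : Set (Pt d)} {h h' k k' : ℕ}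
    (hk : k ∈ [1, 2, 3]) (hk' : k' ∈ [1, 2, 3]) (hne : k ≠ k')
    (hc : cutClass I w Q Q' h = k) (hc' : cutClass I w Q Q' h' = k') :
    Disjoint (I.obj h) (I.obj h') := by
  have H : ∀ {h h' k k' : ℕ}, k ∈ [1, 2, 3] → k' ∈ [1, 2, 3] → k < k' →
      cutClass I w Q Q' h = k → cutClass I w Q Q' h' = k' → Disjoint (I.obj h) (I.obj h') := by
    intro h h' k k' hk hk' hlt hc hc'
    simp only [List.mem_cons, List.not_mem_nil, or_false] at hk hk'
    obtain ⟨a1, a2, -⟩ := cutClass_spec (I := I) (w := w) (Q := Q) (Q' := Q') (h := h)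
    obtain ⟨-, b2, b3⟩ := cutClass_spec (I := I) (w := w) (Q := Q) (Q' := Q') (h := h')
    by_cases h3 : k' = 3
    · have hQ : I.obj h ⊆ Q := by
        rcases (by omega : k = 1 ∨ k = 2) with h1 | h1
        · exact (a1 (by omega)).1
        · exact (a2 (by omega)).1
      exact ((b3 (by omega)).mono_right hQ).symm
    · exact ((b2 (by omega)).2.mono_right (a1 (by omega)).2).symm
  rcases lt_or_gt_of_ne hne with h1 | h1
  · exact H hk hk' h1 hc hc'
  · exact (H hk' hk h1 hc' hc).symm

/-- The arrays `g j` hold the same handles at `a, …, b - 1`, sorted by the `j`-th coordinate. -/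
structure IsSegment {d : ℕ} (I : Input d) (g : ℕ → ℕ → ℕ) (a b : ℕ) : Prop where
  lt : a < b
  nodup : (seg (g 0) a b).Nodup
  mem : ∀ h ∈ seg (g 0) a b, h < I.m₁ + I.m₂
  perm : ∀ j < d, (seg (g j) a b).Perm (seg (g 0) a b)
  sorted : ∀ j : Fin d, (seg (g j) a b).Pairwise (fun x y => I.rep x j ≤ I.rep y j)

theorem IsSegment.length_le {d : ℕ} {I : Input d} {g : ℕ → ℕ → ℕ} {a b : ℕ}
    (h : IsSegment I g a b) : b - a ≤ I.m₁ + I.m₂ := by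
  have h1 : (seg (g 0) a b).toFinset ⊆ Finset.range (I.m₁ + I.m₂) := fun x hx => by
    rw [Finset.mem_range]; exact h.mem x (List.mem_toFinset.1 hx)
  have := Finset.card_le_card h1
  rwa [List.toFinset_card_of_nodup h.nodup, length_seg, Finset.card_range] at this

/-- For the segments that wait on the stack while another part of the arrays is rearranged. -/
theorem IsSegment.congr {d : ℕ} (hd : 1 ≤ d) {I : Input d} {g g' : ℕ → ℕ → ℕ} {a b : ℕ}
    (h : IsSegment I g a b) (hg : ∀ j < d, ∀ k, a ≤ k → k < b → g' j k = g j k) :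
    IsSegment I g' a b := by
  have e : ∀ j < d, seg (g' j) a b = seg (g j) a b := fun j hj => seg_congr (hg j hj)
  refine ⟨h.lt, ?_, ?_, fun j hj => ?_, fun j => ?_⟩
  · rw [e 0 hd]; exact h.nodup
  · rw [e 0 hd]; exact h.mem
  · rw [e 0 hd, e j hj]; exact h.perm j hj
  · rw [e j j.2]; exact h.sorted j

/-- In a sorted array the position of an entry bounds its rank. Ties allow inequalities only: strict
comparisons give upper bounds, weak ones lower bounds. -/
theorem length_filter_le_of_sorted {κ : ℕ → ℝ} {g : ℕ → ℕ} {a b p : ℕ}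
    (h : (seg g a b).Pairwise (fun x y => κ x ≤ κ y)) (hap : a ≤ p) (hpb : p < b) :
    ((seg g a b).filter (fun x => κ x < κ (g p))).length ≤ p - a ∧
    p + 1 - a ≤ ((seg g a b).filter (fun x => κ x ≤ κ (g p))).length ∧
    ((seg g a b).filter (fun x => κ (g p) < κ x)).length ≤ b - (p + 1) ∧
    b - p ≤ ((seg g a b).filter (fun x => κ (g p) ≤ κ x)).length := by
  have e1 : seg g a b = seg g a p ++ (g p :: seg g (p + 1) b) := by
    rw [← seg_cons g hpb, seg_append g hap hpb.le]
  rw [e1, List.pairwise_append, List.pairwise_cons] at h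
  obtain ⟨-, ⟨h1, -⟩, h2⟩ := h
  have h3 : ∀ x ∈ seg g a p, κ x ≤ κ (g p) := fun x hx => h2 x hx _ (by simp)
  rw [e1]
  simp only [List.filter_append, List.length_append, List.filter_cons, lt_self_iff_false, le_refl,
    decide_false, decide_true, if_true]
  have f1 : (seg g (p + 1) b).filter (fun x => κ x < κ (g p)) = [] :=
    List.filter_eq_nil_iff.2 (by simpa using h1)
  have f2 : (seg g a p).filter (fun x => κ x ≤ κ (g p)) = seg g a p :=
    List.filter_eq_self.2 (by simpa using h3)
  have f3 : (seg g a p).filter (fun x => κ (g p) < κ x) = [] :=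
    List.filter_eq_nil_iff.2 (by simpa using h3)
  have f4 : (seg g (p + 1) b).filter (fun x => κ (g p) ≤ κ x) = seg g (p + 1) b :=
    List.filter_eq_self.2 (by simpa using h1)
  have l1 := List.length_filter_le (fun x => decide (κ x < κ (g p))) (seg g a p)
  have l2 := List.length_filter_le (fun x => decide (κ (g p) < κ x)) (seg g (p + 1) b)
  rw [f1, f2, f3, f4]
  simp at l1 l2 ⊢
  omega

theorem IsSegment.isQuantile {d : ℕ} {I : Input d} {g : ℕ → ℕ → ℕ} {a b q : ℕ}
    (h : IsSegment I g a b) (hq : q < b - a) {lo hi : Fin d → ℝ}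
    (hlo : ∀ j : Fin d, lo j = I.rep (g j (a + q)) j)
    (hhi : ∀ j : Fin d, hi j = I.rep (g j (b - (1 + q))) j) :
    IsQuantile I.rep (seg (g 0) a b).toFinset q lo hi := by
  have key : ∀ (j : Fin d) (p : ℕ → Prop) [DecidablePred p],
      ((seg (g 0) a b).toFinset.filter p).card = ((seg (g j) a b).filter (fun h => p h)).length :=
    fun j p _ => by
      rw [card_filter_toFinset h.nodup]; exact (((h.perm j j.2).filter _).length_eq).symm
  have A := fun j : Fin d => length_filter_le_of_sorted (κ := fun x => I.rep x j) (h.sorted j)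
    (p := a + q) (by omega) (by omega)
  have B := fun j : Fin d => length_filter_le_of_sorted (κ := fun x => I.rep x j) (h.sorted j)
    (p := b - (1 + q)) (by omega) (by omega)
  refine ⟨fun j => ?_, fun j => ?_, fun j => ?_, fun j => ?_⟩
  · rw [key j, hlo]; have := (A j).1; omega
  · rw [key j, hlo]; have := (A j).2.1; omega
  · rw [key j, hhi]; have := (B j).2.2.1; omega
  · rw [key j, hhi]; have := (B j).2.2.2; omega

/-- Two intervals of positions are disjoint. -/
def Apart (p p' : ℕ × ℕ) : Prop := p.2 ≤ p'.1 ∨ p'.2 ≤ p.1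

/-- The last clause is the combination step of the recursion, stated before the recursion has taken
place: `F` stands for any later content of the array that rearranges the pushed blocks validly and
keeps the other positions of the segment. This lets an iterative loop with a stack inherit the
correctness of the recursion. -/
theorem node_effect {d : ℕ} (hd : 1 ≤ d) (f : ℕ) : ∃ C, ∀ (I : Input d) (σ : Store) (a b : ℕ)
    (s : List (ℕ × ℕ)), I.IsGood f → stack σ = s ++ [(a, b)] → σ.nat 0 0 = I.m₁ →
    1 ≤ σ.nat 2 0 → σ.nat 2 0 ≤ I.m₁ + I.m₂ → (I.m₁ + I.m₂) ^ (d - 1) ≤ σ.nat 2 0 ^ d →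
    IsSegment I (fun j => σ.nat (100 + j)) a b →
    ∃ t σ' ch, Exec I (node d (4 * d)) σ t σ' ∧ t ≤ C * (b - a) ∧
      σ'.nat 0 = σ.nat 0 ∧ σ'.nat 2 = σ.nat 2 ∧
      (∀ j < d, ∀ k, k < a ∨ b ≤ k → σ'.nat (100 + j) k = σ.nat (100 + j) k) ∧
      stack σ' = s ++ ch ∧
      (∀ p ∈ ch, a ≤ p.1 ∧ p.2 ≤ b ∧ IsSegment I (fun j => σ'.nat (100 + j)) p.1 p.2 ∧
        2 ^ (4 * d) * (p.2 - p.1) ≤ (2 ^ (4 * d) - 1) * (b - a)) ∧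
      ch.Pairwise Apart ∧ (ch.map (fun p => p.2 - p.1)).sum ≤ b - a ∧
      ∀ (F : ℕ → ℕ) (G : ℕ),
        (∀ k, a ≤ k → k < b → (∀ p ∈ ch, ¬ (p.1 ≤ k ∧ k < p.2)) → F k = σ'.nat 100 k) →
        (∀ p ∈ ch, (seg F p.1 p.2).Perm (seg (σ'.nat 100) p.1 p.2) ∧
          IsValid I G (seg F p.1 p.2)) →
        (seg F a b).Perm (seg (σ.nat 100) a b) ∧
          IsValid I (G + sepConst d f * σ.nat 2 0) (seg F a b) := by
  obtain ⟨C, hC⟩ := node_spec hd (4 * d)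
  refine ⟨C, fun I σ a b s hI hs h0 hm1 hmn hpow hseg => ?_⟩
  -- A power of two, since the machine divides natural numbers by halving only. It exceeds `4 * d`,
  -- so the `2 * d` sides of the box cut off at most half of the segment.
  set D := 2 ^ (4 * d) with hD
  have hD4 : 4 * d < D := Nat.lt_two_pow_self
  set q := (b - a) / D with hq
  have hab := hseg.lt
  have hqle : D * q ≤ b - a := Nat.mul_div_le _ _
  have hqlt : b - a < D * (q + 1) := Nat.lt_mul_div_succ _ (by omega)
  have h4q : 4 * q ≤ b - a := (Nat.mul_le_mul_right q (by omega : 4 ≤ D)).trans hqle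
  have h4dq : 4 * d * q ≤ b - a := (Nat.mul_le_mul_right q hD4.le).trans hqle
  set l := seg (σ.nat 100) a b with hl
  have hll : l.length = b - a := by simp [hl]
  have hnd : l.Nodup := hseg.nodup
  have hln : ∀ h ∈ l, h < I.m₁ + I.m₂ := hseg.mem
  let lo : Fin d → ℝ := fun j => I.rep (σ.nat (100 + j) (a + q)) j
  let hi : Fin d → ℝ := fun j => I.rep (σ.nat (100 + j) (b - (1 + q))) j
  have hlohi : ∀ j, lo j ≤ hi j := fun j => by
    have h1 := hseg.sorted j
    rw [List.pairwise_iff_getElem] at h1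
    -- As `4 * q ≤ b - a`, the two quantile positions are in order; they coincide only for a segment
    -- with one entry.
    rcases Nat.lt_or_ge (q) (b - (1 + q) - a) with h2 | h2
    · have := h1 q (b - (1 + q) - a) (by simp; omega) (by simp; omega) h2
      rw [getElem_seg, getElem_seg] at this
      have h3 : a + (b - (1 + q) - a) = b - (1 + q) := by omega
      rw [h3] at this
      exact this
    · have h3 : b - (1 + q) = a + q := by omega
      simp only [lo, hi, h3]; exact le_rfl
  obtain ⟨t, σ', w, R, c, c', A, B, e, ht, hcut, hAB, hb, hout, hn0, hn2, hst⟩ := hC I σ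
    (I.m₁ + I.m₂) a b s l lo hi hs hab hseg.length_le hmn h0 hl hseg.perm (fun _ => rfl)
    (fun _ => rfl) hlohi
  have hquant : IsQuantile I.rep l.toFinset q lo hi :=
    hseg.isQuantile (by omega) (fun _ => rfl) (fun _ => rfl)
  set cls := cutClass I w (cube c R) (cube c' R) with hcls
  have hmem : ∀ h, cls h ∈ [0, 1, 2, 3, 7] := fun h => cutClass_mem _ _ _ _ _
  set lab := label cls A B with hlab
  have hlab8 : ∀ h ∈ l, lab h < 8 := fun h _ => label_lt (hmem h)
  set pos : ℕ → ℕ := fun k => a + (bucket lab l k).length with hpos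
  have hp0 : pos 0 = a := by simp [hpos, bucket_zero]
  have hp8 : pos 8 = b := by
    simp only [hpos]; rw [(bucket_perm hlab8).length_eq, hll]; omega
  have hpm : ∀ k, pos k ≤ pos (k + 1) := fun k => by
    simp only [hpos, bucket_succ, List.length_append]; omega
  have hpmono : Monotone pos := monotone_nat_of_le_succ hpm
  have hblock : ∀ j < d, ∀ k < 8, seg (σ'.nat (100 + j)) (pos k) (pos (k + 1)) =
      (seg (σ.nat (100 + j)) a b).filter (fun h => lab h = k) := fun j hj k hk => by
    have := seg_bucket (hb j hj) hk
    rwa [bucket_length_perm (hseg.perm j hj) k, bucket_length_perm (hseg.perm j hj) (k + 1)] at this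
  have hblock0 : ∀ k < 8, seg (σ'.nat 100) (pos k) (pos (k + 1)) =
      l.filter (fun h => lab h = k) := fun k hk => hblock 0 hd k hk
  set ch := ([1, 2, 3, 4, 5, 6].map (fun k => (pos k, pos (k + 1)))).filter
    (fun p => p.1 < p.2) with hch
  have hmemch : ∀ p, p ∈ ch ↔ ∃ k, 1 ≤ k ∧ k ≤ 6 ∧ pos k < pos (k + 1) ∧
      p = (pos k, pos (k + 1)) := fun p => by
    simp only [hch, List.mem_filter, List.mem_map, decide_eq_true_eq]
    constructor
    · rintro ⟨⟨k, hk, rfl⟩, h⟩; exact ⟨k, by simp at hk; omega, by simp at hk; omega, h, rfl⟩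
    · rintro ⟨k, h1, h2, h3, rfl⟩; exact ⟨⟨k, by simp; omega, rfl⟩, h3⟩
  have hsize : ∀ k, 1 ≤ k → k ≤ 6 →
      D * (l.filter (fun h => lab h = k)).length ≤ (D - 1) * (b - a) := by
    intro k hk1 hk6
    obtain ⟨k', hk', hsub⟩ : ∃ k' ∈ [1, 2, 3], ∀ h, lab h = k → cls h = k' := by
      rcases Nat.lt_or_ge k 4 with h | h
      · refine ⟨k, by simp; omega, fun x hx => ?_⟩
        rw [hlab, label_eq_iff (hmem x)] at hx; omega
      · refine ⟨k - 3, by simp; omega, fun x hx => ?_⟩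
        rw [hlab, label_eq_iff (hmem x)] at hx; omega
    have := card_part_le hI hnd hln hcut hm1 hquant (by omega) (D := D) (by omega) (by omega) hk'
      (H := (l.filter (fun h => lab h = k)).toFinset)
      (fun x hx => by simp at hx ⊢; exact hx.1) (fun x hx => by
        simp at hx; exact hsub x hx.2)
    rwa [List.toFinset_card_of_nodup (hnd.filter _), hll] at this
  have hlen : ∀ k < 8, (l.filter (fun h => lab h = k)).length = pos (k + 1) - pos k :=
    fun k hk => by rw [← hblock0 k hk, length_seg]
  refine ⟨t, σ', ch, e, ht, hn0, hn2, hout, hst, ?_, ?_, ?_, ?_⟩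
  · intro p hp
    obtain ⟨k, hk1, hk6, hlt, rfl⟩ := (hmemch p).1 hp
    refine ⟨hp0 ▸ hpmono (Nat.zero_le k), hp8 ▸ hpmono (by omega), ⟨hlt, ?_, ?_, ?_, ?_⟩, ?_⟩
    · exact (hblock 0 hd k (by omega)) ▸ hnd.filter _
    · intro h hh
      have : h ∈ l.filter (fun h => lab h = k) := (hblock0 k (by omega)) ▸ hh
      exact hln h (List.mem_of_mem_filter this)
    · intro j hj
      have h1 := hblock j hj k (by omega)
      have h2 := hblock 0 hd k (by omega)
      show (seg (σ'.nat (100 + j)) _ _).Perm (seg (σ'.nat (100 + 0)) _ _)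
      rw [h1, h2]
      exact (hseg.perm j hj).filter _
    · intro j
      show (seg (σ'.nat (100 + j)) _ _).Pairwise _
      rw [hblock j j.2 k (by omega)]
      exact (hseg.sorted j).filter _
    · rw [← hlen k (by omega)]; exact hsize k hk1 hk6
  · refine List.Pairwise.filter _ (List.pairwise_map.2 ?_)
    refine List.Pairwise.imp (R := (· < ·)) ?_ (by decide)
    intro i j hij
    exact .inl (hpmono (Nat.succ_le_of_lt hij))
  · have h1 : (ch.map (fun p => p.2 - p.1)).Sublist
        (([1, 2, 3, 4, 5, 6].map (fun k => (pos k, pos (k + 1)))).map (fun p => p.2 - p.1)) :=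
      List.Sublist.map _ List.filter_sublist
    refine h1.sum_le_sum (fun _ _ => Nat.zero_le _) |>.trans ?_
    have m1 : pos 1 ≤ pos 2 := hpm 1
    have m2 : pos 2 ≤ pos 3 := hpm 2
    have m3 : pos 3 ≤ pos 4 := hpm 3
    have m4 : pos 4 ≤ pos 5 := hpm 4
    have m5 : pos 5 ≤ pos 6 := hpm 5
    have m6 : pos 6 ≤ pos 7 := hpm 6
    have m7 := hpmono (show 7 ≤ 8 by omega)
    have m0 := hpmono (show 0 ≤ 1 by omega)
    rw [hp8] at m7
    rw [hp0] at m0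
    simp only [List.map_cons, List.map_nil, List.sum_cons, List.sum_nil, Nat.reduceAdd]
    omega
  · intro F G hF hFv
    have hFseg : seg F a b = (List.range 8).flatMap (fun k => seg F (pos k) (pos (k + 1))) := by
      rw [← seg_flatMap F pos hpm 8, hp0, hp8]
    have hperm : ∀ k < 8, (seg F (pos k) (pos (k + 1))).Perm (l.filter (fun h => lab h = k)) := by
      intro k hk
      rw [← hblock0 k hk]
      rcases (hpm k).eq_or_lt with heq | hlt
      · rw [← heq, seg_self, seg_self]
      -- Blocks `1, …, 6` are pushed when they are nonempty, and there `F` is a permutation by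
      -- assumption; in blocks `0` and `7` it agrees with the array.
      · by_cases hk' : 1 ≤ k ∧ k ≤ 6
        · exact (hFv _ ((hmemch _).2 ⟨k, hk'.1, hk'.2, hlt, rfl⟩)).1
        · refine List.Perm.of_eq (seg_congr fun x hx hx' => hF x ?_ ?_ ?_)
          · have := hpmono (Nat.zero_le k); omega
          · have := hpmono (show k + 1 ≤ 8 by omega); omega
          · intro p hp
            obtain ⟨i, hi1, hi6, -, rfl⟩ := (hmemch p).1 hp
            rcases (by omega : k = 0 ∨ k = 7) with rfl | rfl
            · have := hpmono (show 0 + 1 ≤ i by omega)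
              simp only; omega
            · have := hpmono (show i + 1 ≤ 7 by omega)
              simp only; omega
    have hmemF : ∀ k < 8, ∀ h ∈ seg F (pos k) (pos (k + 1)), h ∈ l ∧ lab h = k := by
      intro k hk h hh
      have := (hperm k hk).mem_iff.1 hh
      simpa using this
    refine ⟨?_, ?_⟩
    · rw [hFseg]
      refine List.Perm.trans ?_ (bucket_perm hlab8)
      exact List.Perm.flatMap_left _ (fun k hk => hperm k (List.mem_range.1 hk))
    · rw [hFseg]
      refine isValid_flatMap ?_ ?_ ?_ ?_ ?_ ?_ ?_
      · intro h hh
        have h1 := (hmemF 0 (by omega) h hh).2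
        rw [hlab, label_eq_iff (hmem h)] at h1
        exact cutClass_eq_zero (by omega : cls h = 0)
      · intro h hh
        have h1 := (hmemF 7 (by omega) h hh).2
        rw [hlab, label_eq_iff (hmem h)] at h1
        exact cutClass_eq_seven (by omega : cls h = 7)
      · intro k hk1 hk6
        rcases (hpm k).eq_or_lt with heq | hlt
        · rw [← heq, seg_self]; exact isValid_nil I G
        · exact (hFv _ ((hmemch _).2 ⟨k, hk1, hk6, hlt, rfl⟩)).2
      · intro k hk1 hk3
        rw [walk_perm (hperm k (by omega)), walk_eq, List.filter_filter, List.filter_filter]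
        -- If the class loses objects, its handles carry the label `k + 3` and this block is empty.
        by_cases hle : A k ≤ B k
        · obtain ⟨hA, hB⟩ := hAB k (by simp; omega)
          have e1 : ∀ P : ℕ → Prop, ∀ [DecidablePred P],
              l.filter (fun h => decide (P h) && decide (lab h = k)) =
              l.filter (fun h => decide (cls h = k ∧ P h)) := by
            intro P _
            refine List.filter_congr fun x _ => ?_
            rw [← Bool.decide_and, decide_eq_decide, hlab, label_eq_iff (hmem x)]
            constructor
            · rintro ⟨h1, h2⟩; exact ⟨by omega, h1⟩
            · rintro ⟨h1, h2⟩; exact ⟨h2, by omega⟩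
          rw [e1 (fun h => ¬ h < I.m₁), e1 (fun h => h < I.m₁), ← hA, ← hB]; omega
        · have e1 : ∀ P : ℕ → Bool, l.filter (fun h => P h && decide (lab h = k)) = [] := by
            intro P
            rw [List.filter_eq_nil_iff]
            intro x _ hx
            rw [Bool.and_eq_true, decide_eq_true_eq, hlab, label_eq_iff (hmem x)] at hx
            omega
          rw [e1, e1]; simp
      · intro k hk4 hk6
        rw [walk_perm (hperm k (by omega)), walk_eq, List.filter_filter, List.filter_filter]
        by_cases hle : A (k - 3) ≤ B (k - 3)
        · have e1 : ∀ P : ℕ → Bool, l.filter (fun h => P h && decide (lab h = k)) = [] := by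
            intro P
            rw [List.filter_eq_nil_iff]
            intro x _ hx
            rw [Bool.and_eq_true, decide_eq_true_eq, hlab, label_eq_iff (hmem x)] at hx
            omega
          rw [e1, e1]; simp
        · obtain ⟨hA, hB⟩ := hAB (k - 3) (by simp; omega)
          have e1 : ∀ P : ℕ → Prop, ∀ [DecidablePred P],
              l.filter (fun h => decide (P h) && decide (lab h = k)) =
              l.filter (fun h => decide (cls h = k - 3 ∧ P h)) := by
            intro P _
            refine List.filter_congr fun x _ => ?_
            rw [← Bool.decide_and, decide_eq_decide, hlab, label_eq_iff (hmem x)]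
            constructor
            · rintro ⟨h1, h2⟩; exact ⟨by omega, h1⟩
            · rintro ⟨h1, h2⟩; exact ⟨h2, by omega⟩
          rw [e1 (fun h => ¬ h < I.m₁), e1 (fun h => h < I.m₁), ← hA, ← hB]; omega
      · intro i j hi hij hj x hx y hy
        have h1 := (hmemF i (by omega) x hx).2
        have h2 := (hmemF j (by omega) y hy).2
        rw [hlab, label_eq_iff (hmem _)] at h1 h2
        have hne : cls x ≠ cls y := fun h => by
          rw [h] at h1
          rcases h1 with h1 | ⟨g1, g2, g3⟩ | ⟨g1, g2, g3⟩
          · omega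
          · rcases h2 with h2 | h2 | ⟨f1, f2, f3⟩
            · omega
            · omega
            · exact f3 (by rw [← f2, g2]; exact g3)
          · omega
        exact disjoint_of_cutClass (by simp; omega) (by simp; omega) hne rfl rfl
      · rw [(hperm 0 (by omega)).length_eq, (hperm 7 (by omega)).length_eq]
        -- Blocks `0` and `7` together consist of the handles whose class is none of `1, 2, 3`, that
        -- is, of the met objects.
        have h1 := card_met_le hd hI hnd hln hcut hm1 hmn hpow hquant (by omega)
          (H := (l.filter (fun h => cls h ∉ [1, 2, 3])).toFinset)
          (fun x hx => by simp only [List.mem_toFinset] at hx ⊢; exact List.mem_of_mem_filter hx)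
          (fun x hx => by
            rw [List.mem_toFinset, List.mem_filter] at hx; simpa only [decide_eq_true_eq] using hx.2)
        rw [List.toFinset_card_of_nodup (hnd.filter _)] at h1
        refine le_trans ?_ h1
        have h2 := List.filter_append_perm (fun h => decide (cls h = 0))
          (l.filter (fun h => cls h ∉ [1, 2, 3]))
        rw [← h2.length_eq, List.length_append, List.filter_filter, List.filter_filter]
        refine Nat.add_le_add (Eq.le ?_) (Eq.le ?_)
        · congr 1
          refine List.filter_congr fun x _ => ?_
          rw [← Bool.decide_and, decide_eq_decide, hlab, label_eq_iff (hmem x)]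
          constructor
          · intro h; have : cls x = 0 := by omega
            rw [this]; decide
          · rintro ⟨h, -⟩; omega
        · congr 1
          refine List.filter_congr fun x _ => ?_
          rw [← decide_not, ← Bool.decide_and, decide_eq_decide, hlab, label_eq_iff (hmem x)]
          have hx := hmem x
          constructor
          · intro h; have : cls x = 7 := by omega
            rw [this]; decide
          · rintro ⟨h, h'⟩; simp at hx h'; omega

/-! ## The main loop -/

/-- Process segments until the stack is empty. -/
def mainLoop (d : ℕ) : Prog d := .while (.natLe (.const 1) (.var 3)) (node d (4 * d))

theorem stack_eq_concat {σ : Store} (h : 1 ≤ σ.nat 3 0) : ∃ s p, stack σ = s ++ [p] := by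
  rw [stack, ← Nat.sub_add_cancel h, seg_succ _ (Nat.zero_le _)]
  exact ⟨_, _, rfl⟩

/-- For a pushed block the depth is smaller by at least one than for its parent. Hence the loss
allowed for the parent covers the loss of the blocks plus one separator, and the potential of the
parent covers the potentials of the blocks plus the linear cost of processing. -/
theorem mainLoop_spec {d : ℕ} (hd : 1 ≤ d) (f : ℕ) : ∃ C, ∀ (I : Input d) (σ : Store) (n m : ℕ),
    I.IsGood f → n = I.m₁ + I.m₂ → σ.nat 0 0 = I.m₁ → m = σ.nat 2 0 → 1 ≤ m → m ≤ n →
    n ^ (d - 1) ≤ m ^ d → stack σ = [(0, n)] → IsSegment I (fun j => σ.nat (100 + j)) 0 n →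
    ∃ t σ', Exec I (mainLoop d) σ t σ' ∧ t ≤ C * (n * (depth (2 ^ (4 * d)) n + 1)) ∧
      (seg (σ'.nat 100) 0 n).Perm (seg (σ.nat 100) 0 n) ∧
      IsValid I (sepConst d f * m * (depth (2 ^ (4 * d)) n + 1)) (seg (σ'.nat 100) 0 n) := by
  obtain ⟨C, hC⟩ := node_effect hd f
  refine ⟨C + 10 + 10, fun I σ₀ n m hI hn h0 hm hm1 hmn hpow hst hseg₀ => ?_⟩
  set D := 2 ^ (4 * d) with hD
  have hD2 : 2 ≤ D := by
    calc 2 = 2 ^ 1 := rfl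
      _ ≤ 2 ^ (4 * d) := Nat.pow_le_pow_right (by norm_num) (by omega)
  set G : ℕ → ℕ := fun s => sepConst d f * m * (depth D s + 1) with hG
  set φ : ℕ × ℕ → ℕ := fun p => (C + 10) * ((p.2 - p.1) * (depth D (p.2 - p.1) + 1)) with hφ
  -- The last clause is a promise: every completion of the current array that orders the pending
  -- segments validly solves the whole problem. Initially it is trivial, and on the empty stack it
  -- applies to the array itself.
  let Inv : Store → Prop := fun σ =>
    (∀ p ∈ stack σ, p.2 ≤ n) ∧ σ.nat 0 = σ₀.nat 0 ∧ σ.nat 2 = σ₀.nat 2 ∧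
    (∀ p ∈ stack σ, IsSegment I (fun j => σ.nat (100 + j)) p.1 p.2) ∧
    (stack σ).Pairwise Apart ∧
    ∀ F : ℕ → ℕ,
      (∀ k < n, (∀ p ∈ stack σ, ¬ (p.1 ≤ k ∧ k < p.2)) → F k = σ.nat 100 k) →
      (∀ p ∈ stack σ, (seg F p.1 p.2).Perm (seg (σ.nat 100) p.1 p.2) ∧
        IsValid I (G (p.2 - p.1)) (seg F p.1 p.2)) →
      (seg F 0 n).Perm (seg (σ₀.nat 100) 0 n) ∧ IsValid I (G n) (seg F 0 n)
  obtain ⟨t, σ', e, ht, ⟨-, -, -, -, -, hcompl⟩, hb⟩ := exec_while (I := I)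
    (b := .natLe (.const 1) (.var 3)) (p := node d (4 * d)) Inv
    (fun σ => ((stack σ).map φ).sum) (by
      rintro σ ⟨hbd, i0, i2, hsegs, hap, hcompl⟩ hb
      obtain ⟨s, ⟨a, b⟩, hs⟩ := stack_eq_concat hb
      rw [hs] at hsegs hap hcompl hbd
      have hab := hsegs (a, b) (by simp)
      rw [List.pairwise_append] at hap
      have hsab : ∀ p ∈ s, Apart p (a, b) := fun p hp => hap.2.2 p hp (a, b) (by simp)
      obtain ⟨t, σ', ch, e, ht, j0, j2, hout, hst', hch, hchap, hsum, hcomb⟩ :=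
        hC I σ a b s hI hs (by rw [i0, h0]) (by rw [i2, ← hm]; exact hm1)
          (by rw [i2, ← hm, ← hn]; exact hmn) (by rw [i2, ← hm, ← hn]; exact hpow) hab
      have hd0 : ∀ k, k < a ∨ b ≤ k → σ'.nat 100 k = σ.nat 100 k := fun k hk => hout 0 hd k hk
      have hsout : ∀ p ∈ s, ∀ k, p.1 ≤ k → k < p.2 → k < a ∨ b ≤ k := by
        intro p hp k h1 h2
        have := hsab p hp; simp only [Apart] at this; omega
      have hdep : ∀ p ∈ ch, depth D (p.2 - p.1) + 1 ≤ depth D (b - a) := by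
        intro p hp
        obtain ⟨-, -, h3, h4⟩ := hch p hp
        exact depth_succ_le hD2 (by have := h3.lt; omega) h4
      refine ⟨t, σ', e, ⟨?_, ?_, ?_, ?_, ?_, ?_⟩, ?_⟩
      · intro p hp
        rw [hst', List.mem_append] at hp
        rcases hp with hp | hp
        · exact hbd p (by simp [hp])
        · exact (hch p hp).2.1.trans (hbd (a, b) (by simp))
      · rw [j0, i0]
      · rw [j2, i2]
      · intro p hp
        rw [hst', List.mem_append] at hp
        rcases hp with hp | hp
        · exact (hsegs p (by simp [hp])).congr hd fun j hj k h1 h2 => hout j hj k (hsout p hp k h1 h2)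
        · exact (hch p hp).2.2.1
      · rw [hst', List.pairwise_append]
        refine ⟨hap.1, hchap, fun p hp q hq => ?_⟩
        have h1 := hsab p hp
        obtain ⟨h2, h3, -⟩ := hch q hq
        simp only [Apart] at h1 ⊢; omega
      · intro F hF hFv
        rw [hst'] at hF hFv
        refine hcompl F ?_ ?_
        · intro k hk hkp
          have hkab := hkp (a, b) (by simp)
          rw [← hd0 k (by simp only at hkab; omega)]
          refine hF k hk fun p hp => ?_
          rcases List.mem_append.1 hp with hp | hp
          · exact hkp p (by simp [hp])
          · obtain ⟨h2, h3, -⟩ := hch p hp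
            simp only at hkab; omega
        · intro p hp
          rcases List.mem_append.1 hp with hp | hp
          · have := hFv p (by simp [hp])
            rwa [seg_congr (f := σ'.nat 100) (g := σ.nat 100)
              fun k h1 h2 => hd0 k (hsout p hp k h1 h2)] at this
          · rw [List.mem_singleton] at hp
            subst hp
            have hbn := hbd (a, b) (by simp)
            simp only at hbn ⊢
            have := hcomb F (sepConst d f * m * depth D (b - a)) (fun k h1 h2 hk => by
              refine hF k (by omega) fun p hp => ?_
              rcases List.mem_append.1 hp with hp | hp
              · intro h; have := hsout p hp k h.1 h.2; omega
              · exact hk p hp) (fun p hp => by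
              obtain ⟨h1, h2⟩ := hFv p (by simp [hp])
              exact ⟨h1, h2.mono (Nat.mul_le_mul_left _ (hdep p hp))⟩)
            rw [i2, ← hm] at this
            exact this
      -- The blocks have total length at most `b - a` and each has depth at most that of the parent
      -- minus one. The difference of the potentials, `(C + 10) * (b - a)`, pays for the step.
      · have h1 : (ch.map φ).sum ≤ (C + 10) * ((b - a) * depth D (b - a)) := by
          have h2 : (ch.map φ).sum ≤
              (ch.map (fun p => (p.2 - p.1) * ((C + 10) * depth D (b - a)))).sum := by
            refine List.sum_le_sum fun p hp => ?_
            rw [hφ]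
            calc (C + 10) * ((p.2 - p.1) * (depth D (p.2 - p.1) + 1))
                ≤ (C + 10) * ((p.2 - p.1) * depth D (b - a)) :=
                  Nat.mul_le_mul_left _ (Nat.mul_le_mul_left _ (hdep p hp))
              _ = _ := by ring
          rw [List.sum_map_mul_right] at h2
          calc _ ≤ _ := h2
            _ ≤ (b - a) * ((C + 10) * depth D (b - a)) := Nat.mul_le_mul_right _ hsum
            _ = _ := by ring
        rw [hst', hs]
        simp only [List.map_append, List.sum_append, List.map_cons, List.map_nil, List.sum_cons,
          List.sum_nil, Test.cost, NExp.cost]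
        have h3 : φ (a, b) = (C + 10) * ((b - a) * depth D (b - a)) + (C * (b - a) + 10 * (b - a)) := by
          rw [hφ]; ring
        have := hab.lt
        omega) σ₀ (by
      refine ⟨by simp [hst], rfl, rfl, by simpa [hst] using hseg₀, by simp [hst], fun F _ hF => ?_⟩
      rw [hst] at hF
      exact hF (0, n) (by simp))
  have hnil : stack σ' = [] := by
    simp only [Test.Holds, NExp.val, not_le] at hb
    rw [stack, Nat.lt_one_iff.1 hb, seg_self]
  rw [hnil] at hcompl
  obtain ⟨h1, h2⟩ := hcompl (σ'.nat 100) (fun _ _ _ => rfl) (by simp)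
  refine ⟨t, σ', e, ?_, h1, h2⟩
  rw [hst] at ht
  simp only [hφ, List.map_cons, List.map_nil, List.sum_cons, List.sum_nil, Test.cost, NExp.cost,
    Nat.sub_zero] at ht
  have : 1 ≤ n * (depth D n + 1) := Nat.mul_pos (by omega) (by omega)
  rw [add_mul]; omega

/-! ## Merging sorted blocks -/

/-- The entries of `g` at `0, …, k - 1` are sorted within blocks of `w` indices. -/
def BlockSorted (κ : ℕ → ℝ) (w : ℕ) (g : ℕ → ℕ) (k : ℕ) : Prop :=
  ∀ i j, i < j → j < k → i / w = j / w → κ (g i) ≤ κ (g j)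

theorem BlockSorted.congr {κ : ℕ → ℝ} {w k : ℕ} {g g' : ℕ → ℕ} (h : BlockSorted κ w g k)
    (hg : ∀ i < k, g' i = g i) : BlockSorted κ w g' k := fun i j hij hj hb => by
  rw [hg i (hij.trans hj), hg j hj]; exact h i j hij hj hb

theorem BlockSorted.pairwise {κ : ℕ → ℝ} {w n : ℕ} {g : ℕ → ℕ} (h : BlockSorted κ w g n)
    (hw : n ≤ w) : (seg g 0 n).Pairwise (fun x y => κ x ≤ κ y) := by
  rw [List.pairwise_iff_getElem]
  intro i j hi hj hij
  rw [length_seg] at hi hj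
  rw [getElem_seg, getElem_seg]
  refine h _ _ (by omega) (by omega) ?_
  rw [Nat.div_eq_of_lt (by omega), Nat.div_eq_of_lt (by omega)]

/-- The state after `k` entries have been written to `T`, when the sorted blocks of width `w` of `g` are
merged in pairs: the entries at `p, …, pe - 1` and at `q, …, qe - 1` of the current pair are left. -/
structure MergeState (κ : ℕ → ℝ) (n w : ℕ) (g T : ℕ → ℕ) (k p pe q qe : ℕ) : Prop where
  le₁ : p ≤ pe
  le₂ : pe ≤ q
  le₃ : q ≤ qe
  le₄ : qe ≤ n
  count : k + pe = p + q
  aligned : qe = n ∨ 2 * w ∣ qe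
  block : ∀ i i', p ≤ i → i < qe → p ≤ i' → i' < qe → i / (2 * w) = i' / (2 * w)
  left : ∀ i j, p ≤ i → i < j → j < pe → κ (g i) ≤ κ (g j)
  right : ∀ i j, q ≤ i → i < j → j < qe → κ (g i) ≤ κ (g j)
  sorted : BlockSorted κ (2 * w) T k
  cross : ∀ i i', i < k → (p ≤ i' ∧ i' < pe ∨ q ≤ i' ∧ i' < qe) → i / (2 * w) = i' / (2 * w) →
    κ (T i) ≤ κ (g i')
  perm : (seg T 0 k).Perm (seg g 0 p ++ seg g pe q)

/-- The pass starts with an exhausted pair of empty runs, so the first round already loads the first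
pair of blocks. -/
theorem mergeState_zero (κ : ℕ → ℝ) (n w : ℕ) (g T : ℕ → ℕ) : MergeState κ n w g T 0 0 0 0 0 where
  le₁ := le_rfl
  le₂ := le_rfl
  le₃ := le_rfl
  le₄ := Nat.zero_le n
  count := rfl
  aligned := .inr (dvd_zero _)
  block := fun _ _ _ h => absurd h (Nat.not_lt_zero _)
  left := fun _ _ _ _ h => absurd h (Nat.not_lt_zero _)
  right := fun _ _ _ _ h => absurd h (Nat.not_lt_zero _)
  sorted := fun _ _ _ h => absurd h (Nat.not_lt_zero _)
  cross := fun _ _ h => absurd h (Nat.not_lt_zero _)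
  perm := by simp [seg_self]

theorem MergeState.congr {κ : ℕ → ℝ} {n w : ℕ} {g T T' : ℕ → ℕ} {k p pe q qe : ℕ}
    (h : MergeState κ n w g T k p pe q qe) (hT : ∀ i < k, T' i = T i) :
    MergeState κ n w g T' k p pe q qe :=
  { h with
    sorted := h.sorted.congr hT
    cross := fun i i' hi => by rw [hT i hi]; exact h.cross i i' hi
    perm := by rw [seg_congr fun i _ hi => hT i hi]; exact h.perm }

/-- The next pair of blocks. -/
theorem MergeState.refill {κ : ℕ → ℝ} {n w : ℕ} {g T : ℕ → ℕ} {k p pe q qe : ℕ}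
    (h : MergeState κ n w g T k p pe q qe) (hw : 1 ≤ w) (hg : BlockSorted κ w g n) (hk : k < n)
    (hp : pe ≤ p) (hq : qe ≤ q) :
    MergeState κ n w g T k k (min (k + w) n) (min (k + w) n) (min (min (k + w) n + w) n) ∧
      k < min (k + w) n := by
  obtain ⟨h1, h2, h3, h4, h5, h6, -, -, -, h10, -, h12⟩ := h
  have hkq : k = qe := by omega
  -- Both runs are exhausted, so `k` is the end of the last pair; as `k < n`, this end is a multiple
  -- of `2 * w`.
  have hdvd : 2 * w ∣ k := by rcases h6 with h6 | h6 <;> [omega; exact hkq ▸ h6]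
  obtain ⟨c, rfl⟩ := hdvd
  have hb : ∀ i, 2 * w * c ≤ i → i < 2 * w * c + 2 * w → i / (2 * w) = c := fun i h h' =>
    Nat.div_eq_of_lt_le (by rw [mul_comm]; exact h) (by rw [add_mul, mul_comm c, one_mul]; exact h')
  have hl : ∀ i, 2 * w * c ≤ i → i < 2 * w * c + w → i / w = 2 * c := fun i h h' =>
    Nat.div_eq_of_lt_le (by linarith) (by linarith)
  have hr : ∀ i, 2 * w * c + w ≤ i → i < 2 * w * c + 2 * w → i / w = 2 * c + 1 := fun i h h' =>
    Nat.div_eq_of_lt_le (by linarith) (by linarith)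
  refine ⟨⟨by omega, le_rfl, by omega, by omega, by omega, ?_, ?_, ?_, ?_, h10, ?_, ?_⟩, by omega⟩
  · by_cases hn : 2 * w * c + 2 * w ≤ n
    · refine .inr ?_
      have : min (min (2 * w * c + w) n + w) n = 2 * w * (c + 1) := by rw [mul_add]; omega
      rw [this]; exact dvd_mul_right _ _
    · exact .inl (by omega)
  · intro i i' a1 a2 a3 a4
    rw [hb i a1 (by omega), hb i' a3 (by omega)]
  · intro i j a1 a2 a3
    exact hg i j a2 (by omega) (by rw [hl i a1 (by omega), hl j (by omega) (by omega)])
  · intro i j a1 a2 a3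
    exact hg i j a2 (by omega) (by rw [hr i (by omega) (by omega), hr j (by omega) (by omega)])
  · intro i i' a1 a2 a3
    rw [hb i' (by omega) (by omega)] at a3
    have : i / (2 * w) < c := Nat.div_lt_of_lt_mul a1
    omega
  · have e : seg g 0 p ++ seg g pe q = seg g 0 (2 * w * c) := by
      have : pe = p := by omega
      rw [this, seg_append g (Nat.zero_le _) (by omega)]
      congr 1; omega
    rw [seg_self, List.append_nil, ← e]; exact h12

/-- Write the first entry of the left block. -/
theorem MergeState.takeLeft {κ : ℕ → ℝ} {n w : ℕ} {g T : ℕ → ℕ} {k p pe q qe : ℕ}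
    (h : MergeState κ n w g T k p pe q qe) (hp : p < pe) (hpq : q < qe → κ (g p) ≤ κ (g q)) :
    MergeState κ n w g (Function.update T k (g p)) (k + 1) (p + 1) pe q qe := by
  have h' := h.congr (T' := Function.update T k (g p))
    fun i hi => Function.update_of_ne (by omega) _ _
  obtain ⟨h1, h2, h3, h4, h5, h6, h7, h8, h9, h10, h11, h12⟩ := h'
  have hblk := h7 k p (by omega) (by omega) le_rfl (by omega)
  refine ⟨hp, h2, h3, h4, by omega, h6, fun i i' a1 a2 a3 a4 =>
    h7 i i' (by omega) a2 (by omega) a4, fun i j a1 => h8 i j (by omega), h9, ?_, ?_, ?_⟩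
  · intro i j hij hj hb
    rcases (Nat.lt_succ_iff_lt_or_eq.1 hj) with hj | rfl
    · exact h10 i j hij hj hb
    · rw [Function.update_self]
      exact h11 i p hij (.inl ⟨le_rfl, hp⟩) (hb.trans hblk)
  · intro i i' hi hi' hb
    rcases (Nat.lt_succ_iff_lt_or_eq.1 hi) with hi | rfl
    · exact h11 i i' hi (by omega) hb
    · rw [Function.update_self]
      rcases hi' with hi' | hi'
      · exact h8 p i' le_rfl (by omega) hi'.2
      · refine (hpq (by omega)).trans ?_
        rcases hi'.1.eq_or_lt with rfl | hlt
        · exact le_rfl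
        · exact h9 q i' le_rfl hlt hi'.2
  · rw [seg_succ _ (Nat.zero_le _), seg_succ _ (Nat.zero_le _), Function.update_self,
      List.append_assoc]
    exact (h12.append_right _).trans (by
      rw [List.append_assoc]; exact List.Perm.append_left _ List.perm_append_comm)

/-- Write the first entry of the right block. -/
theorem MergeState.takeRight {κ : ℕ → ℝ} {n w : ℕ} {g T : ℕ → ℕ} {k p pe q qe : ℕ}
    (h : MergeState κ n w g T k p pe q qe) (hq : q < qe) (hpq : p < pe → κ (g q) ≤ κ (g p)) :
    MergeState κ n w g (Function.update T k (g q)) (k + 1) p pe (q + 1) qe := by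
  have h' := h.congr (T' := Function.update T k (g q))
    fun i hi => Function.update_of_ne (by omega) _ _
  obtain ⟨h1, h2, h3, h4, h5, h6, h7, h8, h9, h10, h11, h12⟩ := h'
  have hblk := h7 k q (by omega) (by omega) (by omega) (by omega)
  refine ⟨h1, by omega, hq, h4, by omega, h6, h7, h8, fun i j a1 => h9 i j (by omega), ?_, ?_, ?_⟩
  · intro i j hij hj hb
    rcases (Nat.lt_succ_iff_lt_or_eq.1 hj) with hj | rfl
    · exact h10 i j hij hj hb
    · rw [Function.update_self]
      exact h11 i q hij (.inr ⟨le_rfl, hq⟩) (hb.trans hblk)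
  · intro i i' hi hi' hb
    rcases (Nat.lt_succ_iff_lt_or_eq.1 hi) with hi | rfl
    · exact h11 i i' hi (by omega) hb
    · rw [Function.update_self]
      rcases hi' with hi' | hi'
      · refine (hpq (by omega)).trans ?_
        rcases hi'.1.eq_or_lt with rfl | hlt
        · exact le_rfl
        · exact h8 p i' le_rfl hlt hi'.2
      · exact h9 q i' le_rfl (by omega) hi'.2
  · rw [seg_succ _ (Nat.zero_le _), seg_succ _ h2, Function.update_self, ← List.append_assoc]
    exact h12.append_right _

theorem MergeState.finish {κ : ℕ → ℝ} {n w : ℕ} {g T : ℕ → ℕ} {p pe q qe : ℕ}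
    (h : MergeState κ n w g T n p pe q qe) :
    (seg T 0 n).Perm (seg g 0 n) ∧ BlockSorted κ (2 * w) T n := by
  refine ⟨?_, h.sorted⟩
  have h1 := h.le₁
  have h2 := h.le₂
  have h3 := h.le₃
  have h4 := h.le₄
  have h5 := h.count
  have : p = pe := by omega
  have : q = n := by omega
  have h6 := h.perm
  subst_vars
  rwa [seg_append g (Nat.zero_le _) h2] at h6

/-! ## Sorting the handles -/

/-- `body` for all indices below the number of objects, which is held in variable `1`. -/
def forAll {d : ℕ} (body : Prog d) : Prog d :=
  .seq (.seq (.assign 7 (.const 0)) (.assign 11 (.var 1))) body.forLoop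

theorem forAll_spec {d : ℕ} {I : Input d} {body : Prog d} (hs : body.Straight)
    (hw : ∀ a ∈ [1, 7, 11], ¬ body.WritesNat a) (Inv : ℕ → Store → Prop) (σ : Store) (n : ℕ)
    (hn : σ.nat 1 0 = n) (hσ : Inv 0 ((σ.setNat 7 0 0).setNat 11 0 n))
    (step : ∀ k σ', k < n → σ'.nat 7 0 = k → σ'.nat 1 0 = n → Inv k σ' →
      Inv (k + 1) ((body.eval I σ').setNat 7 0 (k + 1))) :
    ∃ t σ', Exec I (forAll body) σ t σ' ∧ t ≤ (body.bound + 40) * (n + 1) ∧ σ'.nat 1 0 = n ∧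
      Inv n σ' := by
  obtain ⟨t₁, b₁, e₁⟩ := Prog.exec_eval I (.seq (.assign 7 (.const 0)) (.assign 11 (.var 1)))
    (by simp [Prog.Straight]) σ
  simp only [Prog.bound, NExp.cost] at b₁
  have he : (σ.setNat 7 0 0).nat 1 0 = n := by rw [Store.setNat_nat_of_ne _ _ _ (by decide), hn]
  simp only [Prog.eval, NExp.val, he] at e₁
  obtain ⟨t₂, σ₂, e₂, b₂, h1, i₂⟩ := exec_forLoop (I := I) (body := body)
    (fun k σ' => σ'.nat 1 0 = n ∧ Inv k σ') body.bound 0 n (hw 7 (by decide)) (hw 11 (by decide)) (by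
      rintro k σ' - hk h7 ⟨h1, hI⟩
      obtain ⟨t, ht, e⟩ := body.exec_eval I hs σ'
      refine ⟨t, _, e, ht, ?_, step k σ' hk h7 h1 hI⟩
      rw [Store.setNat_nat_of_ne _ _ _ (by decide), e.nat_eq (hw 1 (by decide)), h1])
    ((σ.setNat 7 0 0).setNat 11 0 n) (by simp [Store.setNat_nat]) (by simp [Store.setNat_nat])
    (Nat.zero_le _) ⟨by rw [Store.setNat_nat_of_ne _ _ _ (by decide), he], hσ⟩
  refine ⟨_, σ₂, .seq e₁ e₂, ?_, h1, i₂⟩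
  have : (body.bound + 40) * (n + 1) = (body.bound + 20) * (n + 1) + 20 * n + 20 := by ring
  rw [Nat.sub_zero] at b₂
  omega

/-- The minimum of two numbers. -/
abbrev NExp.min (x y : NExp) : NExp := .minus x (.minus x y)

/-- Start with the next pair of blocks when the current pair is exhausted. -/
def refill (d : ℕ) : Prog d :=
  .ite (.and (.natLe (.var 33) (.var 32)) (.natLe (.var 35) (.var 34)))
    (.seq (.assign 32 (.var 7))
    (.seq (.assign 33 (.min (.plus (.var 7) (.var 31)) (.var 1)))
    (.seq (.assign 34 (.var 33))
      (.assign 35 (.min (.plus (.var 33) (.var 31)) (.var 1)))))) .skip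

/-- Write the next entry. -/
def takeNext {d : ℕ} (j : Fin d) : Prog d :=
  .ite (.and (.natLe (.plus (.var 32) (.const 1)) (.var 33))
      (.not (.and (.natLe (.plus (.var 34) (.const 1)) (.var 35))
        (.not (.realLe (.rep (.read (100 + j) (.var 32)) j) (.rep (.read (100 + j) (.var 34)) j))))))
    (.seq (.setNat 26 (.var 7) (.read (100 + j) (.var 32)))
      (.assign 32 (.plus (.var 32) (.const 1))))
    (.seq (.setNat 26 (.var 7) (.read (100 + j) (.var 34)))
      (.assign 34 (.plus (.var 34) (.const 1))))

/-- The arrays `32, …, 35` hold the indices of the merge. -/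
def IsMerge {d : ℕ} (I : Input d) (j : Fin d) (n w k : ℕ) (g : ℕ → ℕ) (σ : Store) : Prop :=
  MergeState (fun h => I.rep h j) n w g (σ.nat 26) k (σ.nat 32 0) (σ.nat 33 0) (σ.nat 34 0)
    (σ.nat 35 0)

theorem Prog.eval_iteTrue {d : ℕ} {I : Input d} {b : Test d} {p q : Prog d} {σ : Store}
    (h : b.Holds I σ) : (Prog.ite b p q).eval I σ = p.eval I σ := if_pos h

theorem Prog.eval_iteFalse {d : ℕ} {I : Input d} {b : Test d} {p q : Prog d} {σ : Store}
    (h : ¬ b.Holds I σ) : (Prog.ite b p q).eval I σ = q.eval I σ := if_neg h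

theorem Store.setNat_nat_self (σ : Store) (a i v : ℕ) :
    (σ.setNat a i v).nat a = Function.update (σ.nat a) i v := by
  simp [Store.setNat]

theorem eval_refill {d : ℕ} {I : Input d} {j : Fin d} {n w k : ℕ} {g : ℕ → ℕ} {σ : Store}
    (h : IsMerge I j n w k g σ) (hw : 1 ≤ w) (hg : BlockSorted (fun h => I.rep h j) w g n)
    (hk : k < n) (h1 : σ.nat 1 0 = n) (h7 : σ.nat 7 0 = k) (h31 : σ.nat 31 0 = w) :
    IsMerge I j n w k g ((refill d).eval I σ) ∧
    (((refill d).eval I σ).nat 32 0 < ((refill d).eval I σ).nat 33 0 ∨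
      ((refill d).eval I σ).nat 34 0 < ((refill d).eval I σ).nat 35 0) ∧
    ∀ a, a ∉ [32, 33, 34, 35] → ((refill d).eval I σ).nat a = σ.nat a := by
  have hmin : ∀ x y : ℕ, x - (x - y) = min x y := fun x y => by omega
  by_cases hc : (Test.and (.natLe (.var 33) (.var 32)) (.natLe (.var 35) (.var 34)) :
      Test d).Holds I σ
  · rw [refill, Prog.eval_iteTrue hc]
    simp only [Test.Holds, NExp.val] at hc
    obtain ⟨h2, h3⟩ := MergeState.refill h hw hg hk hc.1 hc.2
    simp only [Prog.eval, NExp.val]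
    refine ⟨?_, .inl ?_, fun a ha => ?_⟩
    · simpa [IsMerge, Store.setNat_nat, h1, h7, h31, hmin, Store.setNat_nat_of_ne] using h2
    · simpa [Store.setNat_nat, h1, h7, h31, hmin] using h3
    · simp only [List.mem_cons, List.not_mem_nil, or_false, not_or] at ha
      simp [Store.setNat_nat_of_ne, ha]
  · rw [refill, Prog.eval_iteFalse hc]
    simp only [Test.Holds, NExp.val] at hc
    exact ⟨h, by rw [Prog.eval]; omega, fun _ _ => rfl⟩

/-- When a run is exhausted, the comparison reads a cell beyond its end, but its outcome does not
influence the test. Hypothesis `hr`, which `eval_refill` provides, ensures that some entry is left.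
-/
theorem eval_takeNext {d : ℕ} {I : Input d} {j : Fin d} {n w k : ℕ} {g : ℕ → ℕ} {σ : Store}
    (h : IsMerge I j n w k g σ) (hg : ∀ i < n, σ.nat (100 + j) i = g i) (h7 : σ.nat 7 0 = k)
    (hr : σ.nat 32 0 < σ.nat 33 0 ∨ σ.nat 34 0 < σ.nat 35 0) :
    IsMerge I j n w (k + 1) g ((takeNext j).eval I σ) ∧
    ∀ a, a ∉ [26, 32, 34] → ((takeNext j).eval I σ).nat a = σ.nat a := by
  have l1 := h.le₁
  have l2 := h.le₂
  have l3 := h.le₃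
  have l4 := h.le₄
  by_cases hc : (Test.and (.natLe (.plus (.var 32) (.const 1)) (.var 33))
      (.not (.and (.natLe (.plus (.var 34) (.const 1)) (.var 35))
        (.not (.realLe (.rep (.read (100 + j) (.var 32)) j)
          (.rep (.read (100 + j) (.var 34)) j))))) : Test d).Holds I σ
  · rw [takeNext, Prog.eval_iteTrue hc]
    simp only [Test.Holds, NExp.val, RExp.val] at hc
    simp only [Prog.eval, NExp.val]
    refine ⟨?_, fun a ha => ?_⟩
    · rw [hg _ (by omega)] at hc ⊢
      have := MergeState.takeLeft h (by omega) (fun hq => by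
        by_contra hlt
        exact hc.2 ⟨by omega, by rw [hg _ (by omega)]; exact hlt⟩)
      simpa [IsMerge, Store.setNat_nat, h7, Store.setNat_nat_of_ne, Store.setNat_nat_self] using this
    · simp only [List.mem_cons, List.not_mem_nil, or_false, not_or] at ha
      simp [Store.setNat_nat_of_ne, ha]
  · rw [takeNext, Prog.eval_iteFalse hc]
    simp only [Test.Holds, NExp.val, RExp.val] at hc
    simp only [Prog.eval, NExp.val]
    have hq : σ.nat 34 0 < σ.nat 35 0 := by
      by_contra hq
      exact hc ⟨by omega, fun h => hq (by omega)⟩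
    refine ⟨?_, fun a ha => ?_⟩
    · rw [hg (σ.nat 34 0) (by omega)] at hc ⊢
      have := MergeState.takeRight h hq (fun hp => by
        rw [hg (σ.nat 32 0) (by omega)] at hc
        by_contra hlt
        exact hc ⟨by omega, fun h => h.2 (not_le.1 hlt).le⟩)
      simpa [IsMerge, Store.setNat_nat, h7, Store.setNat_nat_of_ne, Store.setNat_nat_self] using this
    · simp only [List.mem_cons, List.not_mem_nil, or_false, not_or] at ha
      simp [Store.setNat_nat_of_ne, ha]

/-- Merge the sorted blocks in pairs. -/
def mergePass {d : ℕ} (j : Fin d) : Prog d :=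
  .seq (.seq (.assign 32 (.const 0)) (.seq (.assign 33 (.const 0))
    (.seq (.assign 34 (.const 0)) (.assign 35 (.const 0)))))
  (.seq (forAll (.seq (refill d) (takeNext j)))
  (.seq (forAll (.setNat (100 + j) (.var 7) (.read 26 (.var 7))))
    (.assign 31 (.plus (.var 31) (.var 31)))))

theorem mergePass_spec {d : ℕ} (j : Fin d) : ∃ C, ∀ (I : Input d) (σ : Store) (n w : ℕ),
    σ.nat 1 0 = n → σ.nat 31 0 = w → 1 ≤ w →
    BlockSorted (fun h => I.rep h j) w (σ.nat (100 + j)) n →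
    ∃ t σ', Exec I (mergePass j) σ t σ' ∧ t ≤ C * (n + 1) ∧ σ'.nat 1 0 = n ∧
      σ'.nat 31 0 = 2 * w ∧ BlockSorted (fun h => I.rep h j) (2 * w) (σ'.nat (100 + j)) n ∧
      (seg (σ'.nat (100 + j)) 0 n).Perm (seg (σ.nat (100 + j)) 0 n) := by
  set body : Prog d := .seq (refill d) (takeNext j) with hbody
  set copy : Prog d := .setNat (100 + j) (.var 7) (.read 26 (.var 7)) with hcopy
  refine ⟨body.bound + copy.bound + 100, fun I σ n w h1 h31 hw hsort => ?_⟩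
  set g := σ.nat (100 + j) with hg
  obtain ⟨t₁, b₁, e₁⟩ := Prog.exec_eval I (.seq (.assign 32 (.const 0)) (.seq (.assign 33 (.const 0))
    (.seq (.assign 34 (.const 0)) (.assign 35 (.const 0))))) (by simp [Prog.Straight]) σ
  simp only [Prog.bound, NExp.cost] at b₁
  simp only [Prog.eval, NExp.val] at e₁
  set σ₁ := (((σ.setNat 32 0 0).setNat 33 0 0).setNat 34 0 0).setNat 35 0 0 with hσ₁
  have n₁ : ∀ a, a ∉ [32, 33, 34, 35] → σ₁.nat a = σ.nat a := fun a ha => by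
    simp only [List.mem_cons, List.not_mem_nil, or_false, not_or] at ha
    simp [hσ₁, Store.setNat_nat_of_ne, ha]
  obtain ⟨t₂, σ₂, e₂, b₂, h1₂, hM, h31₂, -⟩ := forAll_spec (I := I) (body := body)
    (by simp [hbody, refill, takeNext, Prog.Straight])
    (by simp [hbody, refill, takeNext, Prog.WritesNat])
    (fun k σ' => IsMerge I j n w k g σ' ∧ σ'.nat 31 0 = w ∧ ∀ i < n, σ'.nat (100 + j) i = g i)
    σ₁ n (by rw [n₁ 1 (by decide), h1]) (by
      refine ⟨?_, ?_, fun i _ => ?_⟩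
      · have : IsMerge I j n w 0 g σ₁ := by
          simpa [IsMerge, hσ₁, Store.setNat_nat] using mergeState_zero _ n w g _
        simpa [IsMerge, Store.setNat_nat_of_ne] using this
      · rw [Store.setNat_nat_of_ne _ _ _ (by decide), Store.setNat_nat_of_ne _ _ _ (by decide),
          n₁ 31 (by decide), h31]
      · rw [Store.setNat_nat_of_ne _ _ _ (by omega), Store.setNat_nat_of_ne _ _ _ (by omega),
          n₁ _ (by simp; omega)]) (by
      rintro k σ' hk h7 h1 ⟨hM, h31, hg'⟩
      obtain ⟨hM₁, hr, hn⟩ := eval_refill hM hw hsort hk h1 h7 h31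
      obtain ⟨hM₂, hn'⟩ := eval_takeNext hM₁
        (fun i hi => by rw [hn _ (by simp; omega), hg' i hi]) (by rw [hn _ (by decide), h7]) hr
      refine ⟨?_, ?_, fun i hi => ?_⟩
      · simpa [IsMerge, Store.setNat_nat_of_ne, hbody, Prog.eval] using hM₂
      · rw [Store.setNat_nat_of_ne _ _ _ (by decide), hbody, Prog.eval, hn' _ (by decide),
          hn 31 (by decide), h31]
      · rw [Store.setNat_nat_of_ne _ _ _ (by omega), hbody, Prog.eval, hn' _ (by simp; omega),
          hn _ (by simp; omega), hg' i hi])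
  obtain ⟨hp, hs⟩ := MergeState.finish hM
  obtain ⟨t₃, σ₃, e₃, b₃, h1₃, h31₃, hT, hc⟩ := forAll_spec (I := I) (body := copy) trivial
    (by simp [hcopy, Prog.WritesNat]; omega)
    (fun k σ' => σ'.nat 31 0 = w ∧ σ'.nat 26 = σ₂.nat 26 ∧
      ∀ i < k, σ'.nat (100 + j) i = σ₂.nat 26 i) σ₂ n h1₂ (by
      refine ⟨?_, ?_, fun i hi => absurd hi (Nat.not_lt_zero i)⟩
      · rw [Store.setNat_nat_of_ne _ _ _ (by decide), Store.setNat_nat_of_ne _ _ _ (by decide), h31₂]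
      · rw [Store.setNat_nat_of_ne _ _ _ (by decide), Store.setNat_nat_of_ne _ _ _ (by decide)]) (by
      rintro k σ' hk h7 h1 ⟨h31, hT, hc⟩
      simp only [hcopy, Prog.eval, NExp.val, h7]
      refine ⟨?_, ?_, fun i hi => ?_⟩
      · rw [Store.setNat_nat_of_ne _ _ _ (by decide), Store.setNat_nat_of_ne _ _ _ (by omega), h31]
      · rw [Store.setNat_nat_of_ne _ _ _ (by decide), Store.setNat_nat_of_ne _ _ _ (by omega), hT]
      · rw [Store.setNat_nat_of_ne _ _ _ (by omega), Store.setNat_nat_self, Function.update_apply, hT]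
        split_ifs with hik
        · rw [hik]
        · exact hc i (by omega))
  refine ⟨_, _, .seq e₁ (.seq e₂ (.seq e₃ (.setNat _ _ _ _))), ?_, ?_, ?_, ?_, ?_⟩
  · simp only [NExp.cost]
    have : (body.bound + copy.bound + 100) * (n + 1) = (body.bound + 40) * (n + 1) +
      (copy.bound + 40) * (n + 1) + 20 * (n + 1) := by ring
    omega
  · rw [Store.setNat_nat_of_ne _ _ _ (by decide), h1₃]
  · simp [NExp.val, Store.setNat_nat, h31₃]; omega
  · rw [Store.setNat_nat_of_ne _ _ _ (by omega)]
    exact hs.congr hc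
  · rw [Store.setNat_nat_of_ne _ _ _ (by omega), seg_congr fun i _ hi => hc i hi]
    exact hp

/-- Sort the handles by the `j`-th coordinates of the representative points. -/
def sortHandles {d : ℕ} (j : Fin d) : Prog d :=
  .seq (forAll (.setNat (100 + j) (.var 7) (.var 7)))
  (.seq (.assign 31 (.const 1))
    (.while (.natLe (.plus (.var 31) (.const 1)) (.var 1)) (mergePass j)))

theorem sortHandles_writesNat {d : ℕ} (j : Fin d) {a : ℕ} :
    (sortHandles j).WritesNat a ↔ a ∈ [7, 11, 26, 31, 32, 33, 34, 35, 100 + (j : ℕ)] := by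
  simp [sortHandles, mergePass, refill, takeNext, forAll, Prog.forLoop, Prog.WritesNat]
  tauto

/-- Bottom-up merge sort: blocks of width `1` are sorted, each pass doubles the width, and at width
at least `n` there is only one block. The potential counts the remaining doublings by `Nat.log`. -/
theorem sortHandles_spec {d : ℕ} (j : Fin d) : ∃ C, ∀ (I : Input d) (σ : Store) (n : ℕ),
    σ.nat 1 0 = n → 1 ≤ n →
    ∃ t σ', Exec I (sortHandles j) σ t σ' ∧ t ≤ C * ((n + 1) * (Nat.log 2 n + 2)) ∧
      (seg (σ'.nat (100 + j)) 0 n).Perm (List.range n) ∧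
      (seg (σ'.nat (100 + j)) 0 n).Pairwise (fun x y => I.rep x j ≤ I.rep y j) := by
  obtain ⟨C, hC⟩ := mergePass_spec j
  set init : Prog d := .setNat (100 + j) (.var 7) (.var 7) with hinit
  refine ⟨init.bound + 50 + (C + 20), fun I σ n h1 hn => ?_⟩
  obtain ⟨t₁, σ₁, e₁, b₁, h1₁, hid⟩ := forAll_spec (I := I) (body := init) trivial
    (by simp [hinit, Prog.WritesNat]; omega)
    (fun k σ' => ∀ i < k, σ'.nat (100 + j) i = i) σ n h1
    (fun i hi => absurd hi (Nat.not_lt_zero i)) (by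
      rintro k σ' hk h7 h1 hid i hi
      simp only [hinit, Prog.eval, NExp.val, h7]
      rw [Store.setNat_nat_of_ne _ _ _ (by omega), Store.setNat_nat_self, Function.update_apply]
      split_ifs with hik
      · rw [hik]
      · exact hid i (by omega))
  have e₂ : Exec I (.assign 31 (.const 1)) σ₁ _ _ := .setNat 31 (.const 0) (.const 1) σ₁
  simp only [NExp.cost, NExp.val] at e₂
  obtain ⟨t₃, σ₃, e₃, b₃, ⟨hw, h1₃, hs, hp⟩, hb⟩ := exec_while (I := I)
    (b := .natLe (.plus (.var 31) (.const 1)) (.var 1)) (p := mergePass j)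
    (fun σ' => 1 ≤ σ'.nat 31 0 ∧ σ'.nat 1 0 = n ∧
      BlockSorted (fun h => I.rep h j) (σ'.nat 31 0) (σ'.nat (100 + j)) n ∧
      (seg (σ'.nat (100 + j)) 0 n).Perm (List.range n))
    (fun σ' => (C + 20) * ((n + 1) * (Nat.log 2 n + 1 - Nat.log 2 (σ'.nat 31 0)))) (by
      rintro σ' ⟨hw, h1, hs, hp⟩ hb
      obtain ⟨t, σ'', e, ht, h1', h31, hs', hp'⟩ := hC I σ' n _ h1 rfl hw hs
      refine ⟨t, σ'', e, ⟨by omega, h1', by rw [h31]; exact hs', hp'.trans hp⟩, ?_⟩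
      simp only [Test.Holds, NExp.val, h1] at hb
      have hlog : Nat.log 2 (σ'.nat 31 0) ≤ Nat.log 2 n := Nat.log_mono_right (by omega)
      have hlog' : Nat.log 2 (2 * σ'.nat 31 0) = Nat.log 2 (σ'.nat 31 0) + 1 := by
        rw [mul_comm, Nat.log_mul_base (by norm_num) (by omega)]
      rw [h31, hlog']
      have : Nat.log 2 n + 1 - Nat.log 2 (σ'.nat 31 0) =
        Nat.log 2 n + 1 - (Nat.log 2 (σ'.nat 31 0) + 1) + 1 := by omega
      rw [this, mul_add (n + 1), mul_add (C + 20), mul_one, add_mul C 20 (n + 1)]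
      simp only [Test.cost, NExp.cost]
      omega) (σ₁.setNat 31 0 1) (by
      refine ⟨by simp [Store.setNat_nat], ?_, ?_, ?_⟩
      · rw [Store.setNat_nat_of_ne _ _ _ (by decide), h1₁]
      · have : (σ₁.setNat 31 0 1).nat 31 0 = 1 := by simp [Store.setNat_nat]
        rw [this]
        intro i k hik _ h
        simp only [Nat.div_one] at h; omega
      · rw [Store.setNat_nat_of_ne _ _ _ (by omega), seg_congr (g := id) fun i _ hi => hid i hi]
        simp [seg, List.range_eq_range'])
  simp only [Test.Holds, NExp.val, h1₃] at hb
  refine ⟨_, σ₃, .seq e₁ (.seq e₂ e₃), ?_, hp, hs.pairwise (by omega)⟩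
  simp only [Test.cost, NExp.cost] at b₃
  have h31 : (σ₁.setNat 31 0 1).nat 31 0 = 1 := by simp [Store.setNat_nat]
  rw [h31, Nat.log_one_right, Nat.sub_zero] at b₃
  have h2 : (n + 1) * (Nat.log 2 n + 1) ≤ (n + 1) * (Nat.log 2 n + 2) :=
    Nat.mul_le_mul_left _ (by omega)
  have h3 : n + 1 ≤ (n + 1) * (Nat.log 2 n + 2) := Nat.le_mul_of_pos_right _ (by omega)
  have h4 := Nat.mul_le_mul_left (init.bound + 50) h3
  have h5 := Nat.mul_le_mul_left (C + 20) h2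
  have h6 : (init.bound + 50) * (n + 1) = (init.bound + 40) * (n + 1) + 10 * n + 10 := by ring
  rw [add_mul (init.bound + 50)]
  omega

/-! ## The scale of the separators -/

/-- The `k`-th power. -/
def RExp.pow {d : ℕ} (x : RExp d) : ℕ → RExp d
  | 0 => .ofNat (.const 1)
  | k + 1 => .times (x.pow k) x

theorem RExp.val_pow {d : ℕ} (I : Input d) (σ : Store) (x : RExp d) (k : ℕ) :
    (x.pow k).val I σ = x.val I σ ^ k := by
  induction k with
  | zero => simp [RExp.pow, RExp.val, NExp.val]
  | succ k ih => rw [RExp.pow, RExp.val, ih, pow_succ]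

/-- The test for a scale that is too small. -/
def scaleTest (d : ℕ) : Test d :=
  .not (.realLe ((RExp.ofNat (.var 1)).pow (d - 1)) ((RExp.ofNat (.var 2)).pow d))

/-- Compute the scale of the separators. -/
def scaleLoop (d : ℕ) : Prog d :=
  .seq (.assign 2 (.const 1)) (.while (scaleTest d) (.assign 2 (.plus (.var 2) (.const 1))))

/-- The scale: the least positive number with `n ^ (d - 1) ≤ m ^ d`. -/
def IsScale (d n m : ℕ) : Prop :=
  1 ≤ m ∧ m ≤ n ∧ n ^ (d - 1) ≤ m ^ d ∧ (m = 1 ∨ (m - 1) ^ d < n ^ (d - 1))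

/-- Linear search is fast enough: `m = n` satisfies the condition, so there are at most `n` rounds.
The powers are compared as reals because natural numbers cannot be multiplied on the machine. -/
theorem scaleLoop_spec {d : ℕ} : ∃ C, ∀ (I : Input d) (σ : Store) (n : ℕ),
    σ.nat 1 0 = n → 1 ≤ n →
    ∃ t σ', Exec I (scaleLoop d) σ t σ' ∧ t ≤ C * (n + 1) ∧ IsScale d n (σ'.nat 2 0) := by
  refine ⟨(scaleTest d).cost + 10, fun I σ n h1 hn => ?_⟩
  have hT : ∀ σ' : Store, σ'.nat 1 0 = n →
      ((scaleTest d).Holds I σ' ↔ σ'.nat 2 0 ^ d < n ^ (d - 1)) := fun σ' h => by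
    simp only [scaleTest, Test.Holds, RExp.val_pow, RExp.val, NExp.val, h, not_le]
    exact_mod_cast Iff.rfl
  have e₁ : Exec I (.assign 2 (.const 1)) σ _ _ := .setNat 2 (.const 0) (.const 1) σ
  simp only [NExp.cost, NExp.val] at e₁
  obtain ⟨t, σ', e, ht, ⟨i1, i2, i3, i4⟩, hb⟩ := exec_while (I := I) (b := scaleTest d)
    (p := .assign 2 (.plus (.var 2) (.const 1)))
    (fun σ' => σ'.nat 1 0 = n ∧ 1 ≤ σ'.nat 2 0 ∧ σ'.nat 2 0 ≤ n ∧
      (σ'.nat 2 0 = 1 ∨ (σ'.nat 2 0 - 1) ^ d < n ^ (d - 1)))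
    (fun σ' => ((scaleTest d).cost + 10) * (n - σ'.nat 2 0)) (by
      rintro σ' ⟨i1, i2, i3, i4⟩ hb
      rw [hT σ' i1] at hb
      have hlt : σ'.nat 2 0 < n := by
        refine i3.lt_of_ne fun h => ?_
        rw [h] at hb
        exact absurd (Nat.pow_le_pow_right hn (Nat.sub_le d 1)) (not_le.2 hb)
      refine ⟨_, _, .setNat _ _ _ _, ⟨?_, ?_, ?_, ?_⟩, ?_⟩
      · rw [Store.setNat_nat_of_ne _ _ _ (by decide), i1]
      · simp [Store.setNat_nat, NExp.val]
      · simpa [Store.setNat_nat, NExp.val] using hlt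
      · right; simpa [Store.setNat_nat, NExp.val] using hb
      · simp only [Store.setNat_nat, NExp.val, NExp.cost, and_self, if_true]
        have : n - σ'.nat 2 0 = n - (σ'.nat 2 0 + 1) + 1 := by omega
        rw [this, mul_add]; omega) (σ.setNat 2 0 1) (by
      refine ⟨?_, ?_, ?_, ?_⟩
      · rw [Store.setNat_nat_of_ne _ _ _ (by decide), h1]
      all_goals simp [Store.setNat_nat, hn])
  rw [hT σ' i1, not_lt] at hb
  refine ⟨_, σ', .seq e₁ e, ?_, i2, i3, hb, i4⟩
  have h2 : (σ.setNat 2 0 1).nat 2 0 = 1 := by simp [Store.setNat_nat]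
  rw [h2] at ht
  have h3 : ((scaleTest d).cost + 10) * (n + 1) = ((scaleTest d).cost + 10) * (n - 1) +
      2 * ((scaleTest d).cost + 10) := by
    have : n + 1 = n - 1 + 2 := by omega
    rw [this]; ring
  omega

/-! ## The algorithm -/

theorem sortAll_spec {d : ℕ} (js : List (Fin d)) : ∃ C, ∀ (I : Input d) (σ : Store) (n : ℕ),
    σ.nat 1 0 = n → 1 ≤ n →
    ∃ t σ', Exec I (Prog.seqList sortHandles js) σ t σ' ∧ t ≤ C * ((n + 1) * (Nat.log 2 n + 2)) ∧
      ∀ j ∈ js, (seg (σ'.nat (100 + j)) 0 n).Perm (List.range n) ∧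
        (seg (σ'.nat (100 + j)) 0 n).Pairwise (fun x y => I.rep x j ≤ I.rep y j) := by
  induction js with
  | nil =>
    refine ⟨1, fun I σ n _ _ => ⟨1, σ, .skip σ, ?_, by simp⟩⟩
    rw [one_mul]
    exact Nat.mul_pos (by omega) (by omega)
  | cons j js ih =>
    obtain ⟨C₁, h₁⟩ := sortHandles_spec j
    obtain ⟨C₂, h₂⟩ := ih
    refine ⟨C₁ + C₂, fun I σ n h1 hn => ?_⟩
    obtain ⟨t₁, σ₁, e₁, b₁, r₁⟩ := h₁ I σ n h1 hn
    obtain ⟨t₂, σ₂, e₂, b₂, r₂⟩ := h₂ I σ₁ n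
      (by rw [e₁.nat_eq (by rw [sortHandles_writesNat]; simp; omega), h1]) hn
    refine ⟨_, σ₂, .seq e₁ e₂, by rw [add_mul]; omega, fun i hi => ?_⟩
    by_cases hij : i ∈ js
    · exact r₂ i hij
    · obtain rfl : i = j := (List.mem_cons.1 hi).resolve_right hij
      rwa [e₂.nat_eq (by
        rw [Prog.writesNat_seqList]
        rintro ⟨k, hk, hw⟩
        rw [sortHandles_writesNat] at hw
        have : (k : ℕ) ≠ i := fun h => hij (Fin.ext h ▸ hk)
        simp at hw
        omega)]

/-- Push the segment of all handles on the empty stack. -/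
def pushAll {d : ℕ} : Prog d :=
  .seq (.setNat 20 (.const 0) (.const 0)) (.seq (.setNat 21 (.const 0) (.var 1))
    (.assign 3 (.const 1)))

/-- The initialization: compute the order in which the handles are processed. -/
def setup (d : ℕ) : Prog d :=
  .ite (.natLe (.const 1) (.plus (.read 0 (.const 0)) (.read 0 (.const 1))))
    (.seq (.assign 1 (.plus (.read 0 (.const 0)) (.read 0 (.const 1))))
    (.seq (scaleLoop d) (.seq (Prog.seqList sortHandles (List.finRange d))
    (.seq pushAll (.seq (mainLoop d) (.assign 30 (.const 0))))))) .skip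

/-- Report the next handle. -/
def advance {d : ℕ} : Prog d :=
  .seq (.setNat 0 (.const 2) (.read 100 (.var 30))) (.assign 30 (.plus (.var 30) (.const 1)))

/-- The algorithm. -/
def algorithm (d : ℕ) : MixAlgorithm d := ⟨setup d, advance⟩

theorem setup_spec {d : ℕ} (hd : 1 ≤ d) (f : ℕ) : ∃ C, ∀ (I : Input d) (n : ℕ),
    I.IsGood f → n = I.m₁ + I.m₂ → 1 ≤ n →
    ∃ m t σ, IsScale d n m ∧ Exec I (setup d) I.initialStore t σ ∧
      t ≤ C * (n * (Nat.log 2 n + depth (2 ^ (4 * d)) n + 1)) ∧ σ.nat 30 0 = 0 ∧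
      (seg (σ.nat 100) 0 n).Perm (List.range n) ∧
      IsValid I (sepConst d f * m * (depth (2 ^ (4 * d)) n + 1)) (seg (σ.nat 100) 0 n) := by
  obtain ⟨C₁, h₁⟩ := scaleLoop_spec (d := d)
  obtain ⟨C₂, h₂⟩ := sortAll_spec (List.finRange d)
  obtain ⟨C₃, h₃⟩ := mainLoop_spec hd f
  refine ⟨2 * C₁ + 4 * C₂ + C₃ + 100, fun I n hI hn hn1 => ?_⟩
  have hb : Test.Holds I I.initialStore
      (.natLe (.const 1) (.plus (.read 0 (.const 0)) (.read 0 (.const 1)))) := by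
    simp only [Test.Holds, NExp.val, Input.initialStore]; simp; omega
  have e₀ : Exec I (.assign 1 (.plus (.read 0 (.const 0)) (.read 0 (.const 1)))) I.initialStore _ _ :=
    .setNat 1 (.const 0) _ I.initialStore
  have hv : (NExp.plus (.read 0 (.const 0)) (.read 0 (.const 1))).val I.initialStore = n := by
    simp [NExp.val, Input.initialStore, hn]
  rw [hv] at e₀
  simp only [NExp.cost, NExp.val] at e₀
  set σ₀ := I.initialStore.setNat 1 0 n with hσ₀
  obtain ⟨t₁, σ₁, e₁, b₁, hm⟩ := h₁ I σ₀ n (by simp [hσ₀, Store.setNat_nat]) hn1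
  have w₁ : ∀ a, a ≠ 2 → σ₁.nat a = σ₀.nat a := fun a ha =>
    e₁.nat_eq (by simpa [scaleLoop, Prog.WritesNat] using ha)
  have hn₁ : σ₁.nat 1 0 = n := by rw [w₁ 1 (by decide)]; simp [hσ₀, Store.setNat_nat]
  obtain ⟨t₂, σ₂, e₂, b₂, hs⟩ := h₂ I σ₁ n hn₁ hn1
  have w₂ : ∀ a, a < 7 → σ₂.nat a = σ₁.nat a := fun a ha => e₂.nat_eq (by
    rw [Prog.writesNat_seqList]
    rintro ⟨k, -, hw⟩
    rw [sortHandles_writesNat] at hw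
    simp at hw
    omega)
  obtain ⟨t₃, b₃, e₃⟩ := Prog.exec_eval I (pushAll (d := d)) (by simp [pushAll, Prog.Straight]) σ₂
  have hσ₃ : (pushAll (d := d)).eval I σ₂ = ((σ₂.setNat 20 0 0).setNat 21 0 n).setNat 3 0 1 := by
    have : σ₂.nat 1 0 = n := by rw [w₂ 1 (by decide), hn₁]
    simp [pushAll, Prog.eval, NExp.val, Store.setNat_nat, this]
  rw [hσ₃] at e₃
  simp only [pushAll, Prog.bound, NExp.cost] at b₃
  set σ₃ := ((σ₂.setNat 20 0 0).setNat 21 0 n).setNat 3 0 1 with hσ₃'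
  have w₃ : ∀ a, a ∉ [3, 20, 21] → σ₃.nat a = σ₂.nat a := fun a ha => by
    simp only [List.mem_cons, List.not_mem_nil, or_false, not_or] at ha
    simp [hσ₃', Store.setNat_nat_of_ne, ha]
  have w100 : ∀ j, σ₃.nat (100 + j) = σ₂.nat (100 + j) := fun j => w₃ _ (by simp; omega)
  have hm₃ : σ₃.nat 2 0 = σ₁.nat 2 0 := by rw [w₃ 2 (by decide), w₂ 2 (by decide)]
  have hsort : ∀ j : Fin d, (seg (σ₂.nat (100 + j)) 0 n).Perm (List.range n) ∧ _ := fun j =>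
    hs j (List.mem_finRange j)
  have hr : (seg (σ₂.nat (100 + 0)) 0 n).Perm (List.range n) := (hsort ⟨0, hd⟩).1
  obtain ⟨t₄, σ₄, e₄, b₄, hp, hval⟩ := h₃ I σ₃ n (σ₁.nat 2 0) hI hn
    (by
      rw [w₃ 0 (by decide), w₂ 0 (by decide), w₁ 0 (by decide)]
      simp [hσ₀, Store.setNat_nat, Input.initialStore])
    hm₃.symm hm.1 hm.2.1 hm.2.2.1
    (by simp [stack, hσ₃', Store.setNat_nat, seg]) (by
      refine ⟨by omega, ?_, fun h hh => ?_, fun j hj => ?_, fun j => ?_⟩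
      · simp only [w100]
        exact hr.nodup_iff.2 List.nodup_range
      · simp only [w100] at hh
        rw [← hn]; exact List.mem_range.1 (hr.mem_iff.1 hh)
      · simp only [w100]
        exact (hsort ⟨j, hj⟩).1.trans hr.symm
      · simp only [w100]
        exact (hsort j).2)
  have e₅ : Exec I (.assign 30 (.const 0)) σ₄ _ _ := .setNat 30 (.const 0) (.const 0) σ₄
  simp only [NExp.cost, NExp.val] at e₅
  have h100 : (σ₄.setNat 30 0 0).nat 100 = σ₄.nat 100 := Store.setNat_nat_of_ne _ _ _ (by decide)
  refine ⟨_, _, _, hm, .iteTrue hb (.seq e₀ (.seq e₁ (.seq e₂ (.seq e₃ (.seq e₄ e₅))))), ?_,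
    by simp [Store.setNat_nat], ?_, ?_⟩
  · simp only [Test.cost, NExp.cost]
    set L := Nat.log 2 n
    set D := depth (2 ^ (4 * d)) n
    have x₁ : n + 1 ≤ 2 * (n * (L + D + 1)) := by nlinarith [Nat.zero_le (n * (L + D))]
    have x₂ : (n + 1) * (L + 2) ≤ 4 * (n * (L + D + 1)) := by
      calc (n + 1) * (L + 2) ≤ (2 * n) * (2 * (L + D + 1)) :=
            Nat.mul_le_mul (by omega) (by omega)
        _ = _ := by ring
    have x₃ : n * (D + 1) ≤ n * (L + D + 1) := Nat.mul_le_mul_left _ (by omega)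
    have x₄ : 1 ≤ n * (L + D + 1) := Nat.mul_pos hn1 (by omega)
    have y₁ := Nat.mul_le_mul_left C₁ x₁
    have y₂ := Nat.mul_le_mul_left C₂ x₂
    have y₃ := Nat.mul_le_mul_left C₃ x₃
    have y : (2 * C₁ + 4 * C₂ + C₃ + 100) * (n * (L + D + 1)) = C₁ * (2 * (n * (L + D + 1))) +
      C₂ * (4 * (n * (L + D + 1))) + C₃ * (n * (L + D + 1)) + 100 * (n * (L + D + 1)) := by ring
    omega
  · rw [h100]
    refine hp.trans ?_
    rw [w100 0]; exact hr
  · rw [h100]; exact hval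

/-- After the initialization the order is stored in array `100`, and the calls only advance the
pointer in variable `30`. So each call takes constant time. -/
theorem algorithm_runs {d : ℕ} {I : Input d} {t : ℕ} {σ₀ : Store}
    (h : Exec I (setup d) I.initialStore t σ₀) (h0 : σ₀.nat 30 0 = 0) :
    ∃ T, T ≤ t + 20 * (I.m₁ + I.m₂) ∧ (algorithm d).Runs I (σ₀.nat 100) T := by
  have hs : (advance (d := d)).Straight := by simp [advance, Prog.Straight]
  let σ : ℕ → Store := fun i => Nat.rec σ₀ (fun _ σ => (advance (d := d)).eval I σ) i
  have hσ : ∀ i, σ (i + 1) = (advance (d := d)).eval I (σ i) := fun _ => rfl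
  choose τ hτ eτ using fun i => Prog.exec_eval I (advance (d := d)) hs (σ i)
  have inv : ∀ i, (σ i).nat 100 = σ₀.nat 100 ∧ (σ i).nat 30 0 = i := by
    intro i
    induction i with
    | zero => exact ⟨rfl, h0⟩
    | succ i ih =>
      rw [hσ]
      simp [advance, Prog.eval, NExp.val, Store.setNat_nat, Store.setNat_nat_of_ne, ih.1, ih.2]
  let τ' : ℕ → ℕ := fun i => Nat.casesOn i t τ
  refine ⟨∑ i ∈ Finset.range (I.m₁ + I.m₂ + 1), τ' i, ?_, σ, τ', h, fun i _ => ⟨eτ i, ?_⟩, rfl⟩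
  · rw [Finset.sum_range_succ', add_comm]
    refine Nat.add_le_add_left ?_ t
    refine (Finset.sum_le_card_nsmul _ _ 20 fun i _ => ?_).trans (by simp [mul_comm])
    refine (hτ i).trans ?_
    simp [advance, Prog.bound, NExp.cost]
  · rw [hσ, Store.reported]
    simp [advance, Prog.eval, NExp.val, Store.setNat_nat, (inv i).1, (inv i).2]

/-! ## From a list of handles to a MIX -/

/-- The handles that are present after `i` steps: those of the first set that have not been processed,
and those of the second set that have been processed. -/
def handles (m₁ : ℕ) (l : List ℕ) (i : ℕ) : Finset ℕ :=
  (l.drop i).toFinset.filter (fun h => h < m₁) ∪ (l.take i).toFinset.filter (fun h => m₁ ≤ h)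

theorem mem_handles {m₁ : ℕ} {l : List ℕ} {i h : ℕ} :
    h ∈ handles m₁ l i ↔ h ∈ l.drop i ∧ h < m₁ ∨ h ∈ l.take i ∧ m₁ ≤ h := by
  simp [handles]

theorem handles_step {m₁ : ℕ} {l : List ℕ} (hl : l.Nodup) {i : ℕ} (hi : i < l.length) :
    (l[i] < m₁ → l[i] ∉ handles m₁ l (i + 1) ∧
      handles m₁ l i = insert l[i] (handles m₁ l (i + 1))) ∧
    (m₁ ≤ l[i] → l[i] ∉ handles m₁ l i ∧ handles m₁ l (i + 1) = insert l[i] (handles m₁ l i)) := by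
  have hd : l.drop i = l[i] :: l.drop (i + 1) := List.drop_eq_getElem_cons hi
  have ht : l.take (i + 1) = l.take i ++ [l[i]] := (List.take_append_getElem hi).symm
  have hn : (l.take i ++ (l[i] :: l.drop (i + 1))).Nodup := by
    rw [← hd, List.take_append_drop]; exact hl
  have h1 : l[i] ∉ l.drop (i + 1) := (List.nodup_cons.1 hn.of_append_right).1
  have h2 : l[i] ∉ l.take i := fun h =>
    (List.nodup_append.1 hn).2.2 _ h _ (List.mem_cons_self) rfl
  refine ⟨fun h => ⟨fun hh => ?_, ?_⟩, fun h => ⟨fun hh => ?_, ?_⟩⟩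
  · rw [mem_handles] at hh
    rcases hh with hh | hh
    · exact h1 hh.1
    · exact absurd hh.2 (not_le.2 h)
  · ext x
    simp only [Finset.mem_insert, mem_handles, hd, ht, List.mem_cons, List.mem_append,
      List.not_mem_nil, or_false]
    constructor
    · rintro (⟨rfl | hx, hx'⟩ | hx)
      · exact .inl rfl
      · exact .inr (.inl ⟨hx, hx'⟩)
      · exact .inr (.inr ⟨.inl hx.1, hx.2⟩)
    · rintro (rfl | ⟨hx, hx'⟩ | ⟨hx | rfl, hx'⟩)
      · exact .inl ⟨.inl rfl, h⟩
      · exact .inl ⟨.inr hx, hx'⟩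
      · exact .inr ⟨hx, hx'⟩
      · omega
  · rw [mem_handles] at hh
    rcases hh with hh | hh
    · omega
    · exact h2 hh.1
  · ext x
    simp only [Finset.mem_insert, mem_handles, hd, ht, List.mem_cons, List.mem_append,
      List.not_mem_nil, or_false]
    constructor
    · rintro (⟨hx, hx'⟩ | ⟨hx | rfl, hx'⟩)
      · exact .inr (.inl ⟨.inr hx, hx'⟩)
      · exact .inr (.inr ⟨hx, hx'⟩)
      · exact .inl rfl
    · rintro (rfl | ⟨rfl | hx, hx'⟩ | ⟨hx, hx'⟩)
      · exact .inr ⟨.inr rfl, h⟩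
      · omega
      · exact .inl ⟨hx, hx'⟩
      · exact .inr ⟨.inl hx, hx'⟩

theorem card_handles {m₁ : ℕ} {l : List ℕ} (hl : l.Nodup) {i : ℕ} (hi : i ≤ l.length) :
    ((handles m₁ l i).card : ℤ) = (handles m₁ l 0).card + walk m₁ (l.take i) := by
  induction i with
  | zero => simp
  | succ i ih =>
    obtain ⟨h1, h2⟩ := handles_step (m₁ := m₁) hl (i := i) (by omega)
    have ih := ih (by omega)
    rw [← List.take_append_getElem (by omega : i < l.length), walk_append, walk_cons, walk_nil]
    split_ifs with h
    · obtain ⟨h3, h4⟩ := h1 h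
      have := Finset.card_insert_of_notMem h3
      rw [← h4] at this; omega
    · obtain ⟨h3, h4⟩ := h2 (not_lt.1 h)
      have := Finset.card_insert_of_notMem h3
      rw [← h4] at this; omega

theorem handles_zero {m₁ m₂ : ℕ} {l : List ℕ} (hl : l.Perm (List.range (m₁ + m₂))) :
    handles m₁ l 0 = Finset.range m₁ := by
  ext h
  rw [mem_handles, List.drop_zero, hl.mem_iff]
  simp; omega

theorem handles_length {m₁ m₂ : ℕ} {l : List ℕ} (hl : l.Perm (List.range (m₁ + m₂))) :
    handles m₁ l (m₁ + m₂) = Finset.Ico m₁ (m₁ + m₂) := by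
  have hlen : l.length = m₁ + m₂ := by rw [hl.length_eq, List.length_range]
  ext h
  rw [mem_handles, ← hlen, List.take_length, List.drop_length, hl.mem_iff]
  simp [hlen]; omega

theorem handles_subset {m₁ m₂ : ℕ} {l : List ℕ} (hl : l.Perm (List.range (m₁ + m₂))) (i : ℕ) :
    handles m₁ l i ⊆ Finset.range m₁ ∪ Finset.Ico m₁ (m₁ + m₂) := by
  intro h hh
  have hmem : h ∈ l := by
    rcases mem_handles.1 hh with h | h
    · exact List.mem_of_mem_drop h.1
    · exact List.mem_of_mem_take h.1
  rw [hl.mem_iff, List.mem_range] at hmem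
  simp; omega

/-- Two handles of the same set are covered by its independence. In a mixed pair the new handle has
been processed and the old one has not, so the new one precedes the old one in the list, and
`IsValid.indep` applies. -/
theorem disjoint_of_mem_handles {d : ℕ} {I : Input d} {f g : ℕ} (hI : I.IsGood f) {l : List ℕ}
    (hl : l.Perm (List.range (I.m₁ + I.m₂))) (hv : IsValid I g l) {i h h' : ℕ}
    (hh : h ∈ handles I.m₁ l i) (hh' : h' ∈ handles I.m₁ l i) (hne : h ≠ h') :
    Disjoint (I.obj h) (I.obj h') := by
  have hlt : ∀ x ∈ handles I.m₁ l i, x < I.m₁ + I.m₂ := fun x hx => by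
    have := handles_subset hl i hx
    simp at this; omega
  have cross : ∀ x y, x ∈ handles I.m₁ l i → y ∈ handles I.m₁ l i → I.m₁ ≤ x → y < I.m₁ →
      Disjoint (I.obj x) (I.obj y) := by
    intro x y hx hy hx' hy'
    rw [mem_handles] at hx hy
    have h1 : x ∈ l.take i := (hx.resolve_left fun h => absurd h.2 (not_lt.2 hx')).1
    have h2 : y ∈ l.drop i := (hy.resolve_right fun h => absurd h.2 (not_le.2 hy')).1
    have h3 := hv.indep
    rw [← List.take_append_drop i l, List.pairwise_append] at h3
    exact h3.2.2 x h1 y h2 hx' hy'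
  rcases lt_or_ge h I.m₁ with h1 | h1 <;> rcases lt_or_ge h' I.m₁ with h2 | h2
  · exact hI.first.disjoint h (by simpa using h1) h' (by simpa using h2) hne
  · exact (cross h' h hh' hh h2 h1).symm
  · exact cross h h' hh hh' h1 h2
  · exact hI.second.disjoint h (by simpa using ⟨h1, hlt h hh⟩) h' (by simpa using ⟨h2, hlt h' hh'⟩)
      hne

/-- The two sets may share objects, so different handles may denote the same object. Objects are
nonempty, hence not disjoint from themselves, and such handles are never present together. -/
theorem injOn_of_disjoint {d : ℕ} {I : Input d} {f : ℕ} (hI : I.IsGood f) {H : Finset ℕ}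
    (hH : ∀ h ∈ H, h < I.m₁ + I.m₂)
    (hd : ∀ h ∈ H, ∀ h' ∈ H, h ≠ h' → Disjoint (I.obj h) (I.obj h')) : Set.InjOn I.obj H := by
  intro x hx y hy hxy
  by_contra hne
  have h1 := hd x hx y hy hne
  rw [hxy, disjoint_self] at h1
  exact (hI.object y (hH y hy)).1.nonempty.ne_empty h1

open scoped Classical in
theorem symmDiff_image_insert {α β : Type*} [DecidableEq α] {F : α → β} {h : α} {H : Finset α}
    (hinj : Set.InjOn F (insert h H : Finset α)) (hh : h ∉ H) :
    symmDiff (H.image F) ((insert h H).image F) = {F h} ∧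
    symmDiff ((insert h H).image F) (H.image F) = {F h} := by
  have h1 : F h ∉ H.image F := by
    rw [Finset.mem_image]
    rintro ⟨x, hx, hxh⟩
    have := hinj (by simp [hx]) (by simp) hxh
    exact hh (this ▸ hx)
  have h2 : symmDiff (H.image F) ((insert h H).image F) = {F h} := by
    ext x
    rw [Finset.image_insert, Finset.mem_symmDiff, Finset.mem_insert, Finset.mem_singleton]
    constructor
    · rintro (⟨hx, hx'⟩ | ⟨hx | hx, hx'⟩)
      · exact absurd (.inr hx) hx'
      · exact hx
      · exact absurd hx hx'
    · rintro rfl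
      exact .inr ⟨.inl rfl, h1⟩
  exact ⟨h2, by rw [symmDiff_comm]; exact h2⟩

open scoped Classical in
/-- The input lists the two sets. -/
structure Input.Lists {d : ℕ} (I : Input d) (A B : Finset (Set (Pt d))) : Prop where
  card₁ : I.m₁ = A.card
  card₂ : I.m₂ = B.card
  image₁ : (Finset.range I.m₁).image I.obj = A
  image₂ : (Finset.Ico I.m₁ (I.m₁ + I.m₂)).image I.obj = B
  rep_mem : ∀ i < I.m₁ + I.m₂, I.rep i ∈ I.obj i

open scoped Classical in
theorem isMix_of_isValid {d : ℕ} {I : Input d} {f g : ℕ} (hI : I.IsGood f)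
    {A B : Finset (Set (Pt d))} (hAB : I.Lists A B) {l : List ℕ}
    (hl : l.Perm (List.range (I.m₁ + I.m₂))) (hv : IsValid I g l) {G : ℝ} (hG : (g : ℝ) ≤ G) :
    IsMix A B G (fun i => (handles I.m₁ l i).image I.obj) ∧
    ∀ (i : ℕ) (hi : i < l.length), symmDiff ((handles I.m₁ l i).image I.obj)
      ((handles I.m₁ l (i + 1)).image I.obj) = {I.obj l[i]} := by
  have hlen : l.length = I.m₁ + I.m₂ := by rw [hl.length_eq, List.length_range]
  have hn : l.Nodup := hl.nodup_iff.2 List.nodup_range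
  have hinj : ∀ i, Set.InjOn I.obj (handles I.m₁ l i) := fun i =>
    injOn_of_disjoint hI (fun h hh => by
      have := handles_subset hl i hh
      simp at this; omega) fun h hh h' hh' hne => disjoint_of_mem_handles hI hl hv hh hh' hne
  have hstep : ∀ (i : ℕ) (hi : i < l.length), symmDiff ((handles I.m₁ l i).image I.obj)
      ((handles I.m₁ l (i + 1)).image I.obj) = {I.obj l[i]} := by
    intro i hi
    obtain ⟨h1, h2⟩ := handles_step (m₁ := I.m₁) hn hi
    rcases lt_or_ge l[i] I.m₁ with h | h
    · obtain ⟨h3, h4⟩ := h1 h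
      have := hinj i
      rw [h4] at this ⊢
      exact (symmDiff_image_insert this h3).2
    · obtain ⟨h3, h4⟩ := h2 h
      have := hinj (i + 1)
      rw [h4] at this ⊢
      exact (symmDiff_image_insert this h3).1
  refine ⟨⟨?_, ?_, fun i _ => ?_, fun i _ => ?_, fun i hi => ?_, fun i hi => ?_⟩, hstep⟩
  · simp only [handles_zero hl]; exact hAB.image₁
  · simp only [← hAB.card₁, ← hAB.card₂, handles_length hl]; exact hAB.image₂
  · rw [← hAB.image₁, ← hAB.image₂, ← Finset.image_union]
    exact Finset.image_subset_image (handles_subset hl i)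
  · intro X hX Y hY hne
    obtain ⟨x, hx, rfl⟩ := Finset.mem_image.1 (Finset.mem_coe.1 hX)
    obtain ⟨y, hy, rfl⟩ := Finset.mem_image.1 (Finset.mem_coe.1 hY)
    exact disjoint_of_mem_handles hI hl hv hx hy fun h => hne (by rw [h])
  · rw [← hAB.card₁, ← hAB.card₂] at hi ⊢
    rw [Finset.card_image_of_injOn (hinj i)]
    -- The set after `i` steps has `m₁` plus the walk of the prefix as its cardinality, and the full
    -- walk is `m₂ - m₁`. So the lower bound `min 0 (m₂ - m₁) - g` for the walk becomes `min m₁ m₂ -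
    -- g`.
    have c0 := card_handles (m₁ := I.m₁) hn (i := i) (by omega)
    have c1 := card_handles (m₁ := I.m₁) hn (i := l.length) le_rfl
    have c2 := hv.bound i
    rw [List.take_length, hlen, handles_length hl, handles_zero hl, Finset.card_range,
      Nat.card_Ico] at c1
    rw [handles_zero hl, Finset.card_range] at c0
    have c3 : ((min I.m₁ I.m₂ : ℕ) : ℤ) - g ≤ (handles I.m₁ l i).card := by omega
    have c4 : ((min I.m₁ I.m₂ : ℕ) : ℝ) - g ≤ (handles I.m₁ l i).card := by exact_mod_cast c3
    linarith
  · rw [← hAB.card₁, ← hAB.card₂] at hi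
    rw [hstep i (by omega), Finset.card_singleton]

theorem Input.Presents.lists {d : ℕ} {I : Input d} {A B : Finset (Set (Pt d))}
    (h : I.Presents A B) : I.Lists A B :=
  ⟨h.card₁, h.card₂, h.image₁, h.image₂, h.rep_mem⟩

-- A listing of a set by as many handles as it has elements is injective, so distinct handles denote
-- distinct, hence disjoint, objects.
open scoped Classical in
theorem isFatFamily_of_image {d : ℕ} {obj : ℕ → Set (Pt d)} {f : ℕ} {S : Finset (Set (Pt d))}
    (hS : IsFat f S) (hi : IsIndep S) {H : Finset ℕ} (hc : H.card = S.card)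
    (himg : H.image obj = S) : IsFatFamily obj f H := by
  have hinj : Set.InjOn obj H := Finset.card_image_iff.1 (by rw [himg, hc])
  have hmem : ∀ h ∈ H, obj h ∈ S := fun h hh => himg ▸ Finset.mem_image_of_mem obj hh
  refine ⟨fun h hh h' hh' hne => hi (hmem h hh) (hmem h' hh') fun he => hne (hinj hh hh' he), ?_⟩
  intro c r hr
  obtain ⟨P, hP, hP'⟩ := hS.2 c r hr
  exact ⟨P, hP, fun h hh => hP' _ (hmem h hh)⟩

theorem Input.Lists.isGood {d : ℕ} {I : Input d} {f : ℕ} {A B : Finset (Set (Pt d))}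
    (h : I.Lists A B) (hA : IsFat f A) (hB : IsFat f B) (hA' : IsIndep A) (hB' : IsIndep B) :
    I.IsGood f := by
  classical
  refine ⟨fun i hi => ?_, h.rep_mem, isFatFamily_of_image hA hA' (by simpa using h.card₁) h.image₁,
    isFatFamily_of_image hB hB' (by simpa using h.card₂) h.image₂⟩
  rcases lt_or_ge i I.m₁ with h1 | h1
  · refine hA.1 _ ?_
    rw [← h.image₁]
    exact Finset.mem_image_of_mem _ (by simpa using h1)
  · refine hB.1 _ ?_
    rw [← h.image₂]
    exact Finset.mem_image_of_mem _ (by simpa using ⟨h1, hi⟩)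

/-- Needed for the existence of a MIX when no input is given. The program reads neither centers nor
sides, so these can be filled with zeros. -/
theorem exists_lists {d f : ℕ} {A B : Finset (Set (Pt d))} (hA : IsFat f A) (hB : IsFat f B) :
    ∃ I : Input d, I.Lists A B := by
  classical
  set l := A.toList ++ B.toList with hl
  have hlen : l.length = A.card + B.card := by simp [hl]
  have hobj : ∀ i (hi : i < A.card + B.card), l.getD i ∅ = l[i] := fun i hi =>
    List.getD_eq_getElem _ _ (by omega)
  let R : ℕ → Pt d := fun i => if h : (l.getD i ∅).Nonempty then h.some else 0
  refine ⟨⟨A.card, B.card, fun i => l.getD i ∅, R, fun _ => 0, fun _ => 0⟩,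
    rfl, rfl, ?_, ?_, fun i hi => ?_⟩
  · ext X
    simp only [Finset.mem_image, Finset.mem_range]
    constructor
    · rintro ⟨i, hi, rfl⟩
      rw [hobj i (by omega), List.getElem_append_left (by simpa using hi)]
      exact Finset.mem_toList.1 (List.getElem_mem _)
    · intro hX
      obtain ⟨i, hi, rfl⟩ := List.mem_iff_getElem.1 (Finset.mem_toList.2 hX)
      have hi' : i < A.card := by simpa using hi
      exact ⟨i, hi', by rw [hobj i (by omega), List.getElem_append_left hi]⟩
  · ext X
    simp only [Finset.mem_image, Finset.mem_Ico]
    constructor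
    · rintro ⟨i, hi, rfl⟩
      rw [hobj i hi.2, List.getElem_append_right (by simpa using hi.1)]
      exact Finset.mem_toList.1 (List.getElem_mem _)
    · intro hX
      obtain ⟨i, hi, rfl⟩ := List.mem_iff_getElem.1 (Finset.mem_toList.2 hX)
      have hi' : i < B.card := by simpa using hi
      refine ⟨A.card + i, by omega, ?_⟩
      rw [hobj _ (by omega), List.getElem_append_right (by simp)]
      congr 1; simp
  · have hmem : l.getD i ∅ ∈ l := by
      rw [hobj i hi]; exact List.getElem_mem _
    have hne : (l.getD i ∅).Nonempty := by
      rw [hl, List.mem_append, Finset.mem_toList, Finset.mem_toList] at hmem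
      rcases hmem with h | h
      · exact (hA.1 _ h).1.nonempty
      · exact (hB.1 _ h).1.nonempty
    show R i ∈ l.getD i ∅
    simp only [R, dif_pos hne]
    exact hne.some_mem

/-! ## The bounds -/

/-- By minimality `m - 1` violates the condition, so `(m - 1) ^ d < n ^ (d - 1)` unless `m = 1`;
take `d`-th roots. -/
theorem IsScale.le_rpow {d n m : ℕ} (hd : 1 ≤ d) (h : IsScale d n m) :
    (m : ℝ) ≤ 1 + (n : ℝ) ^ (1 - 1 / (d : ℝ)) := by
  have hpos : 0 ≤ (n : ℝ) ^ (1 - 1 / (d : ℝ)) := by positivity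
  rcases h.2.2.2 with rfl | h4
  · simpa using hpos
  · have hd' : (d : ℝ) ≠ 0 := by exact_mod_cast (by omega : d ≠ 0)
    have h5 : ((m - 1 : ℕ) : ℝ) ^ d ≤ ((n : ℝ) ^ (1 - 1 / (d : ℝ))) ^ d := by
      rw [← Real.rpow_natCast (_ ^ _) d, ← Real.rpow_mul (by positivity)]
      have : (1 - 1 / (d : ℝ)) * d = (d - 1 : ℕ) := by
        rw [Nat.cast_sub hd, sub_mul, one_div, inv_mul_cancel₀ hd']; simp
      rw [this, Real.rpow_natCast]
      exact_mod_cast h4.le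
    have h6 := (pow_le_pow_iff_left₀ (by positivity) hpos (by omega : d ≠ 0)).1 h5
    rw [Nat.cast_sub h.1] at h6
    push_cast at h6; linarith

/-- The bound for the loss. -/
noncomputable def lossBound (d f n : ℕ) : ℝ :=
  sepConst d f * (1 + (n : ℝ) ^ (1 - 1 / (d : ℝ))) *
    (Real.log n / Real.log (((2 ^ (4 * d) : ℕ) : ℝ) / (2 ^ (4 * d) - 1 : ℕ)) + 1)

/-- The bound for the running time per object. -/
noncomputable def timeBound (C d n : ℕ) : ℝ :=
  C * (Real.log n / Real.log 2 +
    Real.log n / Real.log (((2 ^ (4 * d) : ℕ) : ℝ) / (2 ^ (4 * d) - 1 : ℕ)) + 1) + 20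

theorem half_le_log {n : ℕ} (hn : 2 ≤ n) : 1 / 2 ≤ Real.log n := by
  have h1 : Real.log 2 ≤ Real.log n := Real.log_le_log (by norm_num) (by exact_mod_cast hn)
  have := Real.log_two_gt_d9
  linarith

theorem two_le_two_pow {d : ℕ} (hd : 1 ≤ d) : 2 ≤ 2 ^ (4 * d) :=
  calc 2 = 2 ^ 1 := rfl
    _ ≤ 2 ^ (4 * d) := Nat.pow_le_pow_right (by norm_num) (by omega)

theorem lossBound_isBigO {d : ℕ} (hd : 1 ≤ d) (f : ℕ) :
    lossBound d f =O[atTop] (fun n : ℕ => (n : ℝ) ^ (1 - 1 / (d : ℝ)) * Real.log n) := by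
  have hc := log_ratio_pos (two_le_two_pow hd)
  unfold lossBound
  set c := Real.log (((2 ^ (4 * d) : ℕ) : ℝ) / (2 ^ (4 * d) - 1 : ℕ))
  refine IsBigO.of_bound (sepConst d f * 2 * (1 / c + 2)) ?_
  filter_upwards [eventually_ge_atTop 2] with n hn
  have hlog := half_le_log hn
  have hexp : 0 ≤ 1 - 1 / (d : ℝ) := by
    rw [sub_nonneg, div_le_one (by exact_mod_cast (by omega : 0 < d))]
    exact_mod_cast hd
  have hp : 1 ≤ (n : ℝ) ^ (1 - 1 / (d : ℝ)) :=
    Real.one_le_rpow (by exact_mod_cast (by omega : 1 ≤ n)) hexp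
  set p := (n : ℝ) ^ (1 - 1 / (d : ℝ))
  have h1 : Real.log n / c + 1 ≤ (1 / c + 2) * Real.log n := by
    have : Real.log n / c = 1 / c * Real.log n := by ring
    rw [this]; linarith
  have h2 : 0 ≤ Real.log n / c := div_nonneg (by linarith) hc.le
  rw [Real.norm_of_nonneg (by positivity), Real.norm_of_nonneg (by positivity)]
  calc sepConst d f * (1 + p) * (Real.log n / c + 1)
      ≤ sepConst d f * (2 * p) * ((1 / c + 2) * Real.log n) := by
        gcongr; linarith
    _ = _ := by ring

/-- The logarithm is `o(n ^ (1 / d))`, and the two exponents add up to one. -/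
theorem lossBound_isLittleO {d : ℕ} (hd : 1 ≤ d) (f : ℕ) :
    lossBound d f =o[atTop] (fun n : ℕ => (n : ℝ)) := by
  refine (lossBound_isBigO hd f).trans_isLittleO ?_
  have hd' : (0 : ℝ) < d := by exact_mod_cast hd
  have h1 : (fun n : ℕ => Real.log n) =o[atTop] (fun n : ℕ => (n : ℝ) ^ (1 / (d : ℝ))) :=
    (isLittleO_log_rpow_atTop (by positivity)).comp_tendsto tendsto_natCast_atTop_atTop
  refine ((isBigO_refl (fun n : ℕ => (n : ℝ) ^ (1 - 1 / (d : ℝ))) atTop).mul_isLittleO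
    h1).congr' EventuallyEq.rfl ?_
  filter_upwards [eventually_ge_atTop 1] with n hn
  rw [← Real.rpow_add (by exact_mod_cast hn)]
  simp

theorem timeBound_isBigO {d : ℕ} (hd : 1 ≤ d) (C : ℕ) :
    timeBound C d =O[atTop] (fun n : ℕ => Real.log n) := by
  have hc := log_ratio_pos (two_le_two_pow hd)
  unfold timeBound
  set c := Real.log (((2 ^ (4 * d) : ℕ) : ℝ) / (2 ^ (4 * d) - 1 : ℕ))
  have h2 : 0 < Real.log 2 := Real.log_pos (by norm_num)
  refine IsBigO.of_bound (C * (1 / Real.log 2 + 1 / c + 2) + 40) ?_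
  filter_upwards [eventually_ge_atTop 2] with n hn
  have hlog := half_le_log hn
  have h3 : 0 ≤ Real.log n / c := div_nonneg (by linarith) hc.le
  have h4 : 0 ≤ Real.log n / Real.log 2 := div_nonneg (by linarith) h2.le
  rw [Real.norm_of_nonneg (by positivity), Real.norm_of_nonneg (by linarith)]
  calc C * (Real.log n / Real.log 2 + Real.log n / c + 1) + 20
      ≤ C * (Real.log n / Real.log 2 + Real.log n / c + 2 * Real.log n) + 40 * Real.log n := by
        gcongr <;> linarith
    _ = _ := by ring

theorem depth_loss_le {d f n m : ℕ} (hd : 1 ≤ d) (hn : 1 ≤ n) (hm : IsScale d n m) :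
    ((sepConst d f * m * (depth (2 ^ (4 * d)) n + 1) : ℕ) : ℝ) ≤ lossBound d f n := by
  have h1 := depth_le (two_le_two_pow hd) hn
  have h2 := hm.le_rpow hd
  have h3 : 0 ≤ Real.log n := Real.log_nonneg (by exact_mod_cast hn)
  push_cast [lossBound] at h1 ⊢
  gcongr

theorem time_le {C d n t : ℕ} (hd : 1 ≤ d) (hn : 1 ≤ n)
    (ht : t ≤ C * (n * (Nat.log 2 n + depth (2 ^ (4 * d)) n + 1)) + 20 * n) :
    (t : ℝ) ≤ n * timeBound C d n := by
  have h1 := depth_le (two_le_two_pow hd) hn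
  have h2 : (Nat.log 2 n : ℝ) ≤ Real.log n / Real.log 2 := by
    rw [le_div_iff₀ (Real.log_pos (by norm_num)), ← Real.log_pow]
    refine Real.log_le_log (by positivity) ?_
    exact_mod_cast Nat.pow_log_le_self 2 (by omega)
  have ht' : (t : ℝ) ≤ C * (n * (Nat.log 2 n + depth (2 ^ (4 * d)) n + 1)) + 20 * n := by
    exact_mod_cast ht
  refine ht'.trans ?_
  rw [timeBound]
  calc (C : ℝ) * (n * (Nat.log 2 n + depth (2 ^ (4 * d)) n + 1)) + 20 * n
      = n * (C * (Nat.log 2 n + depth (2 ^ (4 * d)) n + 1) + 20) := by ring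
    _ ≤ _ := by gcongr

/-- The computation on an input that lists the two sets. -/
theorem exists_mix {d : ℕ} (hd : 1 ≤ d) (f : ℕ) : ∃ C, ∀ (I : Input d) (A B : Finset (Set (Pt d))),
    IsFat f A → IsFat f B → IsIndep A → IsIndep B → I.Lists A B →
    ∃ (M : ℕ → Finset (Set (Pt d))) (T : ℕ), IsMix A B (lossBound d f (A.card + B.card)) M ∧
      (algorithm d).Realizes I M T ∧
      (1 ≤ A.card + B.card →
        (T : ℝ) ≤ ((A.card + B.card : ℕ) : ℝ) * timeBound C d (A.card + B.card)) := by
  classical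
  obtain ⟨C, hC⟩ := setup_spec hd f
  refine ⟨C, fun I A B hA hB hA' hB' hL => ?_⟩
  have hI := hL.isGood hA hB hA' hB'
  have hn : A.card + B.card = I.m₁ + I.m₂ := by rw [hL.card₁, hL.card₂]
  rw [hn]
  rcases Nat.eq_zero_or_pos (I.m₁ + I.m₂) with h0 | hpos
  · have hb : ¬ Test.Holds I I.initialStore
        (.natLe (.const 1) (.plus (.read 0 (.const 0)) (.read 0 (.const 1)))) := by
      simp only [Test.Holds, NExp.val, Input.initialStore]; simp; omega
    obtain ⟨T, -, hT⟩ := algorithm_runs (.iteFalse hb (.skip _)) rfl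
    -- Without objects the initialization does nothing and the empty list is valid; the bound is
    -- nonnegative because `Real.log 0 = 0`.
    have hG : 0 ≤ lossBound d f (I.m₁ + I.m₂) := by
      rw [h0]
      simp only [lossBound, Nat.cast_zero, Real.log_zero, zero_div, zero_add, mul_one]
      positivity
    obtain ⟨h1, -⟩ := isMix_of_isValid hI hL (l := []) (by rw [h0]; rfl) (isValid_nil I 0)
      (by exact_mod_cast hG)
    exact ⟨_, T, h1, ⟨_, hT, fun i hi => by omega⟩, fun h => by omega⟩
  · obtain ⟨m, t, σ, hm, e, ht, h30, hp, hv⟩ := hC I _ hI rfl hpos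
    obtain ⟨T, hTt, hT⟩ := algorithm_runs e h30
    obtain ⟨h1, h2⟩ := isMix_of_isValid hI hL hp hv (depth_loss_le hd hpos hm)
    refine ⟨_, T, h1, ⟨_, hT, fun i hi => ⟨?_, ?_⟩⟩, fun _ => time_le hd hpos (by omega)⟩
    · exact List.mem_range.1 (hp.mem_iff.1 (mem_seg.2 ⟨i, Nat.zero_le i, hi, rfl⟩))
    · have := h2 i (by simpa using hi)
      rw [getElem_seg, zero_add] at this
      exact this

end FatMix

/-! ### Existence and computation of the MIX. -/

theorem mainTheorem4 (d : ℕ) (hd : 1 ≤ d) (f : ℕ) :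
    ∃ (𝒜 : FatMix.MixAlgorithm d) (Γ γ : ℕ → ℝ),
      Γ =O[atTop] (fun n : ℕ => (n : ℝ) ^ (1 - 1 / (d : ℝ)) * Real.log n) ∧
      Γ =o[atTop] (fun n : ℕ => (n : ℝ)) ∧
      γ =O[atTop] (fun n : ℕ => Real.log n) ∧
      ∀ S₁ S₂ : Finset (Set (FatMix.Pt d)),
        FatMix.IsFat f S₁ → FatMix.IsFat f S₂ → FatMix.IsIndep S₁ → FatMix.IsIndep S₂ →
          (∃ M, FatMix.IsMix S₁ S₂ (Γ (S₁.card + S₂.card)) M) ∧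
          ∀ I : FatMix.Input d, I.Presents S₁ S₂ →
            ∃ (M : ℕ → Finset (Set (FatMix.Pt d))) (T : ℕ),
              FatMix.IsMix S₁ S₂ (Γ (S₁.card + S₂.card)) M ∧
              𝒜.Realizes I M T ∧
              (1 ≤ S₁.card + S₂.card →
                (T : ℝ) ≤ ((S₁.card + S₂.card : ℕ) : ℝ) * γ (S₁.card + S₂.card)) := by
  obtain ⟨C, hC⟩ := FatMix.exists_mix hd f
  refine ⟨FatMix.algorithm d, FatMix.lossBound d f, FatMix.timeBound C d,
    FatMix.lossBound_isBigO hd f, FatMix.lossBound_isLittleO hd f, FatMix.timeBound_isBigO hd C,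
    fun S₁ S₂ h₁ h₂ h₁' h₂' => ⟨?_, fun I hI => hC I S₁ S₂ h₁ h₂ h₁' h₂' hI.lists⟩⟩
  obtain ⟨I, hI⟩ := FatMix.exists_lists h₁ h₂
  obtain ⟨M, -, hM, -⟩ := hC I S₁ S₂ h₁ h₂ h₁' h₂' hI
  exact ⟨M, hM⟩
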